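/- Let $M$ be a smooth manifold of dimension $n$ and $Z\subset M$ a smooth embedded hypersurface, closed as a subset. Let $\mathcal A_Z\to M$ be the b-tangent bundle of $(M,Z)$, i.e. the Lie algebroid of rank $n$ with anchor $\rho:\mathcal A_Z\to TM$ for which $v\mapsto\rho(v)$ is a bijection from the smooth sections of $\mathcal A_Z$ onto the smooth vector fields on $M$ tangent to $Z$. Let $Q=\det(\mathcal A_Z^*)\otimes\det(TM)$ and let $\det(\rho)$ be the section of $Q$ defined by $\Lambda^n\rho:\det(\mathcal A_Z)\to\det(TM)$. Notation. For a line bundle $W\to M$ with a smooth section $s$ vanishing exactly on $Z$, and transversely there (a b-divisor for $Z$), the intrinsic regularisation of $(W,s)$ is the foliation $\mathcal F=\ker d\varphi$ of $W^*\setminus M$ (the complement of the zero section), where $\varphi:W^*\to\mathbb R$ is $\varphi(e)=\langle s,e\rangle$. For the projection $\pi:V\to M$ of a vector bundle, $\pi^!\mathcal A_Z=\{(a,w)\in \mathcal A_Z\times TV:\rho(a)=d\pi(w)\}$, with anchor $(a,w)\mapsto w$. A linear $\mathcal A_Z$-connection $\nabla$ on $V$ defines the Ehresmann connection $\mathrm{hor}^{\nabla}(\mathcal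 A_Z)\subset\pi^!\mathcal A_Z$, the image of the horizontal lift $\mathrm{hor}^\nabla(a)=(a,X)$, where $X$ lifts $\rho(a)$ and $X(\ell_\xi)=\ell_{\nabla^*_a\xi}$ for the linear function $\ell_\xi$ on $V$ defined by a section $\xi$ of $V^*$; here $\nabla^*$ is the dual connection on $V^*$. Then: 1. $(Q,\det(\rho))$ is a b-divisor for $Z$. 2. There is exactly one linear $\mathcal A_Z$-connection $\nabla$ on $Q$ such that $\nabla_v(\alpha\otimes\omega)=\mathcal L_v\alpha\otimes\omega+\alpha\otimes\mathcal L_{\rho(v)}\omega$ for all sections $v$ of $\mathcal A_Z$, $\alpha$ of $\det(\mathcal A_Z^*)$ and all $\omega=Y_1\wedge\dots\wedge Y_n$ with $Y_1,\dots,Y_n$ vector fields. It is flat: it is the canonical $\mathcal A_Z$-representation on $Q$. 3. The Ehresmann connection on $Q^*$ associated to the dual $\nabla^*$ of the canonical representation projects bijectively onto the fibres of $\mathcal A_Z$ (so it is a complement of the vertical bundle of $\pi^!\mathcal A_Z$), and over $Q^*\setminus M$ it is exactly the intrinsic regularisation $\mathcal F$ of the b-divisor $(Q,\det(\rho))$: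 the anchor of $\pi^!\mathcal A_Z$ maps it bijectively, fibre by fibre, onto $\mathcal F$. 4. The Ehresmann connection on $Q$ associated to the canonical representation $\nabla$ itself likewise projects bijectively onto the fibres of $\mathcal A_Z$, and over $Q\setminus M$ the anchor of $\pi^!\mathcal A_Z$ maps it bijectively, fibre by fibre, onto the foliation corresponding to $\mathcal F$ under the canonical diffeomorphism $Q\setminus M\to Q^*\setminus M$, $e\mapsto e^{-1}$, with $\langle e^{-1},e\rangle=1$. -/

import Mathlib

open Bundle Set Topology
open scoped Manifold ContDiff TensorProduct

noncomputable section

/-! ## The line bundle `det(A^*) ⊗ det(B)` -/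

section DetLine

variable {M : Type*} {r n : ℕ}

/-- The fibre at `x` of `det(A^*) ⊗ det(B)`, for vector bundles `A` of rank `r` and `B` of
rank `n`: top-degree alternating forms on `A x`, tensored with the top exterior power of `B x`. -/
def DetLine (r n : ℕ) {M : Type*} (A : M → Type*) (B : M → Type*)
    [∀ x, AddCommGroup (A x)] [∀ x, Module ℝ (A x)]
    [∀ x, AddCommGroup (B x)] [∀ x, Module ℝ (B x)] (x : M) : Type _ :=
  ((A x) [⋀^Fin r]→ₗ[ℝ] ℝ) ⊗[ℝ] (⋀[ℝ]^n (B x))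

variable (A : M → Type*) (B : M → Type*)
  [∀ x, AddCommGroup (A x)] [∀ x, Module ℝ (A x)]
  [∀ x, AddCommGroup (B x)] [∀ x, Module ℝ (B x)]

instance (x : M) : AddCommGroup (DetLine r n A B x) :=
  inferInstanceAs (AddCommGroup (((A x) [⋀^Fin r]→ₗ[ℝ] ℝ) ⊗[ℝ] (⋀[ℝ]^n (B x))))

instance (x : M) : Module ℝ (DetLine r n A B x) :=
  inferInstanceAs (Module ℝ (((A x) [⋀^Fin r]→ₗ[ℝ] ℝ) ⊗[ℝ] (⋀[ℝ]^n (B x))))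

instance (x : M) : TopologicalSpace (DetLine r n A B x) := moduleTopology ℝ _

instance (x : M) : IsModuleTopology ℝ (DetLine r n A B x) := ⟨rfl⟩

instance (x : M) : IsTopologicalAddGroup (DetLine r n A B x) :=
  IsModuleTopology.topologicalAddGroup ℝ _

instance (x : M) : ContinuousSMul ℝ (DetLine r n A B x) :=
  IsModuleTopology.toContinuousSMul ℝ _

variable {A B}

/-- The element `α ⊗ (Y₁ ∧ ⋯ ∧ Yₙ)` of `det(A x ^*) ⊗ det(B x)`. -/
def DetLine.mk {x : M} (α : (A x) [⋀^Fin r]→ₗ[ℝ] ℝ) (Y : Fin n → B x) : DetLine r n A B x :=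
  α ⊗ₜ[ℝ] (exteriorPower.ιMulti ℝ n Y)


variable [TopologicalSpace M] [TopologicalSpace (TotalSpace (EuclideanSpace ℝ (Fin r)) A)]
  [TopologicalSpace (TotalSpace (EuclideanSpace ℝ (Fin n)) B)]

/-- The standard basis of `ℝ^k`. -/
abbrev stdBasis (k : ℕ) : Module.Basis (Fin k) ℝ (EuclideanSpace ℝ (Fin k)) :=
  (EuclideanSpace.basisFun (Fin k) ℝ).toBasis

section Frames

variable (s : Trivialization (EuclideanSpace ℝ (Fin r)) (π (EuclideanSpace ℝ (Fin r)) A))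
  (t : Trivialization (EuclideanSpace ℝ (Fin n)) (π (EuclideanSpace ℝ (Fin n)) B))
  [s.IsLinear ℝ] [t.IsLinear ℝ]

/-- The local frame of `A` given by a local trivialization. -/
def trivFrame (x : M) (i : Fin r) : A x := s.symm x (stdBasis r i)

/-- The local frame of `det(A^*)` dual to the local frame `trivFrame s` of `A`. -/
def trivCovolume (x : M) : (A x) [⋀^Fin r]→ₗ[ℝ] ℝ :=
  (stdBasis r).det.compLinearMap (s.linearMapAt ℝ x)

/-- The local frame of `det(A^*) ⊗ det(B)` given by local trivializations of `A` and `B`. -/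
def DetLine.frame (x : M) : DetLine r n A B x := DetLine.mk (trivCovolume s x) (trivFrame t x)

/-- The coefficient with respect to the local frame `DetLine.frame s t`. -/
def DetLine.coord (x : M) : DetLine r n A B x →ₗ[ℝ] ℝ :=
  TensorProduct.lift
    (((LinearMap.mul ℝ ℝ).compl₂ (exteriorPower.alternatingMapLinearEquiv (trivCovolume t x))) ∘ₗ
      { toFun := fun α : (A x) [⋀^Fin r]→ₗ[ℝ] ℝ => α (trivFrame s x)
        map_add' := fun _ _ => rfl
        map_smul' := fun _ _ => rfl })

set_option linter.unusedSectionVars false in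
lemma DetLine.coord_mk (x : M) (α : (A x) [⋀^Fin r]→ₗ[ℝ] ℝ) (Y : Fin n → B x) :
    DetLine.coord s t x (DetLine.mk α Y) = α (trivFrame s x) * trivCovolume t x Y := by
  simp only [DetLine.coord, DetLine.mk]
  erw [TensorProduct.lift.tmul]
  simp

lemma trivCovolume_trivFrame {x : M} (hx : x ∈ s.baseSet) :
    trivCovolume s x (trivFrame s x) = 1 := by
  have h : (fun i => s.linearMapAt ℝ x (trivFrame s x i)) = stdBasis r := by
    funext i
    rw [trivFrame, ← s.coe_symmₗ (R := ℝ) hx]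
    exact s.linearMapAt_symmₗ (R := ℝ) hx _
  simp only [trivCovolume, AlternatingMap.compLinearMap_apply]
  rw [h, Module.Basis.det_self]

/-- The local frame of `A`, as a basis of the fibre. -/
def trivBasis {x : M} (hx : x ∈ s.baseSet) : Module.Basis (Fin r) ℝ (A x) :=
  (stdBasis r).map (s.linearEquivAt ℝ x hx).symm

lemma trivBasis_apply {x : M} (hx : x ∈ s.baseSet) (i : Fin r) :
    trivBasis s hx i = trivFrame s x i := by
  rfl

lemma coe_trivBasis {x : M} (hx : x ∈ s.baseSet) : ⇑(trivBasis s hx) = trivFrame s x :=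
  funext (trivBasis_apply s hx)

lemma DetLine.coord_frame {x : M} (hs : x ∈ s.baseSet) (ht : x ∈ t.baseSet) :
    DetLine.coord s t x (DetLine.frame s t x) = 1 := by
  simp [DetLine.frame, DetLine.coord_mk, trivCovolume_trivFrame, hs, ht]

lemma eq_smul_trivCovolume {x : M} (hx : x ∈ s.baseSet) (α : (A x) [⋀^Fin r]→ₗ[ℝ] ℝ) :
    α = α (trivFrame s x) • trivCovolume s x := by
  have h1 := α.eq_smul_basis_det (trivBasis s hx)
  have h2 := (trivCovolume s x).eq_smul_basis_det (trivBasis s hx)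
  rw [coe_trivBasis, trivCovolume_trivFrame s hx, one_smul] at h2
  rw [h2, ← coe_trivBasis s hx]
  exact h1

lemma eq_coord_smul_frame {x : M} (hs : x ∈ s.baseSet) (ht : x ∈ t.baseSet)
    (q : DetLine r n A B x) : q = DetLine.coord s t x q • DetLine.frame s t x := by
  have key : (LinearMap.id : DetLine r n A B x →ₗ[ℝ] DetLine r n A B x) =
      (LinearMap.toSpanSingleton ℝ _ (DetLine.frame s t x)) ∘ₗ DetLine.coord s t x := by
    refine TensorProduct.ext' (R := ℝ) (M := (A x) [⋀^Fin r]→ₗ[ℝ] ℝ) (N := ⋀[ℝ]^n (B x)) ?_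
    intro α τ
    let L : ⋀[ℝ]^n (B x) →ₗ[ℝ] DetLine r n A B x :=
      TensorProduct.mk ℝ ((A x) [⋀^Fin r]→ₗ[ℝ] ℝ) (⋀[ℝ]^n (B x)) α
    suffices h : L = ((LinearMap.toSpanSingleton ℝ (DetLine r n A B x) (DetLine.frame s t x)) ∘ₗ
          DetLine.coord s t x) ∘ₗ L by
      exact DFunLike.congr_fun h τ
    apply exteriorPower.linearMap_ext
    apply Module.Basis.ext_alternating (trivBasis t ht)
    intro v hv
    have hα := eq_smul_trivCovolume s hs α
    let e : Equiv.Perm (Fin n) := Equiv.ofBijective v (Finite.injective_iff_bijective.1 hv)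
    have hv' : (fun i => trivBasis t ht (v i)) = trivFrame t x ∘ e := by
      funext i; exact trivBasis_apply t ht _
    have h2 : DetLine.mk (r := r) (n := n) (A := A) α (trivFrame t x ∘ e) =
        DetLine.coord s t x (DetLine.mk α (trivFrame t x ∘ e)) • DetLine.frame s t x := by
      rw [DetLine.coord_mk, AlternatingMap.map_perm, trivCovolume_trivFrame t ht]
      unfold DetLine.frame DetLine.mk
      have e0 : (α (trivFrame s x) • trivCovolume s x) ⊗ₜ[ℝ]
          (exteriorPower.ιMulti ℝ n (trivFrame t x)) = α (trivFrame s x) •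
          (trivCovolume s x ⊗ₜ[ℝ] (exteriorPower.ιMulti ℝ n (trivFrame t x))) :=
        TensorProduct.smul_tmul' _ _ _
      rw [AlternatingMap.map_perm]
      conv_lhs => rw [hα]
      rcases Int.units_eq_one_or (Equiv.Perm.sign e) with h | h <;> rw [h]
      · simp only [one_smul, mul_one]
        exact e0
      · simp only [Units.neg_smul, one_smul, mul_neg, mul_one]
        rw [TensorProduct.tmul_neg, e0]
        exact (neg_smul _ _).symm
    simp only [LinearMap.compAlternatingMap_apply]
    rw [hv']
    exact h2
  exact DFunLike.congr_fun key q

/-- The local trivialization of `det(A^*) ⊗ det(B)` given by local trivializations of `A`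
and `B`. -/
def DetLine.pretrivialization : Pretrivialization ℝ (π ℝ (DetLine r n A B)) where
  toFun p := ⟨p.1, DetLine.coord s t p.1 p.2⟩
  invFun p := ⟨p.1, p.2 • DetLine.frame s t p.1⟩
  source := TotalSpace.proj ⁻¹' (s.baseSet ∩ t.baseSet)
  target := (s.baseSet ∩ t.baseSet) ×ˢ Set.univ
  map_source' := fun ⟨_, _⟩ h => ⟨h, Set.mem_univ _⟩
  map_target' := fun ⟨_, _⟩ h => h.1
  left_inv' := fun ⟨x, q⟩ ⟨h₁, h₂⟩ => by
    simp only [TotalSpace.mk_inj]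
    exact (eq_coord_smul_frame s t h₁ h₂ q).symm
  right_inv' := fun ⟨x, c⟩ ⟨⟨h₁, h₂⟩, _⟩ => by
    simp only [map_smul, DetLine.coord_frame s t h₁ h₂, smul_eq_mul, mul_one]
  open_target := (s.open_baseSet.inter t.open_baseSet).prod isOpen_univ
  baseSet := s.baseSet ∩ t.baseSet
  open_baseSet := s.open_baseSet.inter t.open_baseSet
  source_eq := rfl
  target_eq := rfl
  proj_toFun _ _ := rfl

instance : (DetLine.pretrivialization s t).IsLinear ℝ where
  linear x _ :=
    { map_add := (DetLine.coord s t x).map_add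
      map_smul := (DetLine.coord s t x).map_smul }

lemma DetLine.pretrivialization_symm_apply {x : M} (hx : x ∈ s.baseSet ∩ t.baseSet) (c : ℝ) :
    (DetLine.pretrivialization s t).symm x c = c • DetLine.frame s t x := by
  rw [Pretrivialization.symm_apply _ hx]
  rfl

variable (s' : Trivialization (EuclideanSpace ℝ (Fin r)) (π (EuclideanSpace ℝ (Fin r)) A))
  (t' : Trivialization (EuclideanSpace ℝ (Fin n)) (π (EuclideanSpace ℝ (Fin n)) B))
  [s'.IsLinear ℝ] [t'.IsLinear ℝ]

/-- The transition function of `det(A^*) ⊗ det(B)` between two pairs of trivializations. -/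
def DetLine.transition (x : M) : ℝ :=
  (stdBasis r).det (fun i => (s'.coordChangeL ℝ s x : _ →L[ℝ] _) (stdBasis r i)) *
    (stdBasis n).det (fun i => (t.coordChangeL ℝ t' x : _ →L[ℝ] _) (stdBasis n i))

lemma trivCovolume_trivFrame' {x : M} (hs : x ∈ s.baseSet) (hs' : x ∈ s'.baseSet) :
    trivCovolume s x (trivFrame s' x) =
      (stdBasis r).det (fun i => (s'.coordChangeL ℝ s x : _ →L[ℝ] _) (stdBasis r i)) := by
  simp only [trivCovolume, AlternatingMap.compLinearMap_apply]
  congr 1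
  funext i
  simp only [trivFrame]
  rw [Trivialization.coe_linearMapAt_of_mem _ hs]
  change _ = (s'.coordChangeL ℝ s x) _
  rw [Trivialization.coordChangeL_apply _ _ ⟨hs', hs⟩]

lemma DetLine.coord_frame' {x : M} (hs : x ∈ s.baseSet ∩ t.baseSet)
    (hs' : x ∈ s'.baseSet ∩ t'.baseSet) :
    DetLine.coord s' t' x (DetLine.frame s t x) = DetLine.transition s t s' t' x := by
  rw [DetLine.frame, DetLine.coord_mk, DetLine.transition,
    trivCovolume_trivFrame' s s' hs.1 hs'.1, trivCovolume_trivFrame' t' t hs'.2 hs.2]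

end Frames

variable [∀ x, TopologicalSpace (A x)] [FiberBundle (EuclideanSpace ℝ (Fin r)) A]
  [VectorBundle ℝ (EuclideanSpace ℝ (Fin r)) A]
  [∀ x, TopologicalSpace (B x)] [FiberBundle (EuclideanSpace ℝ (Fin n)) B]
  [VectorBundle ℝ (EuclideanSpace ℝ (Fin n)) B]

lemma continuousOn_det_stdBasis {U : Set M} {k : ℕ}
    {g : M → EuclideanSpace ℝ (Fin k) →L[ℝ] EuclideanSpace ℝ (Fin k)} (hg : ContinuousOn g U) :
    ContinuousOn (fun x => (stdBasis k).det (fun i => g x (stdBasis k i))) U := by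
  have h : ∀ x, (stdBasis k).det (fun i => g x (stdBasis k i)) =
      ∑ σ : Equiv.Perm (Fin k), ((Equiv.Perm.sign σ : ℤ) : ℝ) *
        ∏ i, EuclideanSpace.proj (𝕜 := ℝ) (σ i) (g x (stdBasis k i)) := by
    intro x
    rw [Module.Basis.det_apply, Matrix.det_apply']
    rfl
  simp_rw [h]
  fun_prop

lemma contMDiffOn_det_stdBasis {m : ℕ} [ChartedSpace (EuclideanSpace ℝ (Fin m)) M]
    {U : Set M} {k : ℕ}
    {g : M → EuclideanSpace ℝ (Fin k) →L[ℝ] EuclideanSpace ℝ (Fin k)}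
    (hg : ContMDiffOn (𝓡 m)
      𝓘(ℝ, EuclideanSpace ℝ (Fin k) →L[ℝ] EuclideanSpace ℝ (Fin k)) ∞ g U) :
    ContMDiffOn (𝓡 m) 𝓘(ℝ, ℝ) ∞ (fun x => (stdBasis k).det (fun i => g x (stdBasis k i))) U := by
  have h : ∀ T : EuclideanSpace ℝ (Fin k) →L[ℝ] EuclideanSpace ℝ (Fin k),
      (stdBasis k).det (fun i => T (stdBasis k i)) =
      ∑ σ : Equiv.Perm (Fin k), ((Equiv.Perm.sign σ : ℤ) : ℝ) *
        ∏ i, EuclideanSpace.proj (𝕜 := ℝ) (σ i) (T (stdBasis k i)) := by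
    intro x
    rw [Module.Basis.det_apply, Matrix.det_apply']
    rfl
  have hd : ContDiff ℝ ∞ (fun T : EuclideanSpace ℝ (Fin k) →L[ℝ] EuclideanSpace ℝ (Fin k) =>
      (stdBasis k).det (fun i => T (stdBasis k i))) := by
    simp_rw [h]
    fun_prop
  exact hd.contMDiff.comp_contMDiffOn hg

variable (r n A B) in
/-- The vector prebundle structure on `det(A^*) ⊗ det(B)`. -/
def DetLine.vectorPrebundle : VectorPrebundle ℝ ℝ (DetLine r n A B) where
  pretrivializationAtlas :=
    {e | ∃ (s : Trivialization (EuclideanSpace ℝ (Fin r)) (π (EuclideanSpace ℝ (Fin r)) A))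
      (t : Trivialization (EuclideanSpace ℝ (Fin n)) (π (EuclideanSpace ℝ (Fin n)) B))
      (_ : MemTrivializationAtlas s) (_ : MemTrivializationAtlas t),
        e = DetLine.pretrivialization s t}
  pretrivialization_linear' := by
    rintro _ ⟨s, t, _, _, rfl⟩
    infer_instance
  pretrivializationAt x := DetLine.pretrivialization
    (trivializationAt (EuclideanSpace ℝ (Fin r)) A x)
    (trivializationAt (EuclideanSpace ℝ (Fin n)) B x)
  mem_base_pretrivializationAt x :=
    ⟨mem_baseSet_trivializationAt _ A x, mem_baseSet_trivializationAt _ B x⟩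
  pretrivialization_mem_atlas x :=
    ⟨trivializationAt _ A x, trivializationAt _ B x, inferInstance, inferInstance, rfl⟩
  exists_coordChange := by
    rintro _ ⟨s, t, _, _, rfl⟩ _ ⟨s', t', _, _, rfl⟩
    refine ⟨fun x => DetLine.transition s t s' t' x • ContinuousLinearMap.id ℝ ℝ, ?_, ?_⟩
    · refine ContinuousOn.smul (f := DetLine.transition s t s' t')
        (ContinuousOn.mul ?_ ?_) continuousOn_const
      · exact continuousOn_det_stdBasis ((continuousOn_coordChange ℝ s' s).mono
          (fun x hx => ⟨hx.2.1, hx.1.1⟩))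
      · exact continuousOn_det_stdBasis ((continuousOn_coordChange ℝ t t').mono
          (fun x hx => ⟨hx.1.2, hx.2.2⟩))
    · intro x hx c
      rw [DetLine.pretrivialization_symm_apply s t hx.1]
      change _ = DetLine.coord s' t' x (c • DetLine.frame s t x)
      rw [map_smul, DetLine.coord_frame' s t s' t' hx.1 hx.2]
      simp [mul_comm]
  totalSpaceMk_isInducing := by
    intro x
    let s := trivializationAt (EuclideanSpace ℝ (Fin r)) A x
    let t := trivializationAt (EuclideanSpace ℝ (Fin n)) B x
    have hs : x ∈ s.baseSet := mem_baseSet_trivializationAt _ A x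
    have ht : x ∈ t.baseSet := mem_baseSet_trivializationAt _ B x
    let φ : DetLine r n A B x ≃L[ℝ] ℝ :=
      { toFun := DetLine.coord s t x
        map_add' := map_add _
        map_smul' := map_smul _
        invFun := fun c => c • DetLine.frame s t x
        left_inv := fun q => (eq_coord_smul_frame s t hs ht q).symm
        right_inv := fun c => by simp [DetLine.coord_frame s t hs ht]
        continuous_toFun := IsModuleTopology.continuous_of_linearMap (DetLine.coord s t x)
        continuous_invFun := by fun_prop }
    exact isInducing_const_prod.mpr φ.toHomeomorph.isInducing

instance : TopologicalSpace (TotalSpace ℝ (DetLine r n A B)) :=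
  (DetLine.vectorPrebundle r n A B).totalSpaceTopology

instance : FiberBundle ℝ (DetLine r n A B) := (DetLine.vectorPrebundle r n A B).toFiberBundle

instance : VectorBundle ℝ ℝ (DetLine r n A B) := (DetLine.vectorPrebundle r n A B).toVectorBundle

section Smooth

variable {m : ℕ} [ChartedSpace (EuclideanSpace ℝ (Fin m)) M]
  [ContMDiffVectorBundle ∞ (EuclideanSpace ℝ (Fin r)) A (𝓡 m)]
  [ContMDiffVectorBundle ∞ (EuclideanSpace ℝ (Fin n)) B (𝓡 m)]

instance : (DetLine.vectorPrebundle r n A B).IsContMDiff (𝓡 m) ∞ where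
  exists_contMDiffCoordChange := by
    rintro _ ⟨s, t, _, _, rfl⟩ _ ⟨s', t', _, _, rfl⟩
    refine ⟨fun x => DetLine.transition s t s' t' x • ContinuousLinearMap.id ℝ ℝ, ?_, ?_⟩
    · have h₁ := contMDiffOn_det_stdBasis ((contMDiffOn_coordChangeL (n := ∞) (IB := 𝓡 m) s' s).mono
        (fun x (hx : x ∈ (s.baseSet ∩ t.baseSet) ∩ (s'.baseSet ∩ t'.baseSet)) => ⟨hx.2.1, hx.1.1⟩))
      have h₂ := contMDiffOn_det_stdBasis ((contMDiffOn_coordChangeL (n := ∞) (IB := 𝓡 m) t t').mono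
        (fun x (hx : x ∈ (s.baseSet ∩ t.baseSet) ∩ (s'.baseSet ∩ t'.baseSet)) => ⟨hx.1.2, hx.2.2⟩))
      exact (h₁.mul h₂).smul contMDiffOn_const
    · intro x hx c
      rw [DetLine.pretrivialization_symm_apply s t hx.1]
      change _ = DetLine.coord s' t' x (c • DetLine.frame s t x)
      rw [map_smul, DetLine.coord_frame' s t s' t' hx.1 hx.2]
      simp [mul_comm]

instance : ContMDiffVectorBundle ∞ ℝ (DetLine r n A B) (𝓡 m) :=
  (DetLine.vectorPrebundle r n A B).contMDiffVectorBundle (𝓡 m)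

end Smooth

end DetLine

/-! ## Lie algebroids, connections and representations -/

section Algebroid

variable {n r : ℕ} {M : Type*} [TopologicalSpace M]
  [ChartedSpace (EuclideanSpace ℝ (Fin n)) M] [IsManifold (𝓡 n) ∞ M]

/-- Smooth sections of a vector bundle `V` with model fibre `F`. -/
abbrev SmoothSection (n : ℕ) {M : Type*} [TopologicalSpace M]
    [ChartedSpace (EuclideanSpace ℝ (Fin n)) M] (F : Type*) [NormedAddCommGroup F]
    [NormedSpace ℝ F] (V : M → Type*) [TopologicalSpace (TotalSpace F V)]
    [∀ x, TopologicalSpace (V x)] [FiberBundle F V] : Type _ :=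
  ContMDiffSection (𝓡 n) F ∞ V

/-- Smooth vector fields. -/
abbrev SmoothVectorField (n : ℕ) (M : Type*) [TopologicalSpace M]
    [ChartedSpace (EuclideanSpace ℝ (Fin n)) M] [IsManifold (𝓡 n) ∞ M] : Type _ :=
  SmoothSection n (EuclideanSpace ℝ (Fin n)) (fun x : M => TangentSpace (𝓡 n) x)

variable {A : M → Type*} [∀ x, AddCommGroup (A x)] [∀ x, Module ℝ (A x)]
  [∀ x, TopologicalSpace (A x)] [TopologicalSpace (TotalSpace (EuclideanSpace ℝ (Fin r)) A)]
  [FiberBundle (EuclideanSpace ℝ (Fin r)) A] [VectorBundle ℝ (EuclideanSpace ℝ (Fin r)) A]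
  [ContMDiffVectorBundle ∞ (EuclideanSpace ℝ (Fin r)) A (𝓡 n)]

/-- A Lie algebroid structure on a smooth vector bundle `A → M` of rank `r`: a smooth bundle
morphism `anchor : A → TM` and a Lie bracket on the smooth sections of `A`, satisfying the
Leibniz rule. -/
structure LieAlgebroid (n r : ℕ) {M : Type*} [TopologicalSpace M]
    [ChartedSpace (EuclideanSpace ℝ (Fin n)) M] [IsManifold (𝓡 n) ∞ M]
    (A : M → Type*) [∀ x, AddCommGroup (A x)] [∀ x, Module ℝ (A x)]
    [∀ x, TopologicalSpace (A x)] [TopologicalSpace (TotalSpace (EuclideanSpace ℝ (Fin r)) A)]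
    [FiberBundle (EuclideanSpace ℝ (Fin r)) A] [VectorBundle ℝ (EuclideanSpace ℝ (Fin r)) A]
    [ContMDiffVectorBundle ∞ (EuclideanSpace ℝ (Fin r)) A (𝓡 n)] where
  anchor : ∀ x : M, A x →L[ℝ] TangentSpace (𝓡 n) x
  contMDiff_anchor : ContMDiff (𝓡 n)
    ((𝓡 n).prod 𝓘(ℝ, EuclideanSpace ℝ (Fin r) →L[ℝ] EuclideanSpace ℝ (Fin n))) ∞
    (fun x => TotalSpace.mk' (EuclideanSpace ℝ (Fin r) →L[ℝ] EuclideanSpace ℝ (Fin n))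
      (E := fun x : M => A x →L[ℝ] TangentSpace (𝓡 n) x) x (anchor x))
  bracket : SmoothSection n (EuclideanSpace ℝ (Fin r)) A →ₗ[ℝ]
    SmoothSection n (EuclideanSpace ℝ (Fin r)) A →ₗ[ℝ]
      SmoothSection n (EuclideanSpace ℝ (Fin r)) A
  bracket_self : ∀ v, bracket v v = 0
  jacobi : ∀ u v w, bracket u (bracket v w) = bracket (bracket u v) w + bracket v (bracket u w)
  anchor_bracket : ∀ v w x, anchor x (bracket v w x) =
    VectorField.mlieBracket (𝓡 n) (fun y => anchor y (v y)) (fun y => anchor y (w y)) x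
  leibniz : ∀ (f : M → ℝ), ContMDiff (𝓡 n) 𝓘(ℝ, ℝ) ∞ f →
    ∀ v w w' : SmoothSection n (EuclideanSpace ℝ (Fin r)) A, (∀ x, w' x = f x • w x) →
      ∀ x, bracket v w' x =
        f x • bracket v w x + (mvfderiv (𝓡 n) f x (anchor x (v x))) • w x

namespace LieAlgebroid

variable (𝒜 : LieAlgebroid n r A)

/-- The smooth vector field `ρ(v)`. -/
def anchorSection (v : SmoothSection n (EuclideanSpace ℝ (Fin r)) A) : SmoothVectorField n M :=
  ⟨fun x => 𝒜.anchor x (v x), ContMDiff.clm_bundle_apply 𝒜.contMDiff_anchor v.contMDiff⟩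

/-- The derivative of the function `f` at `x` in the direction `ρ(a)`, for `a ∈ A x`. -/
def lieDerivFun (f : M → ℝ) (x : M) (a : A x) : ℝ := mvfderiv (𝓡 n) f x (𝒜.anchor x a)

/-- A top-degree `A`-form `α`, i.e. a section of `det(A^*)`, is smooth if its values on smooth
sections of `A` are smooth functions. -/
def IsSmoothForm (α : ∀ x, (A x) [⋀^Fin r]→ₗ[ℝ] ℝ) : Prop :=
  ∀ a : Fin r → SmoothSection n (EuclideanSpace ℝ (Fin r)) A,
    ContMDiff (𝓡 n) 𝓘(ℝ, ℝ) ∞ (fun x => α x (fun i => a i x))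

/-- `β` is the Lie derivative `ℒ_v α` of the top-degree `A`-form `α`:
`(ℒ_v α)(a₁, …, a_r) = ρ(v)(α(a₁, …, a_r)) - ∑ᵢ α(a₁, …, [v, aᵢ], …, a_r)`. -/
def IsLieDerivForm (v : SmoothSection n (EuclideanSpace ℝ (Fin r)) A)
    (α β : ∀ x, (A x) [⋀^Fin r]→ₗ[ℝ] ℝ) : Prop :=
  ∀ (a : Fin r → SmoothSection n (EuclideanSpace ℝ (Fin r)) A) (x : M),
    β x (fun i => a i x) = 𝒜.lieDerivFun (fun y => α y (fun i => a i y)) x (v x) -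
      ∑ i, α x (Function.update (fun j => a j x) i (𝒜.bracket v (a i) x))

end LieAlgebroid

/-- A linear connection of the Lie algebroid `𝒜` on the vector bundle `V`. -/
structure AConnection (𝒜 : LieAlgebroid n r A) (F : Type*) [NormedAddCommGroup F]
    [NormedSpace ℝ F] (V : M → Type*) [∀ x, AddCommGroup (V x)] [∀ x, Module ℝ (V x)]
    [∀ x, TopologicalSpace (V x)] [TopologicalSpace (TotalSpace F V)]
    [FiberBundle F V] [VectorBundle ℝ F V] where
  conn : SmoothSection n (EuclideanSpace ℝ (Fin r)) A →ₗ[ℝ] SmoothSection n F V →ₗ[ℝ]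
    SmoothSection n F V
  smul_left : ∀ (f : M → ℝ), ContMDiff (𝓡 n) 𝓘(ℝ, ℝ) ∞ f →
    ∀ v v' : SmoothSection n (EuclideanSpace ℝ (Fin r)) A, (∀ x, v' x = f x • v x) →
      ∀ σ x, conn v' σ x = f x • conn v σ x
  leibniz : ∀ (f : M → ℝ), ContMDiff (𝓡 n) 𝓘(ℝ, ℝ) ∞ f →
    ∀ (v) (σ σ' : SmoothSection n F V), (∀ x, σ' x = f x • σ x) →
      ∀ x, conn v σ' x = f x • conn v σ x + 𝒜.lieDerivFun f x (v x) • σ x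

/-- The fibre at `e`, with `x = π(e)`, of the pullback Lie algebroid `π^! 𝒜` of `𝒜` to the total
space of a vector bundle `V`: pairs `(a, w)` with `a ∈ A x`, `w` tangent at `e` to the total
space, and `ρ(a) = dπ(w)`. -/
def pullbackAlgebroid (𝒜 : LieAlgebroid n r A) (F : Type*) [NormedAddCommGroup F]
    [NormedSpace ℝ F] (V : M → Type*)
    [∀ x, TopologicalSpace (V x)] [TopologicalSpace (TotalSpace F V)]
    [FiberBundle F V] (e : TotalSpace F V) :
    Submodule ℝ (A e.proj × TangentSpace ((𝓡 n).prod 𝓘(ℝ, F)) e) :=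
  LinearMap.eqLocus ((𝒜.anchor e.proj).toLinearMap ∘ₗ LinearMap.fst ℝ _ _)
    ((mfderiv ((𝓡 n).prod 𝓘(ℝ, F)) (𝓡 n) (TotalSpace.proj : TotalSpace F V → M) e).toLinearMap ∘ₗ
      LinearMap.snd ℝ _ _)

namespace AConnection

variable {𝒜 : LieAlgebroid n r A} {F : Type*} [NormedAddCommGroup F]
    [NormedSpace ℝ F] {V : M → Type*} [∀ x, AddCommGroup (V x)] [∀ x, Module ℝ (V x)]
    [∀ x, TopologicalSpace (V x)] [∀ x, IsTopologicalAddGroup (V x)]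
    [∀ x, ContinuousSMul ℝ (V x)] [TopologicalSpace (TotalSpace F V)]
    [FiberBundle F V] [VectorBundle ℝ F V]

/-- The connection is flat, i.e. a representation of `𝒜` on `V`. -/
def IsFlat (D : AConnection 𝒜 F V) : Prop :=
  ∀ u v σ, D.conn u (D.conn v σ) - D.conn v (D.conn u σ) - D.conn (𝒜.bracket u v) σ = 0

/-- The Ehresmann connection on the total space of `V` defined by the linear connection `∇` on `V`.
The horizontal lift of a section `a` of `A` is the pair `(a, X)`, where the vector field `X` lifts
`ρ(a)` and acts on the linear function `ℓ_ξ(e) = ⟨ξ, e⟩` defined by a section `ξ` of `V^*` by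
`X(ℓ_ξ) = ℓ_{∇^*_a ξ}`, with `∇^*` the dual connection:
`⟨∇^*_a ξ, σ⟩ = ρ(a)⟨ξ, σ⟩ - ⟨ξ, ∇_a σ⟩`. -/
def ehresmann (D : AConnection 𝒜 F V) (e : TotalSpace F V) :
    Submodule ℝ (A e.proj × TangentSpace ((𝓡 n).prod 𝓘(ℝ, F)) e) where
  carrier := {z | z ∈ pullbackAlgebroid 𝒜 F V e ∧
    ∃ a : SmoothSection n (EuclideanSpace ℝ (Fin r)) A, a e.proj = z.1 ∧
      ∀ (ξ : SmoothSection n (F →L[ℝ] ℝ) (fun x => V x →L[ℝ] ℝ)) (σ : SmoothSection n F V),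
        σ e.proj = e.2 →
        mvfderiv ((𝓡 n).prod 𝓘(ℝ, F)) (fun e' : TotalSpace F V => ξ e'.proj e'.2) e z.2 =
          𝒜.lieDerivFun (fun x => ξ x (σ x)) e.proj (a e.proj) - ξ e.proj (D.conn a σ e.proj)}
  add_mem' := by
    rintro z z' ⟨h, a, ha, H⟩ ⟨h', a', ha', H'⟩
    refine ⟨add_mem h h', a + a', by simp [ha, ha'], fun ξ σ hσ => ?_⟩
    simp only [Prod.snd_add, map_add, H ξ σ hσ, H' ξ σ hσ, LinearMap.add_apply,
      ContMDiffSection.coe_add, Pi.add_apply, LieAlgebroid.lieDerivFun]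
    ring
  zero_mem' := by
    refine ⟨zero_mem _, 0, by simp, fun ξ σ hσ => ?_⟩
    simp [LieAlgebroid.lieDerivFun]
  smul_mem' := by
    rintro c z ⟨h, a, ha, H⟩
    refine ⟨Submodule.smul_mem _ c h, c • a, by simp [ha], fun ξ σ hσ => ?_⟩
    simp only [Prod.smul_snd, map_smul, H ξ σ hσ, LinearMap.smul_apply,
      ContMDiffSection.coe_smul, Pi.smul_apply, LieAlgebroid.lieDerivFun, smul_eq_mul]
    ring

/-- The Ehresmann connection on the total space of `V^*` defined by the dual `∇^*` of the linear
connection `∇` on `V`. The linear functions on the total space of `V^*` are the functions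
`ℓ_σ(e) = ⟨e, σ⟩` for sections `σ` of `V`, the dual of `∇^*` is `∇`, and so the horizontal lift of
a section `a` of `A` is `(a, X)`, where `X` lifts `ρ(a)` and `X(ℓ_σ) = ℓ_{∇_a σ}`. -/
def dualEhresmann (D : AConnection 𝒜 F V)
    (e : TotalSpace (F →L[ℝ] ℝ) (fun x => V x →L[ℝ] ℝ)) :
    Submodule ℝ (A e.proj × TangentSpace ((𝓡 n).prod 𝓘(ℝ, F →L[ℝ] ℝ)) e) where
  carrier := {z | z ∈ pullbackAlgebroid 𝒜 (F →L[ℝ] ℝ) (fun x => V x →L[ℝ] ℝ) e ∧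
    ∃ a : SmoothSection n (EuclideanSpace ℝ (Fin r)) A, a e.proj = z.1 ∧
      ∀ σ : SmoothSection n F V,
        mvfderiv ((𝓡 n).prod 𝓘(ℝ, F →L[ℝ] ℝ))
          (fun e' : TotalSpace (F →L[ℝ] ℝ) (fun x => V x →L[ℝ] ℝ) => e'.2 (σ e'.proj)) e z.2 =
            e.2 (D.conn a σ e.proj)}
  add_mem' := by
    rintro z z' ⟨h, a, ha, H⟩ ⟨h', a', ha', H'⟩
    refine ⟨add_mem h h', a + a', by simp [ha, ha'], fun σ => ?_⟩
    rw [Prod.snd_add, ContinuousLinearMap.map_add, H σ, H' σ, map_add, LinearMap.add_apply,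
      ContMDiffSection.coe_add, Pi.add_apply, ContinuousLinearMap.map_add]
  zero_mem' := by
    refine ⟨zero_mem _, 0, by simp, fun σ => ?_⟩
    rw [Prod.snd_zero, ContinuousLinearMap.map_zero, map_zero, LinearMap.zero_apply,
      ContMDiffSection.coe_zero, Pi.zero_apply, ContinuousLinearMap.map_zero]
  smul_mem' := by
    rintro c z ⟨h, a, ha, H⟩
    refine ⟨Submodule.smul_mem _ c h, c • a, by simp [ha], fun σ => ?_⟩
    rw [Prod.smul_snd, ContinuousLinearMap.map_smul, H σ, map_smul, LinearMap.smul_apply,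
      ContMDiffSection.coe_smul, Pi.smul_apply, ContinuousLinearMap.map_smul]

end AConnection

/-! ### The canonical representation -/

/-- The line bundle `Q = det(A^*) ⊗ det(TM)`. -/
abbrev CanonicalBundle (n r : ℕ) {M : Type*} [TopologicalSpace M]
    [ChartedSpace (EuclideanSpace ℝ (Fin n)) M] (A : M → Type*)
    [∀ x, AddCommGroup (A x)] [∀ x, Module ℝ (A x)] : M → Type _ :=
  DetLine r n A (fun x : M => TangentSpace (𝓡 n) x)

/-- `∇` is the canonical connection on `Q = det(A^*) ⊗ det(TM)`:
`∇_v (α ⊗ ω) = ℒ_v α ⊗ ω + α ⊗ ℒ_{ρ(v)} ω`, where for `ω = Y₁ ∧ ⋯ ∧ Yₙ` one has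
`ℒ_X ω = ∑ⱼ Y₁ ∧ ⋯ ∧ [X, Yⱼ] ∧ ⋯ ∧ Yₙ`. -/
def IsCanonicalConnection {𝒜 : LieAlgebroid n r A}
    (D : AConnection 𝒜 ℝ (CanonicalBundle n r A)) : Prop :=
  ∀ (v : SmoothSection n (EuclideanSpace ℝ (Fin r)) A) (α β : ∀ x, (A x) [⋀^Fin r]→ₗ[ℝ] ℝ)
    (Y : Fin n → SmoothVectorField n M) (σ : SmoothSection n ℝ (CanonicalBundle n r A)),
    LieAlgebroid.IsSmoothForm (n := n) α → 𝒜.IsLieDerivForm v α β →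
    (∀ x, σ x = DetLine.mk (α x) (fun j => Y j x)) →
    ∀ x, D.conn v σ x = DetLine.mk (β x) (fun j => Y j x) +
      ∑ j, DetLine.mk (α x) (Function.update (fun i => Y i x) j
        (VectorField.mlieBracket (𝓡 n) (𝒜.anchorSection v) (Y j) x))

end Algebroid

/-! ## Hypersurfaces, b-tangent bundles, b-divisors and the intrinsic regularisation -/

section BGeometry

variable {n : ℕ} {M : Type*} [TopologicalSpace M]
  [ChartedSpace (EuclideanSpace ℝ (Fin n)) M]

/-- `f` is a defining function for `Z` near `p`: it is smooth with nowhere vanishing differential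
on a neighbourhood of `p`, in which `Z` is the zero set of `f`. -/
def IsDefiningFunctionAt (n : ℕ) {M : Type*} [TopologicalSpace M]
    [ChartedSpace (EuclideanSpace ℝ (Fin n)) M] (Z : Set M) (f : M → ℝ) (p : M) : Prop :=
  ∃ U : Set M, IsOpen U ∧ p ∈ U ∧ ContMDiffOn (𝓡 n) 𝓘(ℝ, ℝ) ∞ f U ∧
    ∀ x ∈ U, (x ∈ Z ↔ f x = 0) ∧ mvfderiv (𝓡 n) f x ≠ 0

/-- `Z` is a smooth hypersurface, embedded in `M` as a closed subset. -/
def IsHypersurface (n : ℕ) {M : Type*} [TopologicalSpace M]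
    [ChartedSpace (EuclideanSpace ℝ (Fin n)) M] (Z : Set M) : Prop :=
  IsClosed Z ∧ ∀ p ∈ Z, ∃ f, IsDefiningFunctionAt n Z f p

/-- The vector `w ∈ T_p M`, with `p ∈ Z`, is tangent to the hypersurface `Z`. -/
def IsTangentVector (Z : Set M) (p : M) (w : TangentSpace (𝓡 n) p) : Prop :=
  ∀ f, IsDefiningFunctionAt n Z f p → mvfderiv (𝓡 n) f p w = 0

/-- `𝒜` is the b-tangent bundle of `(M, Z)`: the Lie algebroid whose sections are, via the anchor,
precisely the vector fields tangent to `Z`. -/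
def IsBTangentBundle [IsManifold (𝓡 n) ∞ M] {A : M → Type*} [∀ x, AddCommGroup (A x)]
    [∀ x, Module ℝ (A x)] [∀ x, TopologicalSpace (A x)]
    [TopologicalSpace (TotalSpace (EuclideanSpace ℝ (Fin n)) A)]
    [FiberBundle (EuclideanSpace ℝ (Fin n)) A] [VectorBundle ℝ (EuclideanSpace ℝ (Fin n)) A]
    [ContMDiffVectorBundle ∞ (EuclideanSpace ℝ (Fin n)) A (𝓡 n)]
    (Z : Set M) (𝒜 : LieAlgebroid n n A) : Prop :=
  Function.Injective 𝒜.anchorSection ∧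
    Set.range 𝒜.anchorSection = {X | ∀ p ∈ Z, IsTangentVector Z p (X p)}

section Divisor

variable {W : M → Type*} [∀ x, AddCommGroup (W x)] [∀ x, Module ℝ (W x)]
  [∀ x, TopologicalSpace (W x)] [∀ x, IsTopologicalAddGroup (W x)]
  [∀ x, ContinuousSMul ℝ (W x)] [TopologicalSpace (TotalSpace ℝ W)]
  [FiberBundle ℝ W] [VectorBundle ℝ ℝ W]

/-- `(W, s)` is a b-divisor for `Z`: `s` is a smooth section of the line bundle `W` whose zero
set is `Z` and which vanishes transversely. -/
def IsBDivisor (n : ℕ) {M : Type*} [TopologicalSpace M]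
    [ChartedSpace (EuclideanSpace ℝ (Fin n)) M] {W : M → Type*}
    [∀ x, AddCommGroup (W x)] [∀ x, Module ℝ (W x)]
    [∀ x, TopologicalSpace (W x)] [∀ x, IsTopologicalAddGroup (W x)]
    [∀ x, ContinuousSMul ℝ (W x)] [TopologicalSpace (TotalSpace ℝ W)]
    [FiberBundle ℝ W] [VectorBundle ℝ ℝ W] (Z : Set M) (s : ∀ x, W x) : Prop :=
  ContMDiff (𝓡 n) ((𝓡 n).prod 𝓘(ℝ, ℝ)) ∞ (fun x => TotalSpace.mk' ℝ x (s x)) ∧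
    (∀ x, s x = 0 ↔ x ∈ Z) ∧
    ∀ x ∈ Z, ∃ ξ : SmoothSection n (ℝ →L[ℝ] ℝ) (fun x => W x →L[ℝ] ℝ),
      mvfderiv (𝓡 n) (fun y => ξ y (s y)) x ≠ 0

/-- The intrinsic regularisation of the b-divisor `(W, s)`, at a point `e` of the total space of
`W^*` outside the zero section: the foliation tangent to `ker dφ`, where `φ(e) = ⟨s, e⟩`. -/
def intrinsicRegularisation (n : ℕ) {M : Type*} [TopologicalSpace M]
    [ChartedSpace (EuclideanSpace ℝ (Fin n)) M] {W : M → Type*}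
    [∀ x, AddCommGroup (W x)] [∀ x, Module ℝ (W x)]
    [∀ x, TopologicalSpace (W x)] [∀ x, IsTopologicalAddGroup (W x)]
    [∀ x, ContinuousSMul ℝ (W x)] [TopologicalSpace (TotalSpace ℝ W)]
    [FiberBundle ℝ W] [VectorBundle ℝ ℝ W] (s : ∀ x, W x)
    (e : TotalSpace (ℝ →L[ℝ] ℝ) (fun x => W x →L[ℝ] ℝ)) :
    Submodule ℝ (TangentSpace ((𝓡 n).prod 𝓘(ℝ, ℝ →L[ℝ] ℝ)) e) :=
  LinearMap.ker (mvfderiv ((𝓡 n).prod 𝓘(ℝ, ℝ →L[ℝ] ℝ))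
    (fun e' : TotalSpace (ℝ →L[ℝ] ℝ) (fun x => W x →L[ℝ] ℝ) => e'.2 (s e'.proj)) e).toLinearMap

open Classical in
/-- The fibrewise inversion `W \ M → W^* \ M` of a line bundle `W`, sending `e ≠ 0` to the
functional `e⁻¹` with `⟨e⁻¹, e⟩ = 1` (and the zero section to the zero section). -/
def fibrewiseInverse (e : TotalSpace ℝ W) :
    TotalSpace (ℝ →L[ℝ] ℝ) (fun x => W x →L[ℝ] ℝ) :=
  ⟨e.proj, if h : ∃ ξ : W e.proj →L[ℝ] ℝ, ξ e.2 = 1 then h.choose else 0⟩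

/-- The foliation on `W \ M` corresponding to the intrinsic regularisation of the b-divisor
`(W, s)` under the fibrewise inversion `W \ M → W^* \ M`, at the point `e`. -/
def inverseIntrinsicRegularisation (n : ℕ) {M : Type*} [TopologicalSpace M]
    [ChartedSpace (EuclideanSpace ℝ (Fin n)) M] {W : M → Type*}
    [∀ x, AddCommGroup (W x)] [∀ x, Module ℝ (W x)]
    [∀ x, TopologicalSpace (W x)] [∀ x, IsTopologicalAddGroup (W x)]
    [∀ x, ContinuousSMul ℝ (W x)] [TopologicalSpace (TotalSpace ℝ W)]
    [FiberBundle ℝ W] [VectorBundle ℝ ℝ W] (s : ∀ x, W x) (e : TotalSpace ℝ W) :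
    Submodule ℝ (TangentSpace ((𝓡 n).prod 𝓘(ℝ, ℝ)) e) :=
  (intrinsicRegularisation n s (fibrewiseInverse e)).comap
    (mfderiv ((𝓡 n).prod 𝓘(ℝ, ℝ)) ((𝓡 n).prod 𝓘(ℝ, ℝ →L[ℝ] ℝ))
      (fibrewiseInverse (W := W)) e).toLinearMap

end Divisor

/-- The section `det(ρ)` of `Q = det(A^*) ⊗ det(TM)`: it is `a^* ⊗ (ρ(a₁) ∧ ⋯ ∧ ρ(aₙ))`, for any
basis `a₁, …, aₙ` of `A x` with dual volume form `a^*`. -/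
def detAnchor [IsManifold (𝓡 n) ∞ M] {A : M → Type*} [∀ x, AddCommGroup (A x)]
    [∀ x, Module ℝ (A x)] [∀ x, TopologicalSpace (A x)]
    [TopologicalSpace (TotalSpace (EuclideanSpace ℝ (Fin n)) A)]
    [FiberBundle (EuclideanSpace ℝ (Fin n)) A] [VectorBundle ℝ (EuclideanSpace ℝ (Fin n)) A]
    [ContMDiffVectorBundle ∞ (EuclideanSpace ℝ (Fin n)) A (𝓡 n)]
    (𝒜 : LieAlgebroid n n A) (x : M) : CanonicalBundle n n A x :=
  DetLine.mk (trivCovolume (trivializationAt (EuclideanSpace ℝ (Fin n)) A x) x)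
    (fun i => 𝒜.anchor x (trivFrame (trivializationAt (EuclideanSpace ℝ (Fin n)) A x) x i))

end BGeometry

end

/-! Everything rests on one identity: for sections b₁, …, bₙ of `A` and a top form α, the element α
⊗ ρ(b₁) ∧ ⋯ ∧ ρ(bₙ) equals α(b₁, …, bₙ) det(ρ) (`mk_anchor_eq_smul_detAnchor`). Off Z the anchor is
invertible, so det(ρ) trivialises Q there. In this trivialisation the bracket terms of the form and
of the multivector cancel, and the canonical formula becomes the connection for which det(ρ) is
parallel (`parallelConn_mkSection`). The complement of Z is dense, so smooth sections are determined
by their values off Z. The canonical formula is smooth across Z, hence it extends the parallel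
connection over Z (`exists_conn`), and linearity, the Leibniz rule and flatness need checking only
off Z. Uniqueness holds because every section of Q is locally a function times some α ⊗ ω.

Transversality: near a point of Z with defining function f and a field W with df(W) ≠ 0, the fields
df(W)Y + (f - 1) df(Y)W are tangent to Z, so they lift to `A`. The endomorphism taking Y to this
field has determinant df(W)ⁿ f. Applied to a frame, the identity exhibits f times a nonvanishing
section of Q as a smooth multiple of det(ρ), which therefore cannot vanish to second order
(`mvfderiv_detAnchor_ne_zero`).

Foliation: since ∇ det(ρ) = 0, horizontal vectors of ∇* annihilate φ = ⟨det(ρ), ·⟩. For the converse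
write det(ρ) = g q with q a local generator; then g defines Z. At a point of Z the kernel of ρ is a
line spanned by the value of some ε with ρ(ε) = g dg(W) W. Expanding 0 = ∇_ε(g q) off Z and dividing
by g gives ∇_ε q = -(dg(W))² q, also on Z by continuity. So the kernel of the anchor moves the fibre
of Q* and supplies the vertical direction of ker dφ (`exists_anchor_eq_zero_conn_ne_zero`,
`exists_anchor_eq_conn_eq`). The statement on Q follows by differentiating ⟨ξ, e⟩⟨e⁻¹, q⟩ = ⟨ξ, q⟩,
which shows that the fibrewise inversion matches the two Ehresmann connections. -/

noncomputable section

/-! ### Derivatives, cut-offs and tensoriality on manifolds -/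

section Toolkit

set_option linter.unusedSectionVars false

variable {n : ℕ} {M : Type*} [TopologicalSpace M]
  [ChartedSpace (EuclideanSpace ℝ (Fin n)) M]

lemma mvfderiv_congr_of_eventuallyEq {E H : Type*} [NormedAddCommGroup E] [NormedSpace ℝ E]
    [TopologicalSpace H] {I : ModelWithCorners ℝ E H} {N : Type*} [TopologicalSpace N]
    [ChartedSpace H N] {f g : N → ℝ} {x : N} (h : f =ᶠ[𝓝 x] g) :
    mvfderiv I f x = mvfderiv I g x := by
  ext v
  change mfderiv I 𝓘(ℝ, ℝ) f x v = mfderiv I 𝓘(ℝ, ℝ) g x v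
  rw [h.mfderiv_eq]
  rfl

lemma mvfderiv_mul_apply {E H : Type*} [NormedAddCommGroup E] [NormedSpace ℝ E]
    [TopologicalSpace H] {I : ModelWithCorners ℝ E H} {N : Type*} [TopologicalSpace N]
    [ChartedSpace H N] {f g : N → ℝ} {x : N} (hf : MDifferentiableAt I 𝓘(ℝ, ℝ) f x)
    (hg : MDifferentiableAt I 𝓘(ℝ, ℝ) g x) (w : TangentSpace I x) :
    mvfderiv I (fun y => f y * g y) x w = f x * mvfderiv I g x w + g x * mvfderiv I f x w := by
  have := mvfderiv_mul hf hg
  change mvfderiv I (f * g) x w = _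
  rw [this]
  simp

variable [IsManifold (𝓡 n) ∞ M]

lemma contMDiffOn_mvfderiv_apply {U : Set M} (hU : IsOpen U) {f : M → ℝ}
    (hf : ContMDiffOn (𝓡 n) 𝓘(ℝ, ℝ) ∞ f U) (X : SmoothVectorField n M) :
    ContMDiffOn (𝓡 n) 𝓘(ℝ, ℝ) ∞ (fun x => mvfderiv (𝓡 n) f x (X x)) U := by
  have h1 := hf.contMDiffOn_tangentMapWithin (m := ∞) (by simp) hU.uniqueMDiffOn
  have h2 := (contMDiff_snd_tangentBundle_modelSpace (n := ∞) ℝ 𝓘(ℝ, ℝ)).comp_contMDiffOn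
    (h1.comp (s := U) X.contMDiff.contMDiffOn (fun x hx => hx))
  refine h2.congr fun x hx => ?_
  change _ = mfderivWithin (𝓡 n) 𝓘(ℝ, ℝ) f U x (X x)
  rw [mfderivWithin_of_isOpen hU hx]
  rfl

lemma contMDiff_mvfderiv_apply {f : M → ℝ}
    (hf : ContMDiff (𝓡 n) 𝓘(ℝ, ℝ) ∞ f) (X : SmoothVectorField n M) :
    ContMDiff (𝓡 n) 𝓘(ℝ, ℝ) ∞ (fun x => mvfderiv (𝓡 n) f x (X x)) := by
  rw [← contMDiffOn_univ] at hf ⊢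
  exact contMDiffOn_mvfderiv_apply isOpen_univ hf X

variable [T2Space M]

lemma exists_bump {U : Set M} {p : M} (hU : U ∈ 𝓝 p) :
    ∃ χ : M → ℝ, ContMDiff (𝓡 n) 𝓘(ℝ, ℝ) ∞ χ ∧ (∀ᶠ y in 𝓝 p, χ y = 1) ∧ tsupport χ ⊆ U := by
  obtain ⟨χ, -, h⟩ := (SmoothBumpFunction.nhds_basis_tsupport (I := 𝓡 n) p).mem_iff.1 hU
  exact ⟨χ, χ.contMDiff, χ.eventuallyEq_one, h⟩

/-- Brackets and connections take only globally defined functions and sections as arguments, so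
local data is replaced by global data with the same germ at `p`. -/
lemma exists_contMDiff_eventuallyEq {U : Set M} (hU : IsOpen U) {p : M} (hp : p ∈ U) {f : M → ℝ}
    (hf : ContMDiffOn (𝓡 n) 𝓘(ℝ, ℝ) ∞ f U) :
    ∃ g : M → ℝ, ContMDiff (𝓡 n) 𝓘(ℝ, ℝ) ∞ g ∧ (∀ᶠ y in 𝓝 p, g y = f y) ∧ ∀ y ∉ U, g y = 0 := by
  obtain ⟨χ, h1, h2, h3⟩ := exists_bump (n := n) (hU.mem_nhds hp)
  refine ⟨fun y => χ y * f y, ?_, ?_, ?_⟩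
  · apply contMDiff_of_tsupport
    intro x hx
    have hx' : x ∈ U := h3 (closure_mono (fun y hy => by
      simp only [Function.mem_support] at hy ⊢; exact left_ne_zero_of_mul hy) hx)
    exact h1.contMDiffAt.mul (hf.contMDiffAt (hU.mem_nhds hx'))
  · filter_upwards [h2] with y hy
    simp [hy]
  · intro y hy
    simp [image_eq_zero_of_notMem_tsupport (fun h => hy (h3 h))]

variable {F : Type*} [NormedAddCommGroup F] [NormedSpace ℝ F]
  {V : M → Type*} [TopologicalSpace (TotalSpace F V)]
  [∀ x, AddCommGroup (V x)] [∀ x, Module ℝ (V x)] [∀ x, TopologicalSpace (V x)]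
  [FiberBundle F V] [VectorBundle ℝ F V]

/-- The product of a smooth function and a smooth section. -/
def funSmul (f : M → ℝ) (hf : ContMDiff (𝓡 n) 𝓘(ℝ, ℝ) ∞ f) (v : SmoothSection n F V) :
    SmoothSection n F V :=
  ⟨fun x => f x • v x, hf.smul_section v.contMDiff⟩

@[simp]
lemma funSmul_apply (f : M → ℝ) (hf : ContMDiff (𝓡 n) 𝓘(ℝ, ℝ) ∞ f) (v : SmoothSection n F V)
    (x : M) : funSmul f hf v x = f x • v x := rfl

lemma exists_smoothSection_eventuallyEq {U : Set M} (hU : IsOpen U) {p : M} (hp : p ∈ U)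
    {σ : ∀ x, V x}
    (hσ : ContMDiffOn (𝓡 n) ((𝓡 n).prod 𝓘(ℝ, F)) ∞ (fun x => TotalSpace.mk' F x (σ x)) U) :
    ∃ s : SmoothSection n F V, (∀ᶠ y in 𝓝 p, s y = σ y) ∧ ∀ y ∉ U, s y = 0 := by
  obtain ⟨χ, h1, h2, h3⟩ := exists_bump (n := n) (hU.mem_nhds hp)
  refine ⟨⟨χ • σ, ContMDiffOn.smul_section_of_tsupport h1.contMDiffOn hU h3 hσ⟩, ?_, ?_⟩
  · filter_upwards [h2] with y hy
    simp [hy]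
  · intro y hy
    simp [image_eq_zero_of_notMem_tsupport (fun h => hy (h3 h))]

variable [ContMDiffVectorBundle ∞ F V (𝓡 n)]

/-- A section constant in a trivialization, cut off by a bump function. The support condition
matters later: with `U` the complement of Z it yields fields that are tangent to Z because they
vanish there. -/
lemma exists_smoothSection_apply_eq {U : Set M} (hU : IsOpen U) {p : M} (hp : p ∈ U) (v : V p) :
    ∃ s : SmoothSection n F V, s p = v ∧ ∀ y ∉ U, s y = 0 := by
  let t := trivializationAt F V p
  have hpt : p ∈ t.baseSet := mem_baseSet_trivializationAt F V p
  have hs : ContMDiffOn (𝓡 n) ((𝓡 n).prod 𝓘(ℝ, F)) ∞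
      (fun x => TotalSpace.mk' F x (FiberBundle.extend F v x)) t.baseSet := by
    rw [t.contMDiffOn_section_baseSet_iff]
    apply (contMDiffOn_const (c := (t ⟨p, v⟩).2)).congr
    intro y hy
    simp only [FiberBundle.extend]
    rw [t.apply_mk_symm hy]
  obtain ⟨s, h1, h2⟩ := exists_smoothSection_eventuallyEq (hU.inter t.open_baseSet) ⟨hp, hpt⟩
    (hs.mono inter_subset_right)
  exact ⟨s, by simpa using h1.self_of_nhds, fun y hy => h2 y fun h => hy h.1⟩

variable [FiniteDimensional ℝ F]

lemma exists_frame (p : M) (t : Trivialization F (π F V)) [MemTrivializationAtlas t]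
    (hp : p ∈ t.baseSet) {ι : Type*} (b : Module.Basis ι ℝ F) :
    ∃ e : ι → SmoothSection n F V, ∀ i, ∀ᶠ y in 𝓝 p, e i y = t.symm y (b i) := by
  have h : ∀ i, ∃ s : SmoothSection n F V, ∀ᶠ y in 𝓝 p, s y = t.symm y (b i) := by
    intro i
    obtain ⟨s, hs, -⟩ := exists_smoothSection_eventuallyEq t.open_baseSet hp
      (t.contMDiffOn_localFrame_baseSet (I := 𝓡 n) ∞ b i)
    refine ⟨s, ?_⟩
    filter_upwards [hs, t.open_baseSet.mem_nhds hp] with y hy hyt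
    rw [hy, t.localFrame_apply_of_mem_baseSet b hyt]
    rfl
  choose e he using h
  exact ⟨e, he⟩

/-- A `C^∞`-linear map on sections, valued at `p`, vanishes on sections which vanish at `p`. -/
lemma eq_zero_of_tensorial {G : Type*} [AddCommGroup G] [Module ℝ G] {p : M}
    (L : SmoothSection n F V →ₗ[ℝ] G)
    (hL : ∀ (f : M → ℝ) (hf : ContMDiff (𝓡 n) 𝓘(ℝ, ℝ) ∞ f) (v : SmoothSection n F V),
      L (funSmul f hf v) = f p • L v)
    {v : SmoothSection n F V} (hv : v p = 0) : L v = 0 := by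
  let t := trivializationAt F V p
  have hpt : p ∈ t.baseSet := mem_baseSet_trivializationAt F V p
  let b := Module.finBasis ℝ F
  have : ContMDiffVectorBundle 1 F V (𝓡 n) := ContMDiffVectorBundle.of_le (n := ∞) (by simp)
  have hc : ∀ i, ∃ g : M → ℝ, ContMDiff (𝓡 n) 𝓘(ℝ, ℝ) ∞ g ∧
      (∀ᶠ y in 𝓝 p, g y = t.localFrameCoeff (𝓡 n) b i y (v y)) ∧ ∀ y ∉ t.baseSet, g y = 0 :=
    fun i => exists_contMDiff_eventuallyEq t.open_baseSet hpt
      (contMDiffOn_baseSet_localFrameCoeff b v.contMDiff.contMDiffOn i)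
  choose g hg1 hg2 _ using hc
  obtain ⟨e, he⟩ := exists_frame (n := n) p t hpt b
  -- `w` has the germ of `v` at `p` and is a global combination of global sections, with
  -- coefficients vanishing at `p`; hence `L w = 0` by tensoriality.
  let w : SmoothSection n F V := ∑ i, funSmul (g i) (hg1 i) (e i)
  have hw : ∀ᶠ y in 𝓝 p, v y - w y = 0 := by
    filter_upwards [Filter.eventually_all.2 hg2, Filter.eventually_all.2 he,
      t.eventually_eq_localFrame_sum_coeff_smul (I := 𝓡 n) b hpt (s := v),
      t.open_baseSet.mem_nhds hpt] with y h1 h2 h3 hy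
    rw [sub_eq_zero, h3]
    have : w y = ∑ i, g i y • e i y := by
      change (∑ i, funSmul (g i) (hg1 i) (e i) : SmoothSection n F V) y = _
      rw [← ContMDiffSection.coeAddHom_apply, map_sum, Finset.sum_apply]
      rfl
    rw [this]
    refine Finset.sum_congr rfl fun i _ => ?_
    rw [h1, h2, t.localFrame_apply_of_mem_baseSet b hy]
    rfl
  have hw0 : L w = 0 := by
    simp only [w, map_sum, hL]
    refine Finset.sum_eq_zero fun i _ => ?_
    rw [(hg2 i).self_of_nhds, hv, map_zero, zero_smul]
  -- It remains to see that `L` is local: `v - w` vanishes wherever χ ≠ 0, so it is unchanged by the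
  -- factor `1 - χ`, which is zero at `p`.
  obtain ⟨χ, h1, h2, h3⟩ := exists_bump (n := n) hw
  have h1' : ContMDiff (𝓡 n) 𝓘(ℝ, ℝ) ∞ (fun y => 1 - χ y) := contMDiff_const.sub h1
  have key : v - w = funSmul _ h1' (v - w) := by
    ext y
    by_cases hy : v y - w y = 0
    · simp [hy]
    · simp [image_eq_zero_of_notMem_tsupport (fun h => hy (h3 h))]
  have : L (v - w) = 0 := by
    rw [key, hL, h2.self_of_nhds]
    simp
  rwa [map_sub, hw0, sub_zero] at this

end Toolkit

/-! ### Linear algebra of top exterior powers -/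

section DetLineAlgebra

set_option linter.unusedSectionVars false

variable {M : Type*} {r n : ℕ} {A B : M → Type*}
  [∀ x, AddCommGroup (A x)] [∀ x, Module ℝ (A x)]
  [∀ x, AddCommGroup (B x)] [∀ x, Module ℝ (B x)]

lemma DetLine.mk_smul_left {x : M} (c : ℝ) (α : (A x) [⋀^Fin r]→ₗ[ℝ] ℝ) (Y : Fin n → B x) :
    DetLine.mk (c • α) Y = c • DetLine.mk α Y :=
  (TensorProduct.smul_tmul' c α _).symm

/-- An injective choice of n indices among n is a permutation, so an alternating map in n arguments
is fixed by its value on one ordered basis. -/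
lemma alternatingMap_eq_det_smul {E G : Type*} [AddCommGroup E] [Module ℝ E] [AddCommGroup G]
    [Module ℝ G] (a : Module.Basis (Fin n) ℝ E) (g : E [⋀^Fin n]→ₗ[ℝ] G) (b : Fin n → E) :
    g b = a.det b • g a := by
  have : g = (LinearMap.toSpanSingleton ℝ G (g a)).compAlternatingMap a.det := by
    refine Module.Basis.ext_alternating a fun v hv => ?_
    let e : Equiv.Perm (Fin n) := Equiv.ofBijective v (Finite.injective_iff_bijective.1 hv)
    have h : (fun i => a (v i)) = a ∘ e := rfl
    rw [h, AlternatingMap.map_perm, AlternatingMap.map_perm]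
    simp [a.det_self]
  conv_lhs => rw [this]
  rfl

/-- The element `α ⊗ (ρ(b₁) ∧ ⋯ ∧ ρ(bₙ))` is the multiple `α(b₁, …, bₙ)` of `a^* ⊗ Λⁿρ(a)`. -/
lemma DetLine.mk_map_eq_smul {x : M} (ρ : A x →ₗ[ℝ] B x) (a : Module.Basis (Fin n) ℝ (A x))
    (α₀ : (A x) [⋀^Fin n]→ₗ[ℝ] ℝ) (h₀ : α₀ a = 1) (α : (A x) [⋀^Fin n]→ₗ[ℝ] ℝ)
    (b : Fin n → A x) :
    DetLine.mk α (fun i => ρ (b i)) = α b • DetLine.mk (B := B) α₀ (fun i => ρ (a i)) := by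
  have h1 : α = α a • α₀ := by
    ext c
    rw [alternatingMap_eq_det_smul a α c, AlternatingMap.smul_apply,
      alternatingMap_eq_det_smul a α₀ c, h₀]
    simp [mul_comm]
  have h2 := alternatingMap_eq_det_smul a ((exteriorPower.ιMulti ℝ n).compLinearMap ρ) b
  have h3 : DetLine.mk (r := n) α₀ (fun i => ρ (b i)) =
      a.det b • DetLine.mk (A := A) (B := B) α₀ (fun i => ρ (a i)) := by
    unfold DetLine.mk
    refine Eq.trans ?_ (TensorProduct.tmul_smul (a.det b) α₀ _)
    exact congrArg (fun z => α₀ ⊗ₜ[ℝ] z) h2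
  conv_lhs => rw [h1]
  rw [DetLine.mk_smul_left, h3, smul_smul, alternatingMap_eq_det_smul a α b, smul_eq_mul, mul_comm]

end DetLineAlgebra

/-! ### Smoothness of sections of the determinant line -/

section DetLineSmooth

set_option linter.unusedSectionVars false

variable {n m r : ℕ} {M : Type*} [TopologicalSpace M]
  [ChartedSpace (EuclideanSpace ℝ (Fin m)) M] {A B : M → Type*}
  [∀ x, AddCommGroup (A x)] [∀ x, Module ℝ (A x)]
  [∀ x, AddCommGroup (B x)] [∀ x, Module ℝ (B x)]
  [TopologicalSpace (TotalSpace (EuclideanSpace ℝ (Fin r)) A)]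
  [TopologicalSpace (TotalSpace (EuclideanSpace ℝ (Fin n)) B)]
  [∀ x, TopologicalSpace (A x)] [FiberBundle (EuclideanSpace ℝ (Fin r)) A]
  [VectorBundle ℝ (EuclideanSpace ℝ (Fin r)) A]
  [∀ x, TopologicalSpace (B x)] [FiberBundle (EuclideanSpace ℝ (Fin n)) B]
  [VectorBundle ℝ (EuclideanSpace ℝ (Fin n)) B]

lemma DetLine.contMDiffAt_section_iff (σ : ∀ x, DetLine r n A B x) (p : M) :
    ContMDiffAt (𝓡 m) ((𝓡 m).prod 𝓘(ℝ, ℝ)) ∞ (fun x => TotalSpace.mk' ℝ x (σ x)) p ↔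
      ContMDiffAt (𝓡 m) 𝓘(ℝ, ℝ) ∞ (fun x =>
        DetLine.coord (trivializationAt (EuclideanSpace ℝ (Fin r)) A p)
        (trivializationAt (EuclideanSpace ℝ (Fin n)) B p) x (σ x)) p := by
  rw [contMDiffAt_section]
  rfl

variable [ContMDiffVectorBundle ∞ (EuclideanSpace ℝ (Fin n)) B (𝓡 m)]

/-- In the trivialization the expression is a determinant, a polynomial in the smooth components of
the `Y i`. -/
lemma contMDiffAt_trivCovolume {p : M} (Y : Fin n → ∀ x, B x)
    (hY : ∀ i, ContMDiffAt (𝓡 m) ((𝓡 m).prod 𝓘(ℝ, EuclideanSpace ℝ (Fin n))) ∞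
      (fun x => TotalSpace.mk' (EuclideanSpace ℝ (Fin n)) x (Y i x)) p)
    (t : Trivialization (EuclideanSpace ℝ (Fin n)) (π (EuclideanSpace ℝ (Fin n)) B))
    [MemTrivializationAtlas t] (hp : p ∈ t.baseSet) :
    ContMDiffAt (𝓡 m) 𝓘(ℝ, ℝ) ∞ (fun x => trivCovolume t x (fun i => Y i x)) p := by
  have h : ∀ x ∈ t.baseSet, trivCovolume t x (fun i => Y i x) =
      ∑ σ : Equiv.Perm (Fin n), ((Equiv.Perm.sign σ : ℤ) : ℝ) *
        ∏ i, EuclideanSpace.proj (𝕜 := ℝ) (σ i) (t ⟨x, Y i x⟩).2 := by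
    intro x hx
    simp only [trivCovolume, AlternatingMap.compLinearMap_apply]
    rw [Module.Basis.det_apply, Matrix.det_apply']
    refine Finset.sum_congr rfl fun σ _ => ?_
    congr 1
    refine Finset.prod_congr rfl fun i _ => ?_
    rw [Trivialization.coe_linearMapAt_of_mem _ hx]
    rfl
  have h2 : ∀ i, ContMDiffAt (𝓡 m) 𝓘(ℝ, EuclideanSpace ℝ (Fin n)) ∞
      (fun x => (t ⟨x, Y i x⟩).2) p := fun i => (t.contMDiffAt_section_iff hp).1 (hY i)
  have h3 : ∀ i j, ContMDiffAt (𝓡 m) 𝓘(ℝ, ℝ) ∞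
      (fun x => EuclideanSpace.proj (𝕜 := ℝ) j (t ⟨x, Y i x⟩).2) p := fun i j =>
    (EuclideanSpace.proj (𝕜 := ℝ) j : EuclideanSpace ℝ (Fin n) →L[ℝ] ℝ).contMDiff.contMDiffAt.comp
      p (h2 i)
  refine ContMDiffAt.congr_of_eventuallyEq ?_
    (Filter.eventuallyEq_of_mem (t.open_baseSet.mem_nhds hp) h)
  refine ContMDiffAt.sum fun σ _ => contMDiffAt_const.mul ?_
  exact contMDiffAt_finsetProd fun i _ => h3 i (σ i)

end DetLineSmooth

/-! ### Lie derivatives of top-degree forms of a Lie algebroid -/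

section LieDerivative

set_option linter.unusedSectionVars false

variable {n r : ℕ} {M : Type*} [TopologicalSpace M] [T2Space M]
  [ChartedSpace (EuclideanSpace ℝ (Fin n)) M] [IsManifold (𝓡 n) ∞ M]
  {A : M → Type*} [∀ x, AddCommGroup (A x)] [∀ x, Module ℝ (A x)]
  [∀ x, TopologicalSpace (A x)] [TopologicalSpace (TotalSpace (EuclideanSpace ℝ (Fin r)) A)]
  [FiberBundle (EuclideanSpace ℝ (Fin r)) A] [VectorBundle ℝ (EuclideanSpace ℝ (Fin r)) A]
  [ContMDiffVectorBundle ∞ (EuclideanSpace ℝ (Fin r)) A (𝓡 n)]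

lemma update_eval (a : Fin r → SmoothSection n (EuclideanSpace ℝ (Fin r)) A) (i : Fin r)
    (w : SmoothSection n (EuclideanSpace ℝ (Fin r)) A) (y : M) :
    (fun j => Function.update a i w j y) = Function.update (fun j => a j y) i (w y) := by
  funext j
  by_cases h : j = i
  · subst h; simp
  · simp [h]

/-- Evaluation of smooth sections at a point. -/
def sectionEval (x : M) : SmoothSection n (EuclideanSpace ℝ (Fin r)) A →ₗ[ℝ] A x where
  toFun v := v x
  map_add' _ _ := rfl
  map_smul' _ _ := rfl

lemma sectionEval_surjective (x : M) :
    Function.Surjective (sectionEval (n := n) (r := r) (A := A) x) := fun u => by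
  obtain ⟨s, hs, -⟩ := exists_smoothSection_apply_eq (n := n)
    (F := EuclideanSpace ℝ (Fin r)) isOpen_univ (mem_univ x) u
  exact ⟨s, hs⟩

namespace LieAlgebroid

variable (𝒜 : LieAlgebroid n r A)

lemma bracket_funSmul (f : M → ℝ) (hf : ContMDiff (𝓡 n) 𝓘(ℝ, ℝ) ∞ f)
    (v w : SmoothSection n (EuclideanSpace ℝ (Fin r)) A) (x : M) :
    𝒜.bracket v (funSmul f hf w) x = f x • 𝒜.bracket v w x + 𝒜.lieDerivFun f x (v x) • w x :=
  𝒜.leibniz f hf v w _ (fun _ => rfl) x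

lemma IsSmoothForm.mdifferentiableAt {α : ∀ x, (A x) [⋀^Fin r]→ₗ[ℝ] ℝ}
    (hα : IsSmoothForm (n := n) α) (a : Fin r → SmoothSection n (EuclideanSpace ℝ (Fin r)) A)
    (x : M) : MDifferentiableAt (𝓡 n) 𝓘(ℝ, ℝ) (fun y => α y (fun i => a i y)) x :=
  (hα a).contMDiffAt.mdifferentiableAt (by simp)

/-- The directional derivative part of the Lie derivative of a form. -/
def lieDerivTransport {α : ∀ x, (A x) [⋀^Fin r]→ₗ[ℝ] ℝ} (hα : IsSmoothForm (n := n) α)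
    (v : SmoothSection n (EuclideanSpace ℝ (Fin r)) A) (x : M) :
    MultilinearMap ℝ (fun _ : Fin r => SmoothSection n (EuclideanSpace ℝ (Fin r)) A) ℝ where
  toFun a := 𝒜.lieDerivFun (fun y => α y (fun i => a i y)) x (v x)
  map_update_add' {inst} a i w w' := by
    obtain rfl : inst = instDecidableEqFin r := Subsingleton.elim _ _
    have h : (fun y => α y (fun j => Function.update a i (w + w') j y)) =
        (fun y => α y (fun j => Function.update a i w j y)) +
          fun y => α y (fun j => Function.update a i w' j y) := by
      funext y
      simp only [update_eval, Pi.add_apply, ContMDiffSection.coe_add, AlternatingMap.map_update_add]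
    simp only [lieDerivFun, h]
    rw [mvfderiv_add (hα.mdifferentiableAt _ x) (hα.mdifferentiableAt _ x)]
    rfl
  map_update_smul' {inst} a i c w := by
    obtain rfl : inst = instDecidableEqFin r := Subsingleton.elim _ _
    have h : (fun y => α y (fun j => Function.update a i (c • w) j y)) =
        fun y => (fun _ : M => c) y * (fun y => α y (fun j => Function.update a i w j y)) y := by
      funext y
      simp only [update_eval, Pi.smul_apply, ContMDiffSection.coe_smul,
        AlternatingMap.map_update_smul, smul_eq_mul]
    simp only [lieDerivFun]
    rw [h, mvfderiv_mul_apply mdifferentiableAt_const (hα.mdifferentiableAt _ x), mvfderiv_const]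
    simp

/-- The part of the Lie derivative of a form which involves brackets. -/
def lieDerivBracket (α : ∀ x, (A x) [⋀^Fin r]→ₗ[ℝ] ℝ)
    (v : SmoothSection n (EuclideanSpace ℝ (Fin r)) A) (x : M) :
    MultilinearMap ℝ (fun _ : Fin r => SmoothSection n (EuclideanSpace ℝ (Fin r)) A) ℝ :=
  ∑ i, (α x).toMultilinearMap.compLinearMap
    (fun j => if j = i then sectionEval x ∘ₗ 𝒜.bracket v else sectionEval x)

lemma lieDerivBracket_apply (α : ∀ x, (A x) [⋀^Fin r]→ₗ[ℝ] ℝ)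
    (v : SmoothSection n (EuclideanSpace ℝ (Fin r)) A) (x : M)
    (a : Fin r → SmoothSection n (EuclideanSpace ℝ (Fin r)) A) :
    𝒜.lieDerivBracket α v x a =
      ∑ i, α x (Function.update (fun j => a j x) i (𝒜.bracket v (a i) x)) := by
  simp only [lieDerivBracket, sum_apply, MultilinearMap.compLinearMap_apply]
  refine Finset.sum_congr rfl fun i _ => ?_
  change α x _ = _
  congr 1
  funext j
  by_cases h : j = i
  · subst h; simp [sectionEval]
  · simp [h, sectionEval]

/-- The Lie derivative of a smooth form, as an alternating map on sections. -/
def lieDerivAlternating {α : ∀ x, (A x) [⋀^Fin r]→ₗ[ℝ] ℝ} (hα : IsSmoothForm (n := n) α)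
    (v : SmoothSection n (EuclideanSpace ℝ (Fin r)) A) (x : M) :
    SmoothSection n (EuclideanSpace ℝ (Fin r)) A [⋀^Fin r]→ₗ[ℝ] ℝ where
  toMultilinearMap := 𝒜.lieDerivTransport hα v x - 𝒜.lieDerivBracket α v x
  map_eq_zero_of_eq' a i j hij hne := by
    change 𝒜.lieDerivTransport hα v x a - 𝒜.lieDerivBracket α v x a = 0
    have h1 : 𝒜.lieDerivTransport hα v x a = 0 := by
      have h : (fun y => α y (fun i => a i y)) = 0 := by
        funext y
        exact (α y).map_eq_zero_of_eq _ (by simp [hij]) hne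
      change mvfderiv (𝓡 n) (fun y => α y (fun i => a i y)) x _ = 0
      rw [h, mvfderiv_zero]
      rfl
    -- With `a i = a j`, every term other than the `i`-th and the `j`-th still has a repeated
    -- argument. The remaining two differ by the transposition of `i` and `j`, so they cancel.
    rw [h1, lieDerivBracket_apply, Fintype.sum_eq_add i j hne, zero_sub, neg_eq_zero]
    · have h2 : Function.update (fun k => a k x) j (𝒜.bracket v (a j) x) =
          Function.update (fun k => a k x) i (𝒜.bracket v (a i) x) ∘ Equiv.swap i j := by
        funext k
        by_cases hi : k = i
        · subst hi; simp [hne, hne.symm, hij]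
        · by_cases hj : k = j
          · subst hj; simp [hij]
          · simp [hi, hj, Equiv.swap_apply_of_ne_of_ne hi hj]
      rw [h2, AlternatingMap.map_swap _ _ hne, add_neg_cancel]
    · rintro k ⟨hi, hj⟩
      exact (α x).map_eq_zero_of_eq _ (by simp [hi.symm, hj.symm, hij]) hne

lemma lieDerivAlternating_apply {α : ∀ x, (A x) [⋀^Fin r]→ₗ[ℝ] ℝ} (hα : IsSmoothForm (n := n) α)
    (v : SmoothSection n (EuclideanSpace ℝ (Fin r)) A) (x : M)
    (a : Fin r → SmoothSection n (EuclideanSpace ℝ (Fin r)) A) :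
    𝒜.lieDerivAlternating hα v x a = 𝒜.lieDerivFun (fun y => α y (fun i => a i y)) x (v x) -
      ∑ i, α x (Function.update (fun j => a j x) i (𝒜.bracket v (a i) x)) := by
  rw [← lieDerivBracket_apply]
  rfl

/-- Tensoriality in each slot: multiplying an argument by `f` produces ρ(v)(f) once from
differentiating the value of the form and once from the bracket in that slot, with opposite signs.
-/
lemma lieDerivAlternating_update_eq_zero {α : ∀ x, (A x) [⋀^Fin r]→ₗ[ℝ] ℝ}
    (hα : IsSmoothForm (n := n) α) (v : SmoothSection n (EuclideanSpace ℝ (Fin r)) A) (x : M)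
    (a : Fin r → SmoothSection n (EuclideanSpace ℝ (Fin r)) A) (i : Fin r)
    {w : SmoothSection n (EuclideanSpace ℝ (Fin r)) A} (hw : w x = 0) :
    𝒜.lieDerivAlternating hα v x (Function.update a i w) = 0 := by
  refine eq_zero_of_tensorial (p := x)
    ((𝒜.lieDerivAlternating hα v x).toMultilinearMap.toLinearMap a i) ?_ hw
  intro f hf w
  change 𝒜.lieDerivAlternating hα v x (Function.update a i (funSmul f hf w)) =
    f x • 𝒜.lieDerivAlternating hα v x (Function.update a i w)
  have h : (fun y => α y (fun j => Function.update a i (funSmul f hf w) j y)) =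
      fun y => f y * (fun y => α y (fun j => Function.update a i w j y)) y := by
    funext y
    simp only [update_eval, funSmul_apply, AlternatingMap.map_update_smul, smul_eq_mul]
  rw [lieDerivAlternating_apply, lieDerivAlternating_apply, h]
  simp only [lieDerivFun]
  rw [mvfderiv_mul_apply (hf.contMDiffAt.mdifferentiableAt (by simp)) (hα.mdifferentiableAt _ x)]
  -- Only the summand whose bracket hits the slot `i` sees the derivative of `f`; in the others `f`
  -- is a scalar pulled out of the form.
  have h2 : ∀ k, α x (Function.update (fun j => Function.update a i (funSmul f hf w) j x) k
        (𝒜.bracket v (Function.update a i (funSmul f hf w) k) x)) =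
      f x * α x (Function.update (fun j => Function.update a i w j x) k
        (𝒜.bracket v (Function.update a i w k) x)) +
      if k = i then 𝒜.lieDerivFun f x (v x) * α x (fun j => Function.update a i w j x) else 0 := by
    intro k
    by_cases hk : k = i
    · subst hk
      simp only [update_eval, Function.update_idem, Function.update_self, if_true, bracket_funSmul,
        AlternatingMap.map_update_add, AlternatingMap.map_update_smul, smul_eq_mul]
    · simp only [hk, if_false, add_zero, update_eval, Function.update_of_ne hk, funSmul_apply]
      rw [Function.update_comm (Ne.symm hk), Function.update_comm (Ne.symm hk),
        AlternatingMap.map_update_smul, smul_eq_mul]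
  simp only [h2, Finset.sum_add_distrib, Finset.sum_ite_eq', Finset.mem_univ, if_true,
    ← Finset.mul_sum, lieDerivFun, smul_eq_mul]
  ring

/-- Expand `b + (a - b)` multilinearly: every term except the pure `b` term has some argument that
vanishes at `x`. -/
lemma lieDerivAlternating_congr {α : ∀ x, (A x) [⋀^Fin r]→ₗ[ℝ] ℝ}
    (hα : IsSmoothForm (n := n) α) (v : SmoothSection n (EuclideanSpace ℝ (Fin r)) A) (x : M)
    {a b : Fin r → SmoothSection n (EuclideanSpace ℝ (Fin r)) A} (h : ∀ i, a i x = b i x) :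
    𝒜.lieDerivAlternating hα v x a = 𝒜.lieDerivAlternating hα v x b := by
  classical
  have h1 : a = b + (a - b) := by simp
  have h2 := (𝒜.lieDerivAlternating hα v x).toMultilinearMap.map_add_univ b (a - b)
  rw [← h1] at h2
  refine h2.trans ((Finset.sum_eq_single Finset.univ ?_ (by simp)).trans (by simp))
  intro s _ hs
  obtain ⟨i, hi⟩ : ∃ i, i ∉ s := by
    by_contra! hc
    exact hs (Finset.eq_univ_iff_forall.2 hc)
  have h3 : s.piecewise b (a - b) = Function.update (s.piecewise b (a - b)) i ((a - b) i) := by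
    rw [eq_comm, Function.update_eq_self_iff]
    simp [hi]
  rw [h3]
  exact 𝒜.lieDerivAlternating_update_eq_zero hα v x _ i (by
    change a i x - b i x = 0
    rw [h, sub_self])

lemma exists_isLieDerivForm {α : ∀ x, (A x) [⋀^Fin r]→ₗ[ℝ] ℝ}
    (hα : IsSmoothForm (n := n) α) (v : SmoothSection n (EuclideanSpace ℝ (Fin r)) A) :
    ∃ β : ∀ x, (A x) [⋀^Fin r]→ₗ[ℝ] ℝ, 𝒜.IsLieDerivForm v α β := by
  -- The form is obtained by extending vectors linearly to sections, separately at each `x`. The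
  -- extensions need not vary smoothly with `x`, because the value depends on the sections only
  -- through their values at `x`.
  have h : ∀ x, ∃ g : A x →ₗ[ℝ] SmoothSection n (EuclideanSpace ℝ (Fin r)) A,
      sectionEval x ∘ₗ g = LinearMap.id := fun x =>
    (sectionEval x).exists_rightInverse_of_surjective
      (LinearMap.range_eq_top.2 (sectionEval_surjective x))
  choose g hg using h
  refine ⟨fun x => (𝒜.lieDerivAlternating hα v x).compLinearMap (g x), fun a x => ?_⟩
  rw [← lieDerivAlternating_apply _ hα, AlternatingMap.compLinearMap_apply]
  exact 𝒜.lieDerivAlternating_congr hα v x fun i => DFunLike.congr_fun (hg x) (a i x)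

lemma IsLieDerivForm.isSmoothForm {𝒜 : LieAlgebroid n r A} {α β : ∀ x, (A x) [⋀^Fin r]→ₗ[ℝ] ℝ}
    {v : SmoothSection n (EuclideanSpace ℝ (Fin r)) A}
    (hα : IsSmoothForm (n := n) α) (h : 𝒜.IsLieDerivForm v α β) :
    IsSmoothForm (n := n) β := by
  intro a
  simp only [h a]
  refine ContMDiff.sub (contMDiff_mvfderiv_apply (hα a) (𝒜.anchorSection v)) ?_
  refine ContMDiff.sum fun i _ => ?_
  have := hα (Function.update a i (𝒜.bracket v (a i)))
  simpa only [update_eval] using this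

end LieAlgebroid

/-- Smooth forms and vector fields define smooth sections of the line bundle `Q`. -/
lemma contMDiff_detLine_mk {α : ∀ x, (A x) [⋀^Fin r]→ₗ[ℝ] ℝ}
    (hα : LieAlgebroid.IsSmoothForm (n := n) α) (Y : Fin n → SmoothVectorField n M) :
    ContMDiff (𝓡 n) ((𝓡 n).prod 𝓘(ℝ, ℝ)) ∞ (fun x => TotalSpace.mk' ℝ x
      (DetLine.mk (α x) (fun j => Y j x) : CanonicalBundle n r A x)) := by
  intro p
  rw [DetLine.contMDiffAt_section_iff]
  simp only [DetLine.coord_mk]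
  obtain ⟨e, he⟩ := exists_frame (n := n) p (trivializationAt (EuclideanSpace ℝ (Fin r)) A p)
    (mem_baseSet_trivializationAt _ A p) (stdBasis r)
  refine ContMDiffAt.mul ?_ (contMDiffAt_trivCovolume (fun j x => Y j x)
    (fun j => (Y j).contMDiff.contMDiffAt) _ (mem_baseSet_trivializationAt _ _ p))
  refine (hα e).contMDiffAt.congr_of_eventuallyEq ?_
  filter_upwards [Filter.eventually_all.2 he] with x hx
  congr 1
  funext i
  exact (hx i).symm

end LieDerivative

/-! ### Pairing sections of a bundle and of its dual -/

section Pairing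

set_option linter.unusedSectionVars false

variable {n : ℕ} {M : Type*} [TopologicalSpace M] [ChartedSpace (EuclideanSpace ℝ (Fin n)) M]
  {F : Type*} [NormedAddCommGroup F] [NormedSpace ℝ F]
  {V : M → Type*} [TopologicalSpace (TotalSpace F V)]
  [∀ x, AddCommGroup (V x)] [∀ x, Module ℝ (V x)] [∀ x, TopologicalSpace (V x)]
  [∀ x, IsTopologicalAddGroup (V x)] [∀ x, ContinuousSMul ℝ (V x)]
  [FiberBundle F V] [VectorBundle ℝ F V]

lemma contMDiffAt_pairing {E H N : Type*} [NormedAddCommGroup E] [NormedSpace ℝ E]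
    [TopologicalSpace H] {I : ModelWithCorners ℝ E H} [TopologicalSpace N] [ChartedSpace H N]
    {b : N → M} {φ : ∀ y, V (b y) →L[ℝ] ℝ} {v : ∀ y, V (b y)} {y₀ : N}
    (hφ : ContMDiffAt I ((𝓡 n).prod 𝓘(ℝ, F →L[ℝ] ℝ)) ∞
      (fun y => TotalSpace.mk' (F →L[ℝ] ℝ) (E := fun x => V x →L[ℝ] ℝ) (b y) (φ y)) y₀)
    (hv : ContMDiffAt I ((𝓡 n).prod 𝓘(ℝ, F)) ∞ (fun y => TotalSpace.mk' F (b y) (v y)) y₀) :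
    ContMDiffAt I 𝓘(ℝ, ℝ) ∞ (fun y => φ y (v y)) y₀ :=
  (contMDiffAt_totalSpace.1
    (ContMDiffAt.clm_bundle_apply (E₂ := Bundle.Trivial M ℝ) hφ hv)).2

lemma contMDiff_pairing (ξ : SmoothSection n (F →L[ℝ] ℝ) (fun x => V x →L[ℝ] ℝ))
    (σ : SmoothSection n F V) : ContMDiff (𝓡 n) 𝓘(ℝ, ℝ) ∞ (fun x => ξ x (σ x)) := fun _ =>
  contMDiffAt_pairing (b := id) ξ.contMDiff.contMDiffAt σ.contMDiff.contMDiffAt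

variable [T2Space M] [IsManifold (𝓡 n) ∞ M] [ContMDiffVectorBundle ∞ F V (𝓡 n)]
  [FiniteDimensional ℝ F]

/-- Used to turn statements about sections into statements about smooth real functions. On a line
bundle such a ξ is moreover a local generator of the dual near `p`. -/
lemma exists_dualSection_apply_ne_zero {p : M} {v : V p} (hv : v ≠ 0) :
    ∃ ξ : SmoothSection n (F →L[ℝ] ℝ) (fun x => V x →L[ℝ] ℝ), ξ p v ≠ 0 := by
  let t := (trivializationAt F V p).continuousLinearEquivAt ℝ p (mem_baseSet_trivializationAt F V p)
  obtain ⟨l, hl⟩ : ∃ l : F →L[ℝ] ℝ, l (t v) ≠ 0 := by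
    by_contra! h
    have h0 : t v ≠ 0 := by simpa using hv
    have h2 := Module.forall_dual_apply_eq_zero_iff ℝ (t v)
    exact h0 (h2.1 fun f => h (LinearMap.toContinuousLinearMap f))
  obtain ⟨ξ, hξ, -⟩ := exists_smoothSection_apply_eq (n := n) (F := F →L[ℝ] ℝ)
    (V := fun x => V x →L[ℝ] ℝ) isOpen_univ (mem_univ p) (l.comp (t : V p →L[ℝ] F))
  exact ⟨ξ, by rw [hξ]; exact hl⟩

end Pairing

/-! ### Defining functions and tangency -/

section Hypersurface

set_option linter.unusedSectionVars false

variable {n : ℕ} {M : Type*} [TopologicalSpace M]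
  [ChartedSpace (EuclideanSpace ℝ (Fin n)) M] {Z : Set M}

lemma hasStrictFDerivAt_written {f : M → ℝ} {p : M} [IsManifold (𝓡 n) ∞ M]
    (hf : ContMDiffAt (𝓡 n) 𝓘(ℝ, ℝ) ∞ f p) :
    HasStrictFDerivAt (f ∘ (extChartAt (𝓡 n) p).symm) (mvfderiv (𝓡 n) f p)
      (extChartAt (𝓡 n) p p) := by
  have h1 := (contMDiffAt_iff.1 hf).2
  simp only [modelWithCornersSelf_coe, range_id, contDiffWithinAt_univ] at h1
  have h2 := MDifferentiableAt.mvfderiv (hf.mdifferentiableAt (by simp))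
  simp only [modelWithCornersSelf_coe, range_id, fderivWithin_univ] at h2
  rw [h2]
  exact h1.hasStrictFDerivAt (by simp)

/-- Lagrange multipliers: `g` is constant on the zero set of `f` near `p`, so a df + b dg = 0 with
(a, b) ≠ 0, and df ≠ 0 forces b ≠ 0. Hence tangency can be tested on a single defining function. -/
lemma IsDefiningFunctionAt.mvfderiv_eq_zero [IsManifold (𝓡 n) ∞ M] {f g : M → ℝ} {p : M}
    (hp : p ∈ Z) (hf : IsDefiningFunctionAt n Z f p) (hg : IsDefiningFunctionAt n Z g p)
    {w : TangentSpace (𝓡 n) p} (hw : mvfderiv (𝓡 n) f p w = 0) : mvfderiv (𝓡 n) g p w = 0 := by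
  obtain ⟨U, hU, hpU, hfU, hf'⟩ := hf
  obtain ⟨V, hV, hpV, hgV, hg'⟩ := hg
  have h1 := hasStrictFDerivAt_written (hfU.contMDiffAt (hU.mem_nhds hpU))
  have h2 := hasStrictFDerivAt_written (hgV.contMDiffAt (hV.mem_nhds hpV))
  set φ := extChartAt (𝓡 n) p
  have hφ : φ.symm (φ p) = p := extChartAt_to_inv p
  have hc : ContinuousAt φ.symm (φ p) := continuousAt_extChartAt_symm p
  have hext : IsLocalExtrOn (g ∘ φ.symm) {x | (f ∘ φ.symm) x = (f ∘ φ.symm) (φ p)} (φ p) := by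
    -- Being constant on the level set, the function has both a minimum and a maximum there; the
    -- minimum is used.
    left
    have hUV : ∀ᶠ y in 𝓝 (φ p), φ.symm y ∈ U ∩ V :=
      hc.eventually_mem ((hU.inter hV).mem_nhds (by rw [hφ]; exact ⟨hpU, hpV⟩))
    filter_upwards [nhdsWithin_le_nhds hUV, self_mem_nhdsWithin] with y hy hy'
    simp only [Function.comp, hφ, ((hf' p hpU).1.1 hp)] at hy'
    have := (hg' _ hy.2).1.1 ((hf' _ hy.1).1.2 hy')
    simp [Function.comp, hφ, (hg' p hpV).1.1 hp, this]
  obtain ⟨a, b, hab, h⟩ := hext.exists_multipliers_of_hasStrictFDerivAt_1d h1 h2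
  have h' : ∀ u : TangentSpace (𝓡 n) p,
      a * mvfderiv (𝓡 n) f p u + b * mvfderiv (𝓡 n) g p u = 0 := fun u => DFunLike.congr_fun h u
  have hb : b ≠ 0 := by
    rintro rfl
    have ha : a ≠ 0 := fun h => hab (by simp [h])
    refine (hf' p hpU).2 (ContinuousLinearMap.ext fun u => ?_)
    have := h' u
    rw [zero_mul, add_zero] at this
    exact (mul_eq_zero.1 this).resolve_left ha
  have := h' w
  rw [hw, mul_zero, zero_add] at this
  exact (mul_eq_zero.1 this).resolve_left hb

lemma IsDefiningFunctionAt.isTangentVector_iff [IsManifold (𝓡 n) ∞ M] {f : M → ℝ} {p : M}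
    (hp : p ∈ Z) (hf : IsDefiningFunctionAt n Z f p) {w : TangentSpace (𝓡 n) p} :
    IsTangentVector Z p w ↔ mvfderiv (𝓡 n) f p w = 0 :=
  ⟨fun h => h f hf, fun h _ hg => hf.mvfderiv_eq_zero hp hg h⟩

/-- If Z contained a neighbourhood of one of its points, a defining function would vanish
identically near it, and so would its differential. -/
lemma IsHypersurface.dense_compl (hZ : IsHypersurface n Z) : Dense Zᶜ := by
  intro p
  by_cases hp : p ∈ Z
  swap
  · exact subset_closure hp
  obtain ⟨f, U, hU, hpU, -, hf⟩ := hZ.2 p hp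
  rw [mem_closure_iff_nhds]
  by_contra! h
  obtain ⟨t, ht, htZ⟩ := h
  have h0 : f =ᶠ[𝓝 p] 0 := by
    filter_upwards [ht, hU.mem_nhds hpU] with y hy hyU
    refine (hf y hyU).1.1 ?_
    by_contra hyZ
    have : y ∈ t ∩ Zᶜ := ⟨hy, hyZ⟩
    simp [htZ] at this
  apply (hf p hpU).2
  rw [mvfderiv_congr_of_eventuallyEq h0, mvfderiv_zero]

/-- A hypersurface has local defining functions which are globally smooth. -/
lemma IsHypersurface.exists_definingFunction [T2Space M] [IsManifold (𝓡 n) ∞ M]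
    (hZ : IsHypersurface n Z) {p : M} (hp : p ∈ Z) :
    ∃ f : M → ℝ, ContMDiff (𝓡 n) 𝓘(ℝ, ℝ) ∞ f ∧ ∃ U : Set M, IsOpen U ∧ p ∈ U ∧
      ∀ x ∈ U, (x ∈ Z ↔ f x = 0) ∧ mvfderiv (𝓡 n) f x ≠ 0 := by
  obtain ⟨f, U, hU, hpU, hfU, hf⟩ := hZ.2 p hp
  obtain ⟨g, hg, hgf, -⟩ := exists_contMDiff_eventuallyEq hU hpU hfU
  obtain ⟨t, ht, hto, hpt⟩ := eventually_nhds_iff.1 hgf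
  refine ⟨g, hg, U ∩ t, hU.inter hto, ⟨hpU, hpt⟩, fun x hx => ?_⟩
  have : g =ᶠ[𝓝 x] f := by
    filter_upwards [hto.mem_nhds hx.2] with y hy using ht y hy
  rw [mvfderiv_congr_of_eventuallyEq this, ht x hx.2]
  exact hf x hx.1

end Hypersurface

/-! ### The anchor of the b-tangent bundle and the section det(ρ) -/

section BTangent

set_option linter.unusedSectionVars false

variable {n : ℕ} {M : Type*} [TopologicalSpace M] [T2Space M]
  [ChartedSpace (EuclideanSpace ℝ (Fin n)) M] [IsManifold (𝓡 n) ∞ M] {Z : Set M}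
  {A : M → Type*} [∀ x, AddCommGroup (A x)] [∀ x, Module ℝ (A x)]
  [∀ x, TopologicalSpace (A x)] [TopologicalSpace (TotalSpace (EuclideanSpace ℝ (Fin n)) A)]
  [FiberBundle (EuclideanSpace ℝ (Fin n)) A] [VectorBundle ℝ (EuclideanSpace ℝ (Fin n)) A]
  [ContMDiffVectorBundle ∞ (EuclideanSpace ℝ (Fin n)) A (𝓡 n)]
  {𝒜 : LieAlgebroid n n A}

instance (x : M) : FiniteDimensional ℝ (TangentSpace (𝓡 n) x) :=
  inferInstanceAs (FiniteDimensional ℝ (EuclideanSpace ℝ (Fin n)))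

lemma finrank_tangentSpace (x : M) : Module.finrank ℝ (TangentSpace (𝓡 n) x) = n :=
  (finrank_euclideanSpace_fin : Module.finrank ℝ (EuclideanSpace ℝ (Fin n)) = n)

/-- The local frame of `A` at the centre of a trivialization. -/
def fibreBasis (n : ℕ) {M : Type*} [TopologicalSpace M] (A : M → Type*) [∀ x, AddCommGroup (A x)] [∀ x, Module ℝ (A x)]
    [∀ x, TopologicalSpace (A x)] [TopologicalSpace (TotalSpace (EuclideanSpace ℝ (Fin n)) A)]
    [FiberBundle (EuclideanSpace ℝ (Fin n)) A] [VectorBundle ℝ (EuclideanSpace ℝ (Fin n)) A]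
    (x : M) : Module.Basis (Fin n) ℝ (A x) :=
  trivBasis (trivializationAt (EuclideanSpace ℝ (Fin n)) A x) (mem_baseSet_trivializationAt _ A x)

lemma IsBTangentBundle.exists_section (h𝒜 : IsBTangentBundle Z 𝒜) (X : SmoothVectorField n M)
    (hX : ∀ p ∈ Z, IsTangentVector Z p (X p)) :
    ∃ v : SmoothSection n (EuclideanSpace ℝ (Fin n)) A, ∀ x, 𝒜.anchor x (v x) = X x := by
  have : X ∈ Set.range 𝒜.anchorSection := by rw [h𝒜.2]; exact hX
  obtain ⟨v, rfl⟩ := this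
  exact ⟨v, fun _ => rfl⟩

lemma IsBTangentBundle.isTangentVector (h𝒜 : IsBTangentBundle Z 𝒜) {p : M} (hp : p ∈ Z)
    (u : A p) : IsTangentVector Z p (𝒜.anchor p u) := by
  obtain ⟨v, rfl, -⟩ := exists_smoothSection_apply_eq (n := n)
    (F := EuclideanSpace ℝ (Fin n)) isOpen_univ (mem_univ p) u
  have : 𝒜.anchorSection v ∈ Set.range 𝒜.anchorSection := ⟨v, rfl⟩
  rw [h𝒜.2] at this
  exact this p hp

lemma isTangentVector_zero (p : M) : IsTangentVector Z p (0 : TangentSpace (𝓡 n) p) :=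
  fun _ _ => map_zero _

/-- A vector at a point off Z extends to a field vanishing on Z, which is tangent to Z and so comes
from a section of `A`. Surjectivity suffices since the ranks agree. -/
lemma IsBTangentBundle.bijective_anchor (hZ : IsClosed Z) (h𝒜 : IsBTangentBundle Z 𝒜) {p : M}
    (hp : p ∉ Z) : Function.Bijective (𝒜.anchor p) := by
  have hsurj : Function.Surjective (𝒜.anchor p).toLinearMap := fun w => by
    obtain ⟨X, rfl, h⟩ := exists_smoothSection_apply_eq (n := n)
      (F := EuclideanSpace ℝ (Fin n)) hZ.isOpen_compl hp w
    obtain ⟨v, hv⟩ := h𝒜.exists_section X fun q hq => by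
      rw [h q (by simpa using hq)]
      exact isTangentVector_zero q
    exact ⟨v p, hv p⟩
  have : FiniteDimensional ℝ (A p) := (fibreBasis n A p).finiteDimensional_of_finite
  have hr : Module.finrank ℝ (A p) = Module.finrank ℝ (TangentSpace (𝓡 n) p) := by
    rw [finrank_tangentSpace, Module.finrank_eq_card_basis (fibreBasis n A p), Fintype.card_fin]
  exact ⟨(LinearMap.injective_iff_surjective_of_finrank_eq_finrank hr).2 hsurj, hsurj⟩

/-- The identity through which computations in Q become computations with the function α(b). It also
shows that det(ρ) does not depend on the frame chosen in its definition. -/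
lemma mk_anchor_eq_smul_detAnchor (x : M) (α : (A x) [⋀^Fin n]→ₗ[ℝ] ℝ) (b : Fin n → A x) :
    (DetLine.mk α (fun i => 𝒜.anchor x (b i)) : CanonicalBundle n n A x) =
      α b • detAnchor 𝒜 x := by
  have hx := mem_baseSet_trivializationAt (EuclideanSpace ℝ (Fin n)) A x
  refine (DetLine.mk_map_eq_smul (𝒜.anchor x).toLinearMap (fibreBasis n A x) (trivCovolume
    (trivializationAt (EuclideanSpace ℝ (Fin n)) A x) x) ?_ α b).trans ?_
  · rw [fibreBasis, coe_trivBasis, trivCovolume_trivFrame _ hx]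
  · rw [fibreBasis, coe_trivBasis]
    rfl

/-- Off Z the anchor carries a basis to a basis, on which a volume form cannot vanish. On Z its
image lies in the proper subspace ker df, so the images of a frame are dependent and their wedge is
zero. -/
lemma detAnchor_eq_zero_iff (hZ : IsHypersurface n Z) (h𝒜 : IsBTangentBundle Z 𝒜) (x : M) :
    detAnchor 𝒜 x = 0 ↔ x ∈ Z := by
  have hx := mem_baseSet_trivializationAt (EuclideanSpace ℝ (Fin n)) A x
  constructor
  · intro h0
    by_contra hxZ
    let t := trivializationAt (EuclideanSpace ℝ (Fin n)) (fun x : M => TangentSpace (𝓡 n) x) x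
    have ht : x ∈ t.baseSet := mem_baseSet_trivializationAt _ _ x
    have h1 := DetLine.coord_mk (trivializationAt (EuclideanSpace ℝ (Fin n)) A x) t x
      (trivCovolume (trivializationAt (EuclideanSpace ℝ (Fin n)) A x) x)
      (fun i => 𝒜.anchor x (trivFrame (trivializationAt (EuclideanSpace ℝ (Fin n)) A x) x i))
    rw [trivCovolume_trivFrame _ hx, one_mul] at h1
    change DetLine.coord _ _ x (detAnchor 𝒜 x) = _ at h1
    rw [h0, map_zero] at h1
    let b := (fibreBasis n A x).map (LinearEquiv.ofBijective (𝒜.anchor x).toLinearMap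
      (h𝒜.bijective_anchor hZ.1 hxZ))
    have hb : ⇑b = fun i =>
        𝒜.anchor x (trivFrame (trivializationAt (EuclideanSpace ℝ (Fin n)) A x) x i) := by
      funext i
      simp only [b, Module.Basis.map_apply, fibreBasis, trivBasis_apply]
      rfl
    rw [← hb] at h1
    have h2 := alternatingMap_eq_det_smul b (trivCovolume t x) (trivFrame t x)
    rw [← h1, trivCovolume_trivFrame _ ht, smul_zero] at h2
    exact one_ne_zero h2
  · intro hxZ
    have h1 : ¬ LinearIndependent ℝ (fun i =>
        𝒜.anchor x (trivFrame (trivializationAt (EuclideanSpace ℝ (Fin n)) A x) x i)) := by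
      intro hli
      obtain ⟨f, hf⟩ := hZ.2 x hxZ
      have hspan := hli.span_eq_top_of_card_eq_finrank' (by rw [finrank_tangentSpace]; simp)
      have hle : Submodule.span ℝ (Set.range fun i =>
          𝒜.anchor x (trivFrame (trivializationAt (EuclideanSpace ℝ (Fin n)) A x) x i)) ≤
          LinearMap.ker (mvfderiv (𝓡 n) f x).toLinearMap := by
        rw [Submodule.span_le]
        rintro _ ⟨i, rfl⟩
        exact (hf.isTangentVector_iff hxZ).1 (h𝒜.isTangentVector hxZ _)
      rw [hspan, top_le_iff, LinearMap.ker_eq_top] at hle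
      obtain ⟨U, -, hpU, -, h⟩ := hf
      exact (h x hpU).2 (ContinuousLinearMap.coe_injective hle)
    have h2 := AlternatingMap.map_linearDependent (exteriorPower.ιMulti ℝ n) _ h1
    unfold detAnchor DetLine.mk
    rw [h2]
    exact TensorProduct.tmul_zero _ _

lemma exists_smoothForm (p : M) : ∃ (α : ∀ x, (A x) [⋀^Fin n]→ₗ[ℝ] ℝ)
    (e : Fin n → SmoothSection n (EuclideanSpace ℝ (Fin n)) A),
    LieAlgebroid.IsSmoothForm (n := n) α ∧ ∀ᶠ y in 𝓝 p, α y (fun i => e i y) = 1 := by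
  let t := trivializationAt (EuclideanSpace ℝ (Fin n)) A p
  have ht : p ∈ t.baseSet := mem_baseSet_trivializationAt _ A p
  obtain ⟨e, he⟩ := exists_frame (n := n) p t ht (stdBasis n)
  obtain ⟨χ, h1, h2, h3⟩ := exists_bump (n := n) (t.open_baseSet.mem_nhds ht)
  refine ⟨fun x => χ x • trivCovolume t x, e, fun a => ?_, ?_⟩
  · apply contMDiff_of_tsupport
    intro x hx
    have hx' : x ∈ t.baseSet := h3 (closure_mono (fun y hy => by
      simp only [Function.mem_support] at hy ⊢; exact left_ne_zero_of_mul hy) hx)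
    exact h1.contMDiffAt.mul (contMDiffAt_trivCovolume (fun j x => a j x)
      (fun j => (a j).contMDiff.contMDiffAt) t hx')
  · filter_upwards [h2, Filter.eventually_all.2 he, t.open_baseSet.mem_nhds ht] with y hy hy' hyt
    have : (fun i => e i y) = trivFrame t y := funext hy'
    rw [this, AlternatingMap.smul_apply, trivCovolume_trivFrame t hyt, hy, one_smul]

/-- The definition uses a different trivialization at each point. Near `p` the section equals α ⊗
ρ(e₁) ∧ ⋯ ∧ ρ(eₙ) for one smooth form and one smooth frame with α(e₁, …, eₙ) = 1. -/
lemma contMDiff_detAnchor : ContMDiff (𝓡 n) ((𝓡 n).prod 𝓘(ℝ, ℝ)) ∞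
    (fun x => TotalSpace.mk' ℝ x (detAnchor 𝒜 x)) := by
  intro p
  obtain ⟨α, e, hα, he⟩ := exists_smoothForm (n := n) (A := A) p
  refine ((contMDiff_detLine_mk hα fun i => 𝒜.anchorSection (e i)) p).congr_of_eventuallyEq ?_
  filter_upwards [he] with y hy
  congr 1
  have := mk_anchor_eq_smul_detAnchor (𝒜 := 𝒜) y (α y) (fun i => e i y)
  rw [hy, one_smul] at this
  exact this.symm

/-- The smooth section `det(ρ)`. -/
def detSection (𝒜 : LieAlgebroid n n A) : SmoothSection n ℝ (CanonicalBundle n n A) :=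
  ⟨detAnchor 𝒜, contMDiff_detAnchor⟩

/-- Near a point of the hypersurface with defining function `f`, every field of the form
`df(W) Y + (f - 1) df(Y) W` is tangent to the hypersurface. -/
lemma IsBTangentBundle.exists_lift (h𝒜 : IsBTangentBundle Z 𝒜) {f : M → ℝ}
    (hf : ContMDiff (𝓡 n) 𝓘(ℝ, ℝ) ∞ f) {U : Set M} (hU : IsOpen U) {p : M} (hp : p ∈ U)
    (hfU : ∀ x ∈ U, (x ∈ Z ↔ f x = 0) ∧ mvfderiv (𝓡 n) f x ≠ 0) (W Y : SmoothVectorField n M) :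
    ∃ v : SmoothSection n (EuclideanSpace ℝ (Fin n)) A, ∀ᶠ y in 𝓝 p, 𝒜.anchor y (v y) =
      mvfderiv (𝓡 n) f y (W y) • Y y + ((f y - 1) * mvfderiv (𝓡 n) f y (Y y)) • W y := by
  obtain ⟨χ, h1, h2, h3⟩ := exists_bump (n := n) (hU.mem_nhds hp)
  -- On this field df takes the value χ f df(W) df(Y), which vanishes on Z. With the coefficient -1
  -- in place of f - 1 the field would be tangent too, but the endomorphism of TM would be
  -- degenerate everywhere when df(W) ≠ 0; the extra f makes its determinant vanish to first order.
  let X : SmoothVectorField n M := funSmul χ h1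
    (funSmul _ (contMDiff_mvfderiv_apply hf W) Y +
      funSmul _ ((hf.sub (contMDiff_const (c := (1 : ℝ)))).mul (contMDiff_mvfderiv_apply hf Y)) W)
  have hX : ∀ y, X y = χ y • (mvfderiv (𝓡 n) f y (W y) • Y y +
    ((f y - 1) * mvfderiv (𝓡 n) f y (Y y)) • W y) := fun y => rfl
  obtain ⟨v, hv⟩ := h𝒜.exists_section X fun q hq => by
    by_cases hqU : q ∈ U
    · have hfq : IsDefiningFunctionAt n Z f q := ⟨U, hU, hqU, hf.contMDiffOn, hfU⟩
      rw [hfq.isTangentVector_iff hq, hX, map_smul, map_add, map_smul, map_smul,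
        (hfU q hqU).1.1 hq]
      simp only [smul_eq_mul]
      ring
    · rw [hX, image_eq_zero_of_notMem_tsupport (fun h => hqU (h3 h)), zero_smul]
      exact isTangentVector_zero q
  refine ⟨v, ?_⟩
  filter_upwards [h2] with y hy
  rw [hv, hX, hy, one_smul]

end BTangent

/-! ### Transverse vanishing of det(ρ) -/

section Transversality

set_option linter.unusedSectionVars false

variable {n : ℕ} {M : Type*} [TopologicalSpace M] [T2Space M]
  [ChartedSpace (EuclideanSpace ℝ (Fin n)) M] [IsManifold (𝓡 n) ∞ M] {Z : Set M}
  {A : M → Type*} [∀ x, AddCommGroup (A x)] [∀ x, Module ℝ (A x)]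
  [∀ x, TopologicalSpace (A x)] [TopologicalSpace (TotalSpace (EuclideanSpace ℝ (Fin n)) A)]
  [FiberBundle (EuclideanSpace ℝ (Fin n)) A] [VectorBundle ℝ (EuclideanSpace ℝ (Fin n)) A]
  [ContMDiffVectorBundle ∞ (EuclideanSpace ℝ (Fin n)) A (𝓡 n)]
  {𝒜 : LieAlgebroid n n A}

/-- The elements of a fibre of `Q` are multiples of any nonzero element. -/
lemma DetLine.exists_eq_smul {x : M} {q₀ : CanonicalBundle n n A x} (h₀ : q₀ ≠ 0)
    (q : CanonicalBundle n n A x) : ∃ c : ℝ, q = c • q₀ := by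
  let t := trivializationAt ℝ (CanonicalBundle n n A) x
  have ht : x ∈ t.baseSet := mem_baseSet_trivializationAt _ _ x
  let L := t.linearEquivAt ℝ x ht
  have hL : L q₀ ≠ 0 := by simpa using h₀
  refine ⟨L q / L q₀, L.injective ?_⟩
  rw [map_smul, smul_eq_mul, div_mul_cancel₀ _ hL]

/-- The top exterior power of an endomorphism is multiplication by its determinant. -/
lemma DetLine.mk_linearMap_comp {x : M} (α : (A x) [⋀^Fin n]→ₗ[ℝ] ℝ)
    (Φ : TangentSpace (𝓡 n) x →ₗ[ℝ] TangentSpace (𝓡 n) x)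
    (Y : Fin n → TangentSpace (𝓡 n) x) :
    (DetLine.mk α (fun i => Φ (Y i)) : CanonicalBundle n n A x) =
      LinearMap.det Φ • DetLine.mk α Y := by
  let b := fibreBasis n (fun x : M => TangentSpace (𝓡 n) x) x
  have h : exteriorPower.ιMulti ℝ n (fun i => Φ (Y i)) =
      LinearMap.det Φ • exteriorPower.ιMulti ℝ n Y := by
    have h1 : b.det (fun i => Φ (Y i)) = LinearMap.det Φ * b.det Y := b.det_comp Φ Y
    rw [alternatingMap_eq_det_smul b _ (fun i => Φ (Y i)), alternatingMap_eq_det_smul b _ Y,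
      h1, smul_smul]
  unfold DetLine.mk
  rw [h]
  exact TensorProduct.tmul_smul _ _ _

/-- The endomorphism is l(w) times the transvection y ↦ y + ((a - 1)/l(w)) l(y) w, whose determinant
is 1 + (a - 1) = a. -/
lemma det_tangent_field {E : Type*} [AddCommGroup E] [Module ℝ E] [FiniteDimensional ℝ E]
    (l : E →ₗ[ℝ] ℝ) (w : E) (a : ℝ) (hw : l w ≠ 0) :
    LinearMap.det (l w • LinearMap.id + (LinearMap.toSpanSingleton ℝ E w) ∘ₗ ((a - 1) • l)) =
      l w ^ Module.finrank ℝ E * a := by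
  have h : l w • LinearMap.id + (LinearMap.toSpanSingleton ℝ E w) ∘ₗ ((a - 1) • l) =
      l w • LinearMap.transvection (((a - 1) / l w) • l) w := by
    ext y
    simp only [LinearMap.add_apply, LinearMap.smul_apply, LinearMap.id_coe, id_eq,
      LinearMap.comp_apply, LinearMap.toSpanSingleton_apply, LinearMap.transvection.apply,
      smul_add, smul_smul, smul_eq_mul]
    congr 2
    field_simp
  rw [h, LinearMap.det_smul, LinearMap.transvection.det]
  congr 1
  simp only [LinearMap.smul_apply, smul_eq_mul]
  field_simp
  ring

/-- The section `α ⊗ (Y₁ ∧ ⋯ ∧ Yₙ)` of `Q`. -/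
def mkSection {α : ∀ x, (A x) [⋀^Fin n]→ₗ[ℝ] ℝ}
    (hα : LieAlgebroid.IsSmoothForm (n := n) α) (Y : Fin n → SmoothVectorField n M) :
    SmoothSection n ℝ (CanonicalBundle n n A) :=
  ⟨fun x => DetLine.mk (α x) (fun j => Y j x), contMDiff_detLine_mk hα Y⟩

lemma exists_mkSection_ne_zero (A : M → Type*) [∀ x, AddCommGroup (A x)] [∀ x, Module ℝ (A x)]
    [∀ x, TopologicalSpace (A x)] [TopologicalSpace (TotalSpace (EuclideanSpace ℝ (Fin n)) A)]
    [FiberBundle (EuclideanSpace ℝ (Fin n)) A] [VectorBundle ℝ (EuclideanSpace ℝ (Fin n)) A]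
    [ContMDiffVectorBundle ∞ (EuclideanSpace ℝ (Fin n)) A (𝓡 n)] (p : M) :
    ∃ (α : ∀ x, (A x) [⋀^Fin n]→ₗ[ℝ] ℝ) (hα : LieAlgebroid.IsSmoothForm (n := n) α)
      (Y : Fin n → SmoothVectorField n M), mkSection hα Y p ≠ 0 := by
  obtain ⟨α, e, hα, he⟩ := exists_smoothForm (n := n) (A := A) p
  let s := trivializationAt (EuclideanSpace ℝ (Fin n)) A p
  have hs : p ∈ s.baseSet := mem_baseSet_trivializationAt _ A p
  let t := trivializationAt (EuclideanSpace ℝ (Fin n)) (fun x : M => TangentSpace (𝓡 n) x) p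
  have ht : p ∈ t.baseSet := mem_baseSet_trivializationAt _ _ p
  obtain ⟨Y, hY⟩ := exists_frame (n := n) p t ht (stdBasis n)
  refine ⟨α, hα, Y, fun h0 => ?_⟩
  have h1 := DetLine.coord_mk s t p (α p) (fun j => Y j p)
  change DetLine.coord s t p (mkSection hα Y p) = _ at h1
  have h2 : (fun j => Y j p) = trivFrame t p := funext fun j => (hY j).self_of_nhds
  rw [h0, map_zero, h2, trivCovolume_trivFrame t ht, mul_one] at h1
  have h3 := eq_smul_trivCovolume s hs (α p)
  rw [← h1, zero_smul] at h3
  have h4 := he.self_of_nhds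
  rw [h3] at h4
  exact zero_ne_one h4

/-- The section `det(ρ)` vanishes transversely: its coefficients have nonzero differential. -/
lemma mvfderiv_detAnchor_ne_zero (hZ : IsHypersurface n Z) (h𝒜 : IsBTangentBundle Z 𝒜) {p : M}
    (hp : p ∈ Z)
    (ξ : SmoothSection n (ℝ →L[ℝ] ℝ) (fun x => CanonicalBundle n n A x →L[ℝ] ℝ)) (hξ : ξ p ≠ 0) :
    mvfderiv (𝓡 n) (fun y => ξ y (detSection 𝒜 y)) p ≠ 0 := by
  intro h0
  obtain ⟨f, hf, U, hU, hpU, hfU⟩ := hZ.exists_definingFunction hp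
  obtain ⟨w, hw⟩ : ∃ w, mvfderiv (𝓡 n) f p w ≠ 0 := by
    by_contra! h
    exact (hfU p hpU).2 (ContinuousLinearMap.ext h)
  obtain ⟨W, rfl, -⟩ := exists_smoothSection_apply_eq (n := n)
    (F := EuclideanSpace ℝ (Fin n)) isOpen_univ (mem_univ p) w
  obtain ⟨α, hα, Y, hq⟩ := exists_mkSection_ne_zero (n := n) A p
  choose v hv using fun k => h𝒜.exists_lift hf hU hpU hfU W (Y k)
  have hc := contMDiff_mvfderiv_apply hf W
  -- Both sides are ξ applied to α ⊗ ρ(v₁) ∧ ⋯ ∧ ρ(vₙ): on the left via det(ρ), on the right via the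
  -- determinant of the endomorphism Φ with ρ(vₖ) = Φ(Yₖ).
  have key : (fun y => α y (fun i => v i y) * ξ y (detSection 𝒜 y)) =ᶠ[𝓝 p]
      fun y => f y * (mvfderiv (𝓡 n) f y (W y) ^ n * ξ y (mkSection hα Y y)) := by
    filter_upwards [Filter.eventually_all.2 hv, hc.continuous.continuousAt.eventually_ne hw]
      with y hy hcy
    have h1 := mk_anchor_eq_smul_detAnchor (𝒜 := 𝒜) y (α y) (fun i => v i y)
    let Φ : TangentSpace (𝓡 n) y →ₗ[ℝ] TangentSpace (𝓡 n) y :=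
      mvfderiv (𝓡 n) f y (W y) • LinearMap.id +
        (LinearMap.toSpanSingleton ℝ (TangentSpace (𝓡 n) y) (W y)) ∘ₗ
          ((f y - 1) • (mvfderiv (𝓡 n) f y).toLinearMap)
    have h2 := DetLine.mk_linearMap_comp (α y) Φ (fun i => Y i y)
    have h3 := det_tangent_field (mvfderiv (𝓡 n) f y).toLinearMap (W y) (f y) hcy
    rw [finrank_tangentSpace] at h3
    have h4 : (fun i => 𝒜.anchor y (v i y)) = fun i => Φ (Y i y) := funext hy
    have h5 : α y (fun i => v i y) • detSection 𝒜 y =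
        (mvfderiv (𝓡 n) f y (W y) ^ n * f y) • mkSection hα Y y := by
      refine h1.symm.trans ?_
      rw [h4, h2]
      exact congrArg (· • _) h3
    have h6 := congrArg (ξ y) h5
    rw [map_smul, map_smul, smul_eq_mul, smul_eq_mul] at h6
    rw [h6]
    ring
  have hd : ∀ g : M → ℝ, ContMDiff (𝓡 n) 𝓘(ℝ, ℝ) ∞ g → MDifferentiableAt (𝓡 n) 𝓘(ℝ, ℝ) g p :=
    fun g hg => hg.contMDiffAt.mdifferentiableAt (by simp)
  -- Differentiate at `p` along W. On the left det(ρ) vanishes at `p`, and so does the derivative of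
  -- its coefficient by assumption. On the right f(p) = 0 leaves df(W)ⁿ ξ(q) df(W), which is
  -- nonzero.
  have h1 := DFunLike.congr_fun (mvfderiv_congr_of_eventuallyEq (I := 𝓡 n) key) (W p)
  rw [mvfderiv_mul_apply (hd _ (hα v)) (hd _ (contMDiff_pairing ξ _)),
    mvfderiv_mul_apply (hd _ hf) (hd (fun y => mvfderiv (𝓡 n) f y (W y) ^ n *
      ξ y (mkSection hα Y y)) ((hc.pow n).mul (contMDiff_pairing ξ _))), h0,
    (hfU p hpU).1.1 hp] at h1
  have h2 : detSection 𝒜 p = 0 := (detAnchor_eq_zero_iff hZ h𝒜 p).2 hp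
  rw [h2, map_zero] at h1
  simp only [zero_apply, mul_zero, zero_mul, add_zero, zero_add] at h1
  have hξq : ξ p (mkSection hα Y p) ≠ 0 := by
    intro h
    refine hξ (ContinuousLinearMap.ext fun q => ?_)
    obtain ⟨c, rfl⟩ := DetLine.exists_eq_smul hq q
    rw [map_smul, h, smul_zero]
    rfl
  exact mul_ne_zero (mul_ne_zero (pow_ne_zero _ hw) hξq) hw h1.symm

lemma isBDivisor_detAnchor (hZ : IsHypersurface n Z) (h𝒜 : IsBTangentBundle Z 𝒜) :
    IsBDivisor n (W := CanonicalBundle n n A) Z (detAnchor 𝒜) := by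
  refine ⟨contMDiff_detAnchor, detAnchor_eq_zero_iff hZ h𝒜, fun x hx => ?_⟩
  obtain ⟨α, hα, Y, hq⟩ := exists_mkSection_ne_zero (n := n) A x
  obtain ⟨ξ, hξ⟩ := exists_dualSection_apply_ne_zero (n := n) (F := ℝ) hq
  exact ⟨ξ, mvfderiv_detAnchor_ne_zero hZ h𝒜 hx ξ fun h => hξ (by rw [h]; rfl)⟩

/-- At a point of the hypersurface, vectors annihilated by the differential of a defining function
are in the image of the anchor. -/
lemma IsBTangentBundle.exists_anchor_eq (h𝒜 : IsBTangentBundle Z 𝒜) {f : M → ℝ}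
    (hf : ContMDiff (𝓡 n) 𝓘(ℝ, ℝ) ∞ f) {U : Set M} (hU : IsOpen U) {p : M} (hpU : p ∈ U)
    (hfU : ∀ x ∈ U, (x ∈ Z ↔ f x = 0) ∧ mvfderiv (𝓡 n) f x ≠ 0) {y : TangentSpace (𝓡 n) p}
    (hy : mvfderiv (𝓡 n) f p y = 0) : ∃ a : A p, 𝒜.anchor p a = y := by
  obtain ⟨w, hw⟩ : ∃ w, mvfderiv (𝓡 n) f p w ≠ 0 := by
    by_contra! h
    exact (hfU p hpU).2 (ContinuousLinearMap.ext h)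
  obtain ⟨W, rfl, -⟩ := exists_smoothSection_apply_eq (n := n)
    (F := EuclideanSpace ℝ (Fin n)) isOpen_univ (mem_univ p) w
  obtain ⟨Y, rfl, -⟩ := exists_smoothSection_apply_eq (n := n)
    (F := EuclideanSpace ℝ (Fin n)) isOpen_univ (mem_univ p) y
  obtain ⟨v, hv⟩ := h𝒜.exists_lift hf hU hpU hfU W Y
  have h1 := hv.self_of_nhds
  rw [hy, mul_zero, zero_smul, add_zero] at h1
  refine ⟨(mvfderiv (𝓡 n) f p (W p))⁻¹ • v p, ?_⟩
  rw [map_smul, h1, smul_smul, inv_mul_cancel₀ hw, one_smul]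

/-- At a point of the hypersurface, the kernel of the anchor is at most one-dimensional. -/
lemma exists_eq_smul_of_anchor_eq_zero (hZ : IsHypersurface n Z) (h𝒜 : IsBTangentBundle Z 𝒜)
    {p : M} (hp : p ∈ Z) {u ε : A p} (hu : 𝒜.anchor p u = 0) (hε : 𝒜.anchor p ε = 0)
    (hε0 : ε ≠ 0) : ∃ c : ℝ, u = c • ε := by
  obtain ⟨f, hf, U, hU, hpU, hfU⟩ := hZ.exists_definingFunction hp
  have : FiniteDimensional ℝ (A p) := (fibreBasis n A p).finiteDimensional_of_finite
  -- The kernel of df has dimension at least n - 1 and lies in the range of ρ, so rank-nullity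
  -- leaves at most one dimension for the kernel of ρ.
  have hle : LinearMap.ker (mvfderiv (𝓡 n) f p).toLinearMap ≤
      LinearMap.range (𝒜.anchor p).toLinearMap := fun _ hy =>
    h𝒜.exists_anchor_eq hf hU hpU hfU hy
  have h1 := Submodule.finrank_mono hle
  have h2 := LinearMap.finrank_range_add_finrank_ker (mvfderiv (𝓡 n) f p).toLinearMap
  have h3 := LinearMap.finrank_range_add_finrank_ker (𝒜.anchor p).toLinearMap
  have h4 := Submodule.finrank_le (LinearMap.range (mvfderiv (𝓡 n) f p).toLinearMap)
  rw [finrank_tangentSpace] at h2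
  rw [Module.finrank_eq_card_basis (fibreBasis n A p), Fintype.card_fin] at h3
  rw [Module.finrank_self] at h4
  obtain ⟨k, hk⟩ := finrank_le_one_iff.1
    (show Module.finrank ℝ (LinearMap.ker (𝒜.anchor p).toLinearMap) ≤ 1 by omega)
  obtain ⟨a, ha⟩ := hk ⟨u, hu⟩
  obtain ⟨b, hb⟩ := hk ⟨ε, hε⟩
  have ha' : a • (k : A p) = u := congrArg Subtype.val ha
  have hb' : b • (k : A p) = ε := congrArg Subtype.val hb
  have hb0 : b ≠ 0 := by
    rintro rfl
    exact hε0 (by rw [← hb', zero_smul])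
  exact ⟨a / b, by rw [← ha', ← hb', smul_smul, div_mul_cancel₀ _ hb0]⟩

end Transversality

/-! ### Construction, uniqueness and flatness of the canonical connection -/

section CanonicalConnection

set_option linter.unusedSectionVars false

variable {n : ℕ} {M : Type*} [TopologicalSpace M] [T2Space M]
  [ChartedSpace (EuclideanSpace ℝ (Fin n)) M] [IsManifold (𝓡 n) ∞ M] {Z : Set M}

section Density

variable {F : Type*} [NormedAddCommGroup F] [NormedSpace ℝ F] [FiniteDimensional ℝ F]
  {V : M → Type*} [TopologicalSpace (TotalSpace F V)]
  [∀ x, AddCommGroup (V x)] [∀ x, Module ℝ (V x)] [∀ x, TopologicalSpace (V x)]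
  [∀ x, IsTopologicalAddGroup (V x)] [∀ x, ContinuousSMul ℝ (V x)]
  [FiberBundle F V] [VectorBundle ℝ F V] [ContMDiffVectorBundle ∞ F V (𝓡 n)]

/-- If a functional separated the two values at `p`, it would separate them on a neighbourhood,
which would then lie in Z. This reduces identities between smooth sections to points off Z. -/
lemma eq_of_eventually_eq_compl (hZ : Dense Zᶜ) {τ τ' : SmoothSection n F V} {p : M}
    (h : ∀ᶠ y in 𝓝 p, y ∉ Z → τ y = τ' y) : τ p = τ' p := by
  by_contra hne
  obtain ⟨ξ, hξ⟩ := exists_dualSection_apply_ne_zero (n := n) (F := F) (sub_ne_zero.2 hne)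
  have hc : ContinuousAt (fun y => ξ y ((τ - τ') y)) p :=
    (contMDiff_pairing ξ (τ - τ')).continuous.continuousAt
  have h1 : ∀ᶠ y in 𝓝 p, y ∈ Z := by
    filter_upwards [h, hc.eventually_ne hξ] with y hy hy'
    by_contra hyZ
    apply hy'
    rw [ContMDiffSection.coe_sub, Pi.sub_apply, hy hyZ, sub_self, map_zero]
  obtain ⟨y, hy, hy'⟩ := mem_closure_iff_nhds.1 (hZ p) _ h1
  exact hy' hy

lemma ext_of_eq_compl (hZ : Dense Zᶜ) {τ τ' : SmoothSection n F V}
    (h : ∀ y ∉ Z, τ y = τ' y) : τ = τ' :=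
  ContMDiffSection.ext fun _ => eq_of_eventually_eq_compl hZ (Filter.Eventually.of_forall h)

end Density

variable {A : M → Type*} [∀ x, AddCommGroup (A x)] [∀ x, Module ℝ (A x)]
  [∀ x, TopologicalSpace (A x)] [TopologicalSpace (TotalSpace (EuclideanSpace ℝ (Fin n)) A)]
  [FiberBundle (EuclideanSpace ℝ (Fin n)) A] [VectorBundle ℝ (EuclideanSpace ℝ (Fin n)) A]
  [ContMDiffVectorBundle ∞ (EuclideanSpace ℝ (Fin n)) A (𝓡 n)]
  {𝒜 : LieAlgebroid n n A}

/-- The coefficient of an element of `Q` with respect to `det(ρ)`. -/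
def detRatio (𝒜 : LieAlgebroid n n A) (x : M) : CanonicalBundle n n A x →ₗ[ℝ] ℝ :=
  let t := trivializationAt ℝ (CanonicalBundle n n A) x
  -- Where det(ρ) vanishes the inverse is 0 by convention and the ratio is the zero map; it carries
  -- information only off the zero set.
  (t.linearMapAt ℝ x (detAnchor 𝒜 x))⁻¹ • t.linearMapAt ℝ x

lemma detRatio_smul_detAnchor {x : M} (h : detAnchor 𝒜 x ≠ 0) (q : CanonicalBundle n n A x) :
    detRatio 𝒜 x q • detAnchor 𝒜 x = q := by
  let t := trivializationAt ℝ (CanonicalBundle n n A) x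
  have ht : x ∈ t.baseSet := mem_baseSet_trivializationAt _ _ x
  have h1 : t.linearMapAt ℝ x (detAnchor 𝒜 x) ≠ 0 := by
    rw [t.linearMapAt_def_of_mem ht]
    exact (LinearEquiv.map_ne_zero_iff _).2 h
  obtain ⟨c, rfl⟩ := DetLine.exists_eq_smul h q
  have : detRatio 𝒜 x (detAnchor 𝒜 x) = 1 := inv_mul_cancel₀ h1
  rw [map_smul, this, smul_eq_mul, mul_one]

lemma detRatio_eq_of_eq_smul {x : M} (h : detAnchor 𝒜 x ≠ 0) {q : CanonicalBundle n n A x}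
    {c : ℝ} (hq : q = c • detAnchor 𝒜 x) : detRatio 𝒜 x q = c :=
  smul_left_injective ℝ h ((detRatio_smul_detAnchor h q).trans hq)

lemma contMDiffOn_detRatio (hZ : IsHypersurface n Z) (h𝒜 : IsBTangentBundle Z 𝒜)
    (σ : SmoothSection n ℝ (CanonicalBundle n n A)) :
    ContMDiffOn (𝓡 n) 𝓘(ℝ, ℝ) ∞ (fun y => detRatio 𝒜 y (σ y)) Zᶜ := by
  intro p hp
  have h0 : detSection 𝒜 p ≠ 0 := (detAnchor_eq_zero_iff hZ h𝒜 p).not.2 hp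
  obtain ⟨ξ, hξ⟩ := exists_dualSection_apply_ne_zero (n := n) (F := ℝ) h0
  refine ContMDiffAt.contMDiffWithinAt ?_
  refine ((contMDiff_pairing ξ σ).contMDiffAt.div₀
    (contMDiff_pairing ξ (detSection 𝒜)).contMDiffAt hξ).congr_of_eventuallyEq ?_
  filter_upwards [(contMDiff_pairing ξ (detSection 𝒜)).continuous.continuousAt.eventually_ne hξ]
    with y hy
  have hy0 : detAnchor 𝒜 y ≠ 0 := by
    intro h
    apply hy
    change ξ y (detAnchor 𝒜 y) = 0
    rw [h, map_zero]
  have := congrArg (ξ y) (detRatio_smul_detAnchor hy0 (σ y))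
  rw [map_smul, smul_eq_mul] at this
  exact eq_div_of_mul_eq hy this

lemma mdifferentiableAt_detRatio (hZ : IsHypersurface n Z) (h𝒜 : IsBTangentBundle Z 𝒜)
    (σ : SmoothSection n ℝ (CanonicalBundle n n A)) {y : M} (hy : y ∉ Z) :
    MDifferentiableAt (𝓡 n) 𝓘(ℝ, ℝ) (fun y => detRatio 𝒜 y (σ y)) y :=
  ((contMDiffOn_detRatio hZ h𝒜 σ).contMDiffAt (hZ.1.isOpen_compl.mem_nhds hy)).mdifferentiableAt
    (by simp)

/-- The connection on `Q`, outside the zero set of `det(ρ)`, for which `det(ρ)` is parallel. -/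
def parallelConn (𝒜 : LieAlgebroid n n A) (v : SmoothSection n (EuclideanSpace ℝ (Fin n)) A)
    (σ : SmoothSection n ℝ (CanonicalBundle n n A)) (x : M) : CanonicalBundle n n A x :=
  𝒜.lieDerivFun (fun y => detRatio 𝒜 y (σ y)) x (v x) • detAnchor 𝒜 x

/-- The Lie bracket of two smooth vector fields. -/
def fieldBracket (X Y : SmoothVectorField n M) : SmoothVectorField n M :=
  ⟨VectorField.mlieBracket (𝓡 n) X Y, by
    have : IsManifold (𝓡 n) (((⊤ : ℕ∞) : WithTop ℕ∞) + 1) M := by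
      simpa using (inferInstance : IsManifold (𝓡 n) ∞ M)
    have : IsManifold (𝓡 n) (minSmoothness ℝ 2) M := by
      rw [minSmoothness_of_isRCLikeNormedField]
      exact IsManifold.of_le (n := ∞) ENat.LEInfty.out
    exact ContDiff.mlieBracket_vectorField (n := ⊤) (m := ⊤) X.contMDiff Y.contMDiff (by simp)⟩

/-- The section `ℒ_v α ⊗ ω + α ⊗ ℒ_{ρ(v)} ω` of `Q`, for `ω = Y₁ ∧ ⋯ ∧ Yₙ`. -/
def lieDerivSection (𝒜 : LieAlgebroid n n A) (v : SmoothSection n (EuclideanSpace ℝ (Fin n)) A)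
    {α β : ∀ x, (A x) [⋀^Fin n]→ₗ[ℝ] ℝ} (hα : LieAlgebroid.IsSmoothForm (n := n) α)
    (hβ : LieAlgebroid.IsSmoothForm (n := n) β) (Y : Fin n → SmoothVectorField n M) :
    SmoothSection n ℝ (CanonicalBundle n n A) :=
  mkSection hβ Y + ∑ j, mkSection hα
    (Function.update Y j (fieldBracket (𝒜.anchorSection v) (Y j)))

lemma lieDerivSection_apply (v : SmoothSection n (EuclideanSpace ℝ (Fin n)) A)
    {α β : ∀ x, (A x) [⋀^Fin n]→ₗ[ℝ] ℝ} (hα : LieAlgebroid.IsSmoothForm (n := n) α)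
    (hβ : LieAlgebroid.IsSmoothForm (n := n) β) (Y : Fin n → SmoothVectorField n M) (x : M) :
    lieDerivSection 𝒜 v hα hβ Y x = DetLine.mk (β x) (fun j => Y j x) +
      ∑ j, DetLine.mk (α x) (Function.update (fun i => Y i x) j
        (VectorField.mlieBracket (𝓡 n) (𝒜.anchorSection v) (Y j) x)) := by
  unfold lieDerivSection
  rw [ContMDiffSection.coe_add, Pi.add_apply]
  congr 1
  rw [← ContMDiffSection.coeAddHom_apply, map_sum, Finset.sum_apply]
  refine Finset.sum_congr rfl fun j _ => ?_
  change DetLine.mk (α x) _ = _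
  congr 1
  exact update_eval Y j _ x

/-- Outside the hypersurface, `det(ρ)` is parallel for the canonical connection. -/
lemma parallelConn_mkSection (hZ : IsHypersurface n Z) (h𝒜 : IsBTangentBundle Z 𝒜)
    (v : SmoothSection n (EuclideanSpace ℝ (Fin n)) A)
    {α β : ∀ x, (A x) [⋀^Fin n]→ₗ[ℝ] ℝ} (hα : LieAlgebroid.IsSmoothForm (n := n) α)
    (hβ : LieAlgebroid.IsSmoothForm (n := n) β) (hαβ : 𝒜.IsLieDerivForm v α β)
    (Y : Fin n → SmoothVectorField n M) {x : M} (hx : x ∉ Z) :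
    parallelConn 𝒜 v (mkSection hα Y) x = lieDerivSection 𝒜 v hα hβ Y x := by
  have hZo := hZ.1.isOpen_compl.mem_nhds (show x ∈ Zᶜ from hx)
  obtain ⟨χ, h1, h2, h3⟩ := exists_bump (n := n) hZo
  -- The cut-off fields vanish on Z, so they lift to `A`; near `x` the lifts have anchors `Y j`.
  have hb : ∀ j, ∃ b : SmoothSection n (EuclideanSpace ℝ (Fin n)) A,
      ∀ y, 𝒜.anchor y (b y) = χ y • Y j y := fun j =>
    h𝒜.exists_section (funSmul χ h1 (Y j)) fun p hp => by
      rw [funSmul_apply, image_eq_zero_of_notMem_tsupport (fun h => h3 h hp), zero_smul]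
      exact isTangentVector_zero p
  choose b hb using hb
  have hbY : ∀ᶠ y in 𝓝 x, ∀ j, 𝒜.anchor y (b j y) = Y j y := by
    filter_upwards [h2] with y hy j
    rw [hb, hy, one_smul]
  have hratio : (fun y => detRatio 𝒜 y (mkSection hα Y y)) =ᶠ[𝓝 x]
      fun y => α y (fun i => b i y) := by
    filter_upwards [hbY, hZo] with y hy hyZ
    refine detRatio_eq_of_eq_smul ((detAnchor_eq_zero_iff hZ h𝒜 y).not.2 hyZ) ?_
    rw [← mk_anchor_eq_smul_detAnchor]
    change DetLine.mk (α y) _ = _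
    congr 1
    exact funext fun j => (hy j).symm
  have hY : (fun i => Y i x) = fun i => 𝒜.anchor x (b i x) :=
    funext fun j => (hbY.self_of_nhds j).symm
  rw [lieDerivSection_apply, hY, mk_anchor_eq_smul_detAnchor, hαβ b x]
  -- Since the anchor preserves brackets, [ρ(v), Yⱼ] = ρ([v, bⱼ]). These terms therefore match those
  -- subtracted in ℒ_v α, and only ρ(v)(α(b₁, …, bₙ)) survives in the sum.
  have hbr : ∀ j, (DetLine.mk (α x) (Function.update (fun i => 𝒜.anchor x (b i x)) j
        (VectorField.mlieBracket (𝓡 n) (𝒜.anchorSection v) (Y j) x)) :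
          CanonicalBundle n n A x) =
      α x (Function.update (fun i => b i x) j (𝒜.bracket v (b j) x)) • detAnchor 𝒜 x := by
    intro j
    rw [← mk_anchor_eq_smul_detAnchor]
    congr 1
    have e1 : VectorField.mlieBracket (𝓡 n) (𝒜.anchorSection v) (Y j) x =
        𝒜.anchor x (𝒜.bracket v (b j) x) := by
      rw [𝒜.anchor_bracket]
      refine Filter.EventuallyEq.mlieBracket_vectorField_eq
        (Filter.EventuallyEq.of_eq rfl) ?_
      filter_upwards [hbY] with y hy using (hy j).symm
    rw [e1]
    funext i
    by_cases hi : i = j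
    · subst hi; simp
    · simp [hi]
  simp only [hbr]
  rw [← Finset.sum_smul, ← add_smul, sub_add_cancel]
  unfold parallelConn LieAlgebroid.lieDerivFun
  rw [mvfderiv_congr_of_eventuallyEq hratio]

lemma parallelConn_congr {v : SmoothSection n (EuclideanSpace ℝ (Fin n)) A}
    {σ σ' : SmoothSection n ℝ (CanonicalBundle n n A)} {x : M} (h : ∀ᶠ y in 𝓝 x, σ y = σ' y) :
    parallelConn 𝒜 v σ x = parallelConn 𝒜 v σ' x := by
  unfold parallelConn LieAlgebroid.lieDerivFun
  rw [mvfderiv_congr_of_eventuallyEq (h.mono fun y hy => by rw [hy])]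

lemma parallelConn_funSmul (hZ : IsHypersurface n Z) (h𝒜 : IsBTangentBundle Z 𝒜)
    (v : SmoothSection n (EuclideanSpace ℝ (Fin n)) A) {g : M → ℝ}
    (hg : ContMDiff (𝓡 n) 𝓘(ℝ, ℝ) ∞ g) (σ : SmoothSection n ℝ (CanonicalBundle n n A))
    {x : M} (hx : x ∉ Z) : parallelConn 𝒜 v (funSmul g hg σ) x =
      g x • parallelConn 𝒜 v σ x + 𝒜.lieDerivFun g x (v x) • σ x := by
  unfold parallelConn LieAlgebroid.lieDerivFun
  have h1 : (fun y => detRatio 𝒜 y (funSmul g hg σ y)) =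
      fun y => g y * (fun y => detRatio 𝒜 y (σ y)) y := by
    funext y
    rw [funSmul_apply, map_smul, smul_eq_mul]
  have h2 := detRatio_smul_detAnchor ((detAnchor_eq_zero_iff hZ h𝒜 x).not.2 hx) (σ x)
  rw [h1, mvfderiv_mul_apply (hg.contMDiffAt.mdifferentiableAt (by simp))
    (mdifferentiableAt_detRatio hZ h𝒜 σ hx)]
  conv_rhs => rw [← h2]
  simp only [smul_smul, ← add_smul]
  congr 1
  ring

/-- Locally, sections of a line bundle are multiples of a nonvanishing one. -/
lemma exists_eventually_eq_funSmul {p : M} {q : SmoothSection n ℝ (CanonicalBundle n n A)}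
    (hq : q p ≠ 0) (σ : SmoothSection n ℝ (CanonicalBundle n n A)) :
    ∃ (g : M → ℝ) (hg : ContMDiff (𝓡 n) 𝓘(ℝ, ℝ) ∞ g), ∀ᶠ y in 𝓝 p, σ y = funSmul g hg q y := by
  obtain ⟨ξ, hξ⟩ := exists_dualSection_apply_ne_zero (n := n) (F := ℝ) hq
  have hξq := contMDiff_pairing ξ q
  have hU : IsOpen {y | ξ y (q y) ≠ 0} := isOpen_ne_fun hξq.continuous continuous_const
  obtain ⟨g, hg, hg', -⟩ := exists_contMDiff_eventuallyEq (n := n) hU hξ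
    ((contMDiff_pairing ξ σ).contMDiffOn.div₀ hξq.contMDiffOn fun x hx => hx)
  refine ⟨g, hg, ?_⟩
  filter_upwards [hg', hU.mem_nhds hξ] with y hy hyU
  have hyU' : ξ y (q y) ≠ 0 := hyU
  have hq0 : q y ≠ 0 := fun h => hyU' (by rw [h, map_zero])
  obtain ⟨c, hc⟩ := DetLine.exists_eq_smul hq0 (σ y)
  rw [funSmul_apply, hy, hc]
  congr 1
  rw [Pi.div_apply, hc, map_smul, smul_eq_mul, mul_div_cancel_right₀ _ hyU']

lemma exists_conn (hZ : IsHypersurface n Z) (h𝒜 : IsBTangentBundle Z 𝒜)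
    (v : SmoothSection n (EuclideanSpace ℝ (Fin n)) A)
    (σ : SmoothSection n ℝ (CanonicalBundle n n A)) :
    ∃ τ : SmoothSection n ℝ (CanonicalBundle n n A), ∀ y ∉ Z, τ y = parallelConn 𝒜 v σ y := by
  have hloc : ∀ p, ∃ τ : SmoothSection n ℝ (CanonicalBundle n n A),
      ∀ᶠ y in 𝓝 p, y ∉ Z → τ y = parallelConn 𝒜 v σ y := by
    intro p
    obtain ⟨α, hα, Y, hq⟩ := exists_mkSection_ne_zero (n := n) A p
    obtain ⟨g, hg, hσ⟩ := exists_eventually_eq_funSmul hq σ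
    obtain ⟨β, hβ⟩ := 𝒜.exists_isLieDerivForm hα v
    -- Near `p`, σ = g (α ⊗ ω), and the Leibniz rule dictates the candidate. It is smooth across Z,
    -- although `parallelConn` is meaningful only off Z.
    refine ⟨funSmul g hg (lieDerivSection 𝒜 v hα (hβ.isSmoothForm hα) Y) +
      funSmul _ (contMDiff_mvfderiv_apply hg (𝒜.anchorSection v)) (mkSection hα Y), ?_⟩
    filter_upwards [hσ.eventually_nhds] with y hy hyZ
    rw [parallelConn_congr hy, parallelConn_funSmul hZ h𝒜 v hg _ hyZ,
      parallelConn_mkSection hZ h𝒜 v hα (hβ.isSmoothForm hα) hβ Y hyZ]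
    rfl
  choose τ hτ using hloc
  -- Local candidates agree off Z, hence also on Z by density, so their diagonal is locally one
  -- smooth section.
  have hτ' : ∀ p, ∀ᶠ y in 𝓝 p, τ y y = τ p y := by
    intro p
    filter_upwards [(hτ p).eventually_nhds] with y hy
    refine eq_of_eventually_eq_compl hZ.dense_compl ?_
    filter_upwards [hτ y, hy] with z h1 h2 hz
    rw [h1 hz, h2 hz]
  refine ⟨⟨fun x => τ x x, fun p => ?_⟩, fun y hy => (hτ y).self_of_nhds hy⟩
  refine (τ p).contMDiff.contMDiffAt.congr_of_eventuallyEq ?_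
  filter_upwards [hτ' p] with y hy
  simp only [hy]

lemma lieDerivFun_add {f g : M → ℝ} {x : M} (hf : MDifferentiableAt (𝓡 n) 𝓘(ℝ, ℝ) f x)
    (hg : MDifferentiableAt (𝓡 n) 𝓘(ℝ, ℝ) g x) (a : A x) :
    𝒜.lieDerivFun (fun y => f y + g y) x a = 𝒜.lieDerivFun f x a + 𝒜.lieDerivFun g x a := by
  unfold LieAlgebroid.lieDerivFun
  have h := mvfderiv_add hf hg
  change mvfderiv (𝓡 n) (f + g) x _ = _
  rw [h]
  rfl

/-- The canonical connection on `Q`. -/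
def canonicalConnection (hZ : IsHypersurface n Z) (h𝒜 : IsBTangentBundle Z 𝒜) :
    AConnection 𝒜 ℝ (CanonicalBundle n n A) where
  -- The chosen section is determined by its values off Z, so bilinearity and both
  -- function-linearity rules follow from those of `parallelConn`.
  conn := LinearMap.mk₂ ℝ (fun v σ => (exists_conn hZ h𝒜 v σ).choose)
    (fun v v' σ => ext_of_eq_compl hZ.dense_compl fun y hy => by
      rw [ContMDiffSection.coe_add, Pi.add_apply, (exists_conn hZ h𝒜 _ _).choose_spec y hy,
        (exists_conn hZ h𝒜 _ _).choose_spec y hy, (exists_conn hZ h𝒜 _ _).choose_spec y hy]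
      simp only [parallelConn, LieAlgebroid.lieDerivFun, ContMDiffSection.coe_add, Pi.add_apply,
        map_add, add_smul])
    (fun c v σ => ext_of_eq_compl hZ.dense_compl fun y hy => by
      rw [ContMDiffSection.coe_smul, Pi.smul_apply, (exists_conn hZ h𝒜 _ _).choose_spec y hy,
        (exists_conn hZ h𝒜 _ _).choose_spec y hy]
      simp only [parallelConn, LieAlgebroid.lieDerivFun, ContMDiffSection.coe_smul, Pi.smul_apply,
        map_smul, smul_assoc])
    (fun v σ σ' => ext_of_eq_compl hZ.dense_compl fun y hy => by
      rw [ContMDiffSection.coe_add, Pi.add_apply, (exists_conn hZ h𝒜 _ _).choose_spec y hy,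
        (exists_conn hZ h𝒜 _ _).choose_spec y hy, (exists_conn hZ h𝒜 _ _).choose_spec y hy]
      simp only [parallelConn, ContMDiffSection.coe_add, Pi.add_apply, map_add]
      rw [lieDerivFun_add (mdifferentiableAt_detRatio hZ h𝒜 σ hy)
        (mdifferentiableAt_detRatio hZ h𝒜 σ' hy), add_smul])
    (fun c v σ => ext_of_eq_compl hZ.dense_compl fun y hy => by
      have h := parallelConn_funSmul hZ h𝒜 v (g := fun _ => c) contMDiff_const σ hy
      have h0 : 𝒜.lieDerivFun (fun _ : M => c) y (v y) = 0 := by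
        unfold LieAlgebroid.lieDerivFun
        rw [mvfderiv_const]
        rfl
      rw [h0, zero_smul, add_zero] at h
      rw [ContMDiffSection.coe_smul, Pi.smul_apply, (exists_conn hZ h𝒜 _ _).choose_spec y hy,
        (exists_conn hZ h𝒜 _ _).choose_spec y hy]
      exact h)
  smul_left f hf v v' hv σ x := by
    have : (exists_conn hZ h𝒜 v' σ).choose = funSmul f hf (exists_conn hZ h𝒜 v σ).choose :=
      ext_of_eq_compl hZ.dense_compl fun y hy => by
        rw [funSmul_apply, (exists_conn hZ h𝒜 _ _).choose_spec y hy,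
          (exists_conn hZ h𝒜 _ _).choose_spec y hy]
        simp only [parallelConn, LieAlgebroid.lieDerivFun, hv, map_smul, smul_assoc]
    exact congrArg (fun τ : SmoothSection n ℝ (CanonicalBundle n n A) => τ x) this
  leibniz f hf v σ σ' hσ x := by
    have : (exists_conn hZ h𝒜 v σ').choose = funSmul f hf (exists_conn hZ h𝒜 v σ).choose +
        funSmul _ (contMDiff_mvfderiv_apply hf (𝒜.anchorSection v)) σ :=
      ext_of_eq_compl hZ.dense_compl fun y hy => by
        rw [ContMDiffSection.coe_add, Pi.add_apply, funSmul_apply, funSmul_apply,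
          (exists_conn hZ h𝒜 _ _).choose_spec y hy, (exists_conn hZ h𝒜 _ _).choose_spec y hy,
          parallelConn_congr (σ' := funSmul f hf σ) (Filter.Eventually.of_forall hσ),
          parallelConn_funSmul hZ h𝒜 v hf σ hy]
        rfl
    exact congrArg (fun τ : SmoothSection n ℝ (CanonicalBundle n n A) => τ x) this

lemma canonicalConnection_apply (hZ : IsHypersurface n Z) (h𝒜 : IsBTangentBundle Z 𝒜)
    (v : SmoothSection n (EuclideanSpace ℝ (Fin n)) A)
    (σ : SmoothSection n ℝ (CanonicalBundle n n A)) {y : M} (hy : y ∉ Z) :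
    (canonicalConnection hZ h𝒜).conn v σ y = parallelConn 𝒜 v σ y :=
  (exists_conn hZ h𝒜 v σ).choose_spec y hy

lemma isCanonicalConnection_canonicalConnection (hZ : IsHypersurface n Z)
    (h𝒜 : IsBTangentBundle Z 𝒜) : IsCanonicalConnection (canonicalConnection hZ h𝒜) := by
  intro v α β Y σ hα hβ hσ x
  obtain rfl : σ = mkSection hα Y := ContMDiffSection.ext hσ
  rw [← lieDerivSection_apply v hα (hβ.isSmoothForm hα)]
  have : (canonicalConnection hZ h𝒜).conn v (mkSection hα Y) =
      lieDerivSection 𝒜 v hα (hβ.isSmoothForm hα) Y :=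
    ext_of_eq_compl hZ.dense_compl fun y hy => by
      rw [canonicalConnection_apply hZ h𝒜 _ _ hy, parallelConn_mkSection hZ h𝒜 v hα _ hβ Y hy]
  rw [this]

section AConnection

variable (D : AConnection 𝒜 ℝ (CanonicalBundle n n A))

lemma AConnection.conn_funSmul (v : SmoothSection n (EuclideanSpace ℝ (Fin n)) A) {g : M → ℝ}
    (hg : ContMDiff (𝓡 n) 𝓘(ℝ, ℝ) ∞ g) (σ : SmoothSection n ℝ (CanonicalBundle n n A)) (x : M) :
    D.conn v (funSmul g hg σ) x = g x • D.conn v σ x + 𝒜.lieDerivFun g x (v x) • σ x :=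
  D.leibniz g hg v σ _ (fun _ => rfl) x

/-- The difference is unchanged by a factor `1 - χ` vanishing at `x`, so the Leibniz rule expresses
its derivative at `x` through quantities that are zero there. -/
lemma AConnection.conn_congr (v : SmoothSection n (EuclideanSpace ℝ (Fin n)) A)
    {σ σ' : SmoothSection n ℝ (CanonicalBundle n n A)} {x : M} (h : ∀ᶠ y in 𝓝 x, σ y = σ' y) :
    D.conn v σ x = D.conn v σ' x := by
  obtain ⟨χ, h1, h2, h3⟩ := exists_bump (n := n) h
  have h1' : ContMDiff (𝓡 n) 𝓘(ℝ, ℝ) ∞ (fun y => 1 - χ y) := contMDiff_const.sub h1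
  have key : σ - σ' = funSmul _ h1' (σ - σ') := by
    ext y
    by_cases hy : σ y = σ' y
    · simp [hy]
    · simp [image_eq_zero_of_notMem_tsupport (fun h => hy (h3 h))]
  have : D.conn v (σ - σ') x = 0 := by
    rw [key, D.conn_funSmul, h2.self_of_nhds, ContMDiffSection.coe_sub, Pi.sub_apply,
      h.self_of_nhds]
    simp
  rw [map_sub, ContMDiffSection.coe_sub, Pi.sub_apply] at this
  exact sub_eq_zero.1 this

/-- The covariant derivative depends only on the value of the section of `A`. -/
lemma AConnection.conn_congr_left {v v' : SmoothSection n (EuclideanSpace ℝ (Fin n)) A}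
    (σ : SmoothSection n ℝ (CanonicalBundle n n A)) {x : M} (h : v x = v' x) :
    D.conn v σ x = D.conn v' σ x := by
  let L : SmoothSection n (EuclideanSpace ℝ (Fin n)) A →ₗ[ℝ] CanonicalBundle n n A x :=
    { toFun := fun w => D.conn w σ x
      map_add' := fun w w' => by rw [map_add]; rfl
      map_smul' := fun c w => by rw [map_smul]; rfl }
  have := eq_zero_of_tensorial (p := x) L (fun f hf w => D.smul_left f hf w _ (fun _ => rfl) σ x)
    (v := v - v') (by rw [ContMDiffSection.coe_sub, Pi.sub_apply, h, sub_self])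
  rw [map_sub] at this
  exact sub_eq_zero.1 this

/-- Near each point a section is a function times some nonvanishing α ⊗ ω. The Leibniz rule and the
defining formula then fix its derivative. -/
lemma IsCanonicalConnection.unique {D D' : AConnection 𝒜 ℝ (CanonicalBundle n n A)}
    (hD : IsCanonicalConnection D) (hD' : IsCanonicalConnection D') : D' = D := by
  have h : D'.conn = D.conn := by
    ext v σ p
    obtain ⟨α, hα, Y, hq⟩ := exists_mkSection_ne_zero (n := n) A p
    obtain ⟨g, hg, hσ⟩ := exists_eventually_eq_funSmul hq σ
    obtain ⟨β, hβ⟩ := 𝒜.exists_isLieDerivForm hα v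
    rw [D.conn_congr v hσ, D'.conn_congr v hσ, D.conn_funSmul, D'.conn_funSmul,
      hD v α β Y _ hα hβ (fun _ => rfl) p, hD' v α β Y _ hα hβ (fun _ => rfl) p]
  cases D
  cases D'
  cases h
  rfl

end AConnection

/-- Compare coefficients of `w` in the Jacobi identity for `u`, `v`, `g w` with those for `u`, `v`,
`w`: the Leibniz rule leaves exactly the second derivatives of `g`. -/
lemma lieDerivFun_bracket (g : M → ℝ) (hg : ContMDiff (𝓡 n) 𝓘(ℝ, ℝ) ∞ g)
    (u v : SmoothSection n (EuclideanSpace ℝ (Fin n)) A) (x : M) :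
    𝒜.lieDerivFun g x (𝒜.bracket u v x) =
      𝒜.lieDerivFun (fun y => 𝒜.lieDerivFun g y (v y)) x (u x) -
        𝒜.lieDerivFun (fun y => 𝒜.lieDerivFun g y (u y)) x (v x) := by
  -- Comparing coefficients needs a nonzero vector in the fibre; in a zero fibre both sides vanish.
  by_cases hA : ∃ w : A x, w ≠ 0
  swap
  · push Not at hA
    simp only [LieAlgebroid.lieDerivFun]
    rw [hA (𝒜.bracket u v x), hA (u x), hA (v x)]
    simp
  obtain ⟨w₀, hw⟩ := hA
  obtain ⟨w, rfl, -⟩ := exists_smoothSection_apply_eq (n := n)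
    (F := EuclideanSpace ℝ (Fin n)) isOpen_univ (mem_univ x) w₀
  have hb : ∀ a b : SmoothSection n (EuclideanSpace ℝ (Fin n)) A,
      𝒜.bracket a (funSmul g hg b) = funSmul g hg (𝒜.bracket a b) +
        funSmul _ (contMDiff_mvfderiv_apply hg (𝒜.anchorSection a)) b := fun a b =>
    ContMDiffSection.ext fun y => 𝒜.bracket_funSmul g hg a b y
  have hj := congrArg (fun τ : SmoothSection n (EuclideanSpace ℝ (Fin n)) A => τ x)
    (𝒜.jacobi u v (funSmul g hg w))
  have hj0 := congrArg (fun τ : SmoothSection n (EuclideanSpace ℝ (Fin n)) A => τ x)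
    (𝒜.jacobi u v w)
  simp only [hb, map_add, ContMDiffSection.coe_add, Pi.add_apply, 𝒜.bracket_funSmul,
    funSmul_apply] at hj hj0
  rw [hj0] at hj
  apply smul_left_injective ℝ hw
  simp only [sub_smul]
  simp only [smul_add] at hj
  change _ = 𝒜.lieDerivFun (fun y => mvfderiv (𝓡 n) g y (𝒜.anchorSection v y)) x (u x) • w x -
    𝒜.lieDerivFun (fun y => mvfderiv (𝓡 n) g y (𝒜.anchorSection u y)) x (v x) • w x
  have e : ∀ a : SmoothSection n (EuclideanSpace ℝ (Fin n)) A,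
    mvfderiv (𝓡 n) g x (𝒜.anchorSection a x) = 𝒜.lieDerivFun g x (a x) := fun _ => rfl
  rw [eq_sub_iff_add_eq]
  simp only [e] at hj
  rw [← sub_eq_zero] at hj ⊢
  rw [← neg_eq_zero, ← hj]
  abel

/-- Off Z the connection acts on the coefficient of det(ρ) as the derivative along the anchor, so
its curvature there is the failure of ρ to preserve brackets, which is zero. -/
lemma isFlat_canonicalConnection (hZ : IsHypersurface n Z) (h𝒜 : IsBTangentBundle Z 𝒜) :
    (canonicalConnection hZ h𝒜).IsFlat := by
  intro u v σ
  refine ext_of_eq_compl hZ.dense_compl fun x hx => ?_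
  have hZo := hZ.1.isOpen_compl
  obtain ⟨g, hg, hgσ, -⟩ := exists_contMDiff_eventuallyEq hZo (show x ∈ Zᶜ from hx)
    (contMDiffOn_detRatio hZ h𝒜 σ)
  have hr : ∀ a : SmoothSection n (EuclideanSpace ℝ (Fin n)) A, ∀ᶠ y in 𝓝 x,
      detRatio 𝒜 y ((canonicalConnection hZ h𝒜).conn a σ y) = 𝒜.lieDerivFun g y (a y) := by
    intro a
    filter_upwards [hZo.mem_nhds hx, hgσ.eventually_nhds] with y hy hgy
    refine detRatio_eq_of_eq_smul ((detAnchor_eq_zero_iff hZ h𝒜 y).not.2 hy) ?_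
    rw [canonicalConnection_apply hZ h𝒜 _ _ hy]
    unfold parallelConn LieAlgebroid.lieDerivFun
    rw [mvfderiv_congr_of_eventuallyEq hgy]
  simp only [ContMDiffSection.coe_sub, Pi.sub_apply, ContMDiffSection.coe_zero, Pi.zero_apply]
  rw [canonicalConnection_apply hZ h𝒜 _ _ hx, canonicalConnection_apply hZ h𝒜 _ _ hx,
    canonicalConnection_apply hZ h𝒜 _ _ hx]
  unfold parallelConn
  rw [← sub_smul, ← sub_smul]
  have e1 : ∀ (f : M → ℝ) (f' : M → ℝ) (a : A x), (∀ᶠ y in 𝓝 x, f y = f' y) →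
      𝒜.lieDerivFun f x a = 𝒜.lieDerivFun f' x a := fun f f' a h => by
    unfold LieAlgebroid.lieDerivFun
    rw [mvfderiv_congr_of_eventuallyEq h]
  rw [e1 _ _ _ (hr v), e1 _ _ _ (hr u), ← e1 _ _ _ hgσ, lieDerivFun_bracket g hg, sub_self,
    zero_smul]

end CanonicalConnection

/-! ### Tangent vectors on the total space of a line bundle -/

section LineBundle

set_option linter.unusedSectionVars false

variable {n : ℕ} {M : Type*} [TopologicalSpace M] [ChartedSpace (EuclideanSpace ℝ (Fin n)) M]
  {F : Type*} [NormedAddCommGroup F] [NormedSpace ℝ F]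
  {V : M → Type*} [TopologicalSpace (TotalSpace F V)]
  [∀ x, AddCommGroup (V x)] [∀ x, Module ℝ (V x)] [∀ x, TopologicalSpace (V x)]
  [FiberBundle F V] [VectorBundle ℝ F V] [IsManifold (𝓡 n) ∞ M] [ContMDiffVectorBundle ∞ F V (𝓡 n)]

/-- On the total space of a line bundle, a tangent vector is determined by its image in the base
and by the derivative of a function which is linear on the fibres. -/
lemma injective_mfderiv_proj_prod (hF : Module.finrank ℝ F = 1) {l : TotalSpace F V → ℝ}
    (hl : ContMDiff ((𝓡 n).prod 𝓘(ℝ, F)) 𝓘(ℝ, ℝ) ∞ l)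
    (hlin : ∀ (y : M) (c : ℝ) (v : V y), l ⟨y, c • v⟩ = c * l ⟨y, v⟩) {e : TotalSpace F V}
    (hne : ∃ v : V e.proj, l ⟨e.proj, v⟩ ≠ 0)
    {w : TangentSpace ((𝓡 n).prod 𝓘(ℝ, F)) e}
    (h1 : mfderiv ((𝓡 n).prod 𝓘(ℝ, F)) (𝓡 n) (TotalSpace.proj : TotalSpace F V → M) e w = 0)
    (h2 : mvfderiv ((𝓡 n).prod 𝓘(ℝ, F)) l e w = 0) : w = 0 := by
  have : FiniteDimensional ℝ F := Module.finite_of_finrank_eq_succ hF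
  let κ : F ≃L[ℝ] ℝ := ContinuousLinearEquiv.ofFinrankEq (by rw [hF, Module.finrank_self])
  let t := trivializationAt F V e.proj
  have hb : e.proj ∈ t.baseSet := mem_baseSet_trivializationAt F V e.proj
  have he : e ∈ t.source := t.mem_source.2 hb
  let μ : M → ℝ := fun y => l ⟨y, t.symm y (κ.symm 1)⟩
  let k : TotalSpace F V → ℝ := fun e' => κ (t e').2
  have hμ : MDifferentiableAt (𝓡 n) 𝓘(ℝ, ℝ) μ e.proj := by
    refine ContMDiffAt.mdifferentiableAt (n := ∞) ?_ (by simp)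
    refine ContMDiffAt.comp (I' := (𝓡 n).prod 𝓘(ℝ, F)) (g := l) e.proj hl.contMDiffAt ?_
    rw [t.contMDiffAt_section_iff hb]
    refine (contMDiffAt_const (c := κ.symm 1)).congr_of_eventuallyEq ?_
    filter_upwards [t.open_baseSet.mem_nhds hb] with y hy
    rw [t.apply_mk_symm hy]
  have ht : ContMDiffAt ((𝓡 n).prod 𝓘(ℝ, F)) ((𝓡 n).prod 𝓘(ℝ, F)) ∞ t e :=
    t.contMDiffOn.contMDiffAt (t.open_source.mem_nhds he)
  have hk' : ContMDiffAt ((𝓡 n).prod 𝓘(ℝ, F)) 𝓘(ℝ, F) ∞ (fun e' => (t e').2) e := ht.snd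
  have hk : MDifferentiableAt ((𝓡 n).prod 𝓘(ℝ, F)) 𝓘(ℝ, ℝ) k e :=
    ((κ : F →L[ℝ] ℝ).contMDiff.contMDiffAt.comp e hk').mdifferentiableAt (by simp)
  have hsmul : ∀ y ∈ t.baseSet, ∀ v : V y, v = κ (t ⟨y, v⟩).2 • t.symm y (κ.symm 1) := by
    intro y hy v
    apply (t.linearEquivAt ℝ y hy).injective
    rw [map_smul]
    change (t ⟨y, v⟩).2 = κ (t ⟨y, v⟩).2 • (t ⟨y, t.symm y (κ.symm 1)⟩).2
    rw [t.apply_mk_symm hy, ← map_smul, smul_eq_mul, mul_one, κ.symm_apply_apply]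
  -- In the trivialization `l` is the fibre coordinate `k` times a function μ from the base, nonzero
  -- at the base point. On a vertical vector dl = μ dk, so dl = 0 forces dk = 0. Then the derivative
  -- of the local diffeomorphism `t` annihilates `w`.
  have hlk : l =ᶠ[𝓝 e] fun e' => (μ ∘ TotalSpace.proj) e' * k e' := by
    filter_upwards [t.open_source.mem_nhds he] with e' he'
    have := hlin e'.proj (k e') (t.symm e'.proj (κ.symm 1))
    rw [← hsmul e'.proj (t.mem_source.1 he') e'.2] at this
    rw [mul_comm]
    exact this
  have hμe : μ e.proj ≠ 0 := by
    obtain ⟨v, hv⟩ := hne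
    rw [hsmul e.proj hb v, hlin] at hv
    exact right_ne_zero_of_mul hv
  rw [mvfderiv_congr_of_eventuallyEq hlk,
    mvfderiv_mul_apply (hμ.comp e (Bundle.mdifferentiableAt_proj V)) hk,
    mvfderiv_comp_apply e hμ (Bundle.mdifferentiableAt_proj V), h1, map_zero, mul_zero, add_zero,
    mul_eq_zero] at h2
  have h3 : mfderiv ((𝓡 n).prod 𝓘(ℝ, F)) 𝓘(ℝ, F) (fun e' => (t e').2) e w = 0 := by
    have hc := mfderiv_comp_apply e ((κ.symm : ℝ →L[ℝ] F).contMDiff (n := 1) (k e)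
      |>.mdifferentiableAt (by simp)) hk w
    have hκ : (κ.symm : ℝ →L[ℝ] F) ∘ k = fun e' => (t e').2 :=
      funext fun e' => κ.symm_apply_apply _
    rw [hκ] at hc
    rw [hc]
    exact (congrArg _ (h2.resolve_left hμe)).trans (map_zero _)
  have h4 : mfderiv ((𝓡 n).prod 𝓘(ℝ, F)) ((𝓡 n).prod 𝓘(ℝ, F)) t e w = 0 := by
    have : mfderiv ((𝓡 n).prod 𝓘(ℝ, F)) ((𝓡 n).prod 𝓘(ℝ, F)) t e =
      mfderiv ((𝓡 n).prod 𝓘(ℝ, F)) ((𝓡 n).prod 𝓘(ℝ, F)) (fun e' => (e'.proj, (t e').2)) e := by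
      refine Filter.EventuallyEq.mfderiv_eq ?_
      filter_upwards [t.open_source.mem_nhds he] with e' he'
      exact (t.mk_proj_snd he').symm
    rw [this]
    rw [mfderiv_prodMk (Bundle.mdifferentiableAt_proj V) (hk'.mdifferentiableAt (by simp))]
    exact Prod.ext h1 h3
  have ht' : MDifferentiableAt ((𝓡 n).prod 𝓘(ℝ, F)) ((𝓡 n).prod 𝓘(ℝ, F))
      t.toOpenPartialHomeomorph.symm (t e) :=
    (t.contMDiffOn_symm.contMDiffAt (n := ∞) (t.open_target.mem_nhds
      (t.toOpenPartialHomeomorph.map_source he))).mdifferentiableAt (by simp)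
  have h5 := mfderiv_comp_apply e ht' (ht.mdifferentiableAt (by simp)) w
  rw [h4, map_zero, Filter.EventuallyEq.mfderiv_eq (f := id), mfderiv_id] at h5
  · exact h5
  · filter_upwards [t.open_source.mem_nhds he] with e' he'
    exact t.toOpenPartialHomeomorph.left_inv he'

variable [T2Space M] [FiniteDimensional ℝ F]

/-- Injectivity suffices, as both spaces have dimension n + 1. -/
lemma bijective_mfderiv_proj_prod (hF : Module.finrank ℝ F = 1) {l : TotalSpace F V → ℝ}
    (hl : ContMDiff ((𝓡 n).prod 𝓘(ℝ, F)) 𝓘(ℝ, ℝ) ∞ l)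
    (hlin : ∀ (y : M) (c : ℝ) (v : V y), l ⟨y, c • v⟩ = c * l ⟨y, v⟩) {e : TotalSpace F V}
    (hne : ∃ v : V e.proj, l ⟨e.proj, v⟩ ≠ 0) :
    Function.Bijective fun w : TangentSpace ((𝓡 n).prod 𝓘(ℝ, F)) e =>
      ((mfderiv ((𝓡 n).prod 𝓘(ℝ, F)) (𝓡 n) (TotalSpace.proj : TotalSpace F V → M) e w,
        mvfderiv ((𝓡 n).prod 𝓘(ℝ, F)) l e w) : TangentSpace (𝓡 n) e.proj × ℝ) := by
  let Ψ : TangentSpace ((𝓡 n).prod 𝓘(ℝ, F)) e →ₗ[ℝ] TangentSpace (𝓡 n) e.proj × ℝ :=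
    (mfderiv ((𝓡 n).prod 𝓘(ℝ, F)) (𝓡 n) (TotalSpace.proj : TotalSpace F V → M) e).toLinearMap.prod
      (mvfderiv ((𝓡 n).prod 𝓘(ℝ, F)) l e).toLinearMap
  have hinj : Function.Injective Ψ := (injective_iff_map_eq_zero _).2 fun w hw =>
    injective_mfderiv_proj_prod hF hl hlin hne (Prod.ext_iff.1 hw).1 (Prod.ext_iff.1 hw).2
  have : FiniteDimensional ℝ (TangentSpace ((𝓡 n).prod 𝓘(ℝ, F)) e) :=
    inferInstanceAs (FiniteDimensional ℝ (EuclideanSpace ℝ (Fin n) × F))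
  have hd : Module.finrank ℝ (TangentSpace ((𝓡 n).prod 𝓘(ℝ, F)) e) =
      Module.finrank ℝ (TangentSpace (𝓡 n) e.proj × ℝ) := by
    rw [Module.finrank_prod, finrank_tangentSpace, Module.finrank_self]
    change Module.finrank ℝ (EuclideanSpace ℝ (Fin n) × F) = _
    rw [Module.finrank_prod, hF, finrank_euclideanSpace_fin]
  exact ⟨hinj, (LinearMap.injective_iff_surjective_of_finrank_eq_finrank hd).1 hinj⟩

end LineBundle

/-! ### Smoothness of fibrewise linear functions -/

section LinearFunctions

set_option linter.unusedSectionVars false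

variable {n : ℕ} {M : Type*} [TopologicalSpace M] [ChartedSpace (EuclideanSpace ℝ (Fin n)) M]
  {F : Type*} [NormedAddCommGroup F] [NormedSpace ℝ F]
  {V : M → Type*} [TopologicalSpace (TotalSpace F V)]
  [∀ x, AddCommGroup (V x)] [∀ x, Module ℝ (V x)] [∀ x, TopologicalSpace (V x)]
  [∀ x, IsTopologicalAddGroup (V x)] [∀ x, ContinuousSMul ℝ (V x)]
  [FiberBundle F V] [VectorBundle ℝ F V] [IsManifold (𝓡 n) ∞ M] [ContMDiffVectorBundle ∞ F V (𝓡 n)]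

lemma contMDiff_dualSection_apply (ξ : SmoothSection n (F →L[ℝ] ℝ) (fun x => V x →L[ℝ] ℝ)) :
    ContMDiff ((𝓡 n).prod 𝓘(ℝ, F)) 𝓘(ℝ, ℝ) ∞ (fun e : TotalSpace F V => ξ e.proj e.2) := fun e =>
  contMDiffAt_pairing (b := TotalSpace.proj) (v := fun e : TotalSpace F V => e.2)
    (ξ.contMDiff.contMDiffAt.comp e (contMDiff_proj (n := ∞) V).contMDiffAt) contMDiffAt_id

lemma contMDiff_apply_section (σ : SmoothSection n F V) :
    ContMDiff ((𝓡 n).prod 𝓘(ℝ, F →L[ℝ] ℝ)) 𝓘(ℝ, ℝ) ∞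
      (fun e : TotalSpace (F →L[ℝ] ℝ) (fun x => V x →L[ℝ] ℝ) => e.2 (σ e.proj)) := fun e =>
  contMDiffAt_pairing (b := TotalSpace.proj)
    (φ := fun e : TotalSpace (F →L[ℝ] ℝ) (fun x => V x →L[ℝ] ℝ) => e.2) contMDiffAt_id
    (σ.contMDiff.contMDiffAt.comp e
      (contMDiff_proj (n := ∞) (fun x => V x →L[ℝ] ℝ)).contMDiffAt)

end LinearFunctions

/-! ### The canonical connection along the hypersurface -/

section Ehresmann

set_option linter.unusedSectionVars false

variable {n : ℕ} {M : Type*} [TopologicalSpace M] [T2Space M]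
  [ChartedSpace (EuclideanSpace ℝ (Fin n)) M] [IsManifold (𝓡 n) ∞ M] {Z : Set M}
  {A : M → Type*} [∀ x, AddCommGroup (A x)] [∀ x, Module ℝ (A x)]
  [∀ x, TopologicalSpace (A x)] [TopologicalSpace (TotalSpace (EuclideanSpace ℝ (Fin n)) A)]
  [FiberBundle (EuclideanSpace ℝ (Fin n)) A] [VectorBundle ℝ (EuclideanSpace ℝ (Fin n)) A]
  [ContMDiffVectorBundle ∞ (EuclideanSpace ℝ (Fin n)) A (𝓡 n)]
  {𝒜 : LieAlgebroid n n A}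

/-- Off Z the coefficient of det(ρ) with respect to itself is the constant 1. Parallelism of det(ρ)
is what puts horizontal vectors in ker dφ. -/
lemma canonicalConnection_detSection (hZ : IsHypersurface n Z) (h𝒜 : IsBTangentBundle Z 𝒜)
    (v : SmoothSection n (EuclideanSpace ℝ (Fin n)) A) :
    (canonicalConnection hZ h𝒜).conn v (detSection 𝒜) = 0 :=
  ext_of_eq_compl hZ.dense_compl fun y hy => by
    rw [canonicalConnection_apply hZ h𝒜 _ _ hy]
    have h1 : (fun y => detRatio 𝒜 y (detSection 𝒜 y)) =ᶠ[𝓝 y] fun _ => 1 := by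
      filter_upwards [hZ.1.isOpen_compl.mem_nhds hy] with z hz
      exact detRatio_eq_of_eq_smul ((detAnchor_eq_zero_iff hZ h𝒜 z).not.2 hz) (one_smul _ _).symm
    unfold parallelConn LieAlgebroid.lieDerivFun
    rw [mvfderiv_congr_of_eventuallyEq h1, mvfderiv_const]
    exact zero_smul _ _

/-- The canonical connection in terms of a coefficient `g` of `det(ρ)`. -/
lemma smul_canonicalConnection_add (hZ : IsHypersurface n Z) (h𝒜 : IsBTangentBundle Z 𝒜)
    (v : SmoothSection n (EuclideanSpace ℝ (Fin n)) A) {q : SmoothSection n ℝ (CanonicalBundle n n A)}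
    {g : M → ℝ} (hg : ContMDiff (𝓡 n) 𝓘(ℝ, ℝ) ∞ g) {p : M}
    (h : ∀ᶠ y in 𝓝 p, detSection 𝒜 y = funSmul g hg q y) :
    g p • (canonicalConnection hZ h𝒜).conn v q p + 𝒜.lieDerivFun g p (v p) • q p = 0 := by
  rw [← AConnection.conn_funSmul (hg := hg), ← AConnection.conn_congr _ v h, canonicalConnection_detSection]
  rfl

/-- The coefficients of `det(ρ)` are local defining functions. -/
lemma exists_isOpen_coefficient (hZ : IsHypersurface n Z) (h𝒜 : IsBTangentBundle Z 𝒜)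
    {q : SmoothSection n ℝ (CanonicalBundle n n A)} {g : M → ℝ}
    (hg : ContMDiff (𝓡 n) 𝓘(ℝ, ℝ) ∞ g) {p : M} (hp : p ∈ Z) (hq : q p ≠ 0)
    (h : ∀ᶠ y in 𝓝 p, detSection 𝒜 y = funSmul g hg q y) :
    ∃ U : Set M, IsOpen U ∧ p ∈ U ∧ ∀ x ∈ U, (x ∈ Z ↔ g x = 0) ∧ mvfderiv (𝓡 n) g x ≠ 0 := by
  obtain ⟨ξ, hξ⟩ := exists_dualSection_apply_ne_zero (n := n) (F := ℝ) hq
  have hd := mvfderiv_detAnchor_ne_zero hZ h𝒜 hp ξ fun h => hξ (by rw [h]; rfl)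
  have hgp : g p = 0 := by
    have h1 := h.self_of_nhds
    have h2 : detSection 𝒜 p = 0 := (detAnchor_eq_zero_iff hZ h𝒜 p).2 hp
    rw [h2, funSmul_apply] at h1
    exact (smul_eq_zero.1 h1.symm).resolve_right hq
  -- Since g(p) = 0, the differential of ξ(det(ρ)) = g ξ(q) at `p` is ξ(q) dg, so dg = 0 would
  -- contradict transversality.
  obtain ⟨w, hw⟩ : ∃ w, mvfderiv (𝓡 n) g p w ≠ 0 := by
    by_contra! h0
    apply hd
    have h1 : (fun y => ξ y (detSection 𝒜 y)) =ᶠ[𝓝 p] fun y => g y * ξ y (q y) := by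
      filter_upwards [h] with y hy
      rw [hy, funSmul_apply, map_smul, smul_eq_mul]
    refine ContinuousLinearMap.ext fun w => ?_
    rw [mvfderiv_congr_of_eventuallyEq h1,
      mvfderiv_mul_apply (hg.contMDiffAt.mdifferentiableAt (by simp))
        ((contMDiff_pairing ξ q).contMDiffAt.mdifferentiableAt (by simp)), h0, hgp]
    simp
  obtain ⟨W, rfl, -⟩ := exists_smoothSection_apply_eq (n := n)
    (F := EuclideanSpace ℝ (Fin n)) isOpen_univ (mem_univ p) w
  obtain ⟨t, ht, hto, hpt⟩ := eventually_nhds_iff.1 (h.and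
    (((contMDiff_mvfderiv_apply hg W).continuous.continuousAt.eventually_ne hw).and
      ((contMDiff_pairing ξ q).continuous.continuousAt.eventually_ne hξ)))
  refine ⟨t, hto, hpt, fun x hx => ?_⟩
  obtain ⟨h1, h2, h3⟩ := ht x hx
  refine ⟨?_, fun h0 => h2 (by rw [h0]; rfl)⟩
  have hqx : q x ≠ 0 := fun h0 => h3 (by rw [h0, map_zero])
  rw [← detAnchor_eq_zero_iff hZ h𝒜 x]
  change detSection 𝒜 x = 0 ↔ _
  rw [h1, funSmul_apply, smul_eq_zero, or_iff_left hqx]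

/-- At a point of the hypersurface, the canonical connection is nontrivial on the kernel of the
anchor. -/
lemma exists_anchor_eq_zero_conn_ne_zero (hZ : IsHypersurface n Z) (h𝒜 : IsBTangentBundle Z 𝒜)
    {p : M} (hp : p ∈ Z) {q : SmoothSection n ℝ (CanonicalBundle n n A)} (hq : q p ≠ 0) :
    ∃ ε : SmoothSection n (EuclideanSpace ℝ (Fin n)) A, 𝒜.anchor p (ε p) = 0 ∧
      ∃ c : ℝ, c ≠ 0 ∧ (canonicalConnection hZ h𝒜).conn ε q p = c • q p := by
  obtain ⟨g, hg, hs⟩ := exists_eventually_eq_funSmul hq (detSection 𝒜)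
  obtain ⟨U, hU, hpU, hgU⟩ := exists_isOpen_coefficient hZ h𝒜 hg hp hq hs
  obtain ⟨w, hw⟩ : ∃ w, mvfderiv (𝓡 n) g p w ≠ 0 := by
    by_contra! h
    exact (hgU p hpU).2 (ContinuousLinearMap.ext h)
  obtain ⟨W, rfl, -⟩ := exists_smoothSection_apply_eq (n := n)
    (F := EuclideanSpace ℝ (Fin n)) isOpen_univ (mem_univ p) w
  -- Taking Y = W makes the lifted field g dg(W) W, the Euler-like field that vanishes on Z to first
  -- order.
  obtain ⟨ε, hε⟩ := h𝒜.exists_lift hg hU hpU hgU W W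
  have hε' : ∀ᶠ y in 𝓝 p, 𝒜.anchor y (ε y) = (g y * mvfderiv (𝓡 n) g y (W y)) • W y := by
    filter_upwards [hε] with y hy
    rw [hy, ← add_smul]
    congr 1
    ring
  have hW := contMDiff_mvfderiv_apply hg W
  have hW2 : ContMDiff (𝓡 n) 𝓘(ℝ, ℝ) ∞ (fun x => -(mvfderiv (𝓡 n) g x (W x)) ^ 2) :=
    (hW.pow 2).neg
  refine ⟨ε, ?_, -(mvfderiv (𝓡 n) g p (W p)) ^ 2, neg_ne_zero.2 (pow_ne_zero _ hw), ?_⟩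
  · rw [hε'.self_of_nhds, (hgU p hpU).1.1 hp, zero_mul, zero_smul]
  · refine eq_of_eventually_eq_compl (τ' := funSmul _ hW2 q) hZ.dense_compl ?_
    -- Off Z, dividing g ∇_ε q + g dg(W)² q = 0 by g gives the formula, which density carries to
    -- `p`.
    filter_upwards [hε', hs.eventually_nhds, hU.mem_nhds hpU] with y hy hsy hyU hyZ
    have h1 := smul_canonicalConnection_add hZ h𝒜 ε hg hsy
    have hgy : g y ≠ 0 := (hgU y hyU).1.not.1 hyZ
    rw [LieAlgebroid.lieDerivFun, hy, map_smul] at h1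
    apply smul_right_injective _ hgy
    simp only [funSmul_apply, smul_smul]
    rw [eq_neg_of_add_eq_zero_left h1, ← neg_smul]
    congr 1
    rw [smul_eq_mul]
    ring

/-- An element of `A` is determined by its anchor and the canonical connection. -/
lemma eq_zero_of_anchor_eq_zero (hZ : IsHypersurface n Z) (h𝒜 : IsBTangentBundle Z 𝒜) {p : M}
    {q : SmoothSection n ℝ (CanonicalBundle n n A)} (hq : q p ≠ 0)
    {v : SmoothSection n (EuclideanSpace ℝ (Fin n)) A} (hv : 𝒜.anchor p (v p) = 0)
    (hvq : (canonicalConnection hZ h𝒜).conn v q p = 0) : v p = 0 := by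
  by_cases hp : p ∈ Z
  swap
  · exact (h𝒜.bijective_anchor hZ.1 hp).1 (hv.trans (map_zero _).symm)
  obtain ⟨ε, hε, c, hc, hεq⟩ := exists_anchor_eq_zero_conn_ne_zero hZ h𝒜 hp hq
  have hε0 : ε p ≠ 0 := by
    intro h
    have h1 := (canonicalConnection hZ h𝒜).conn_congr_left (v' := 0) q
      (show ε p = (0 : SmoothSection n (EuclideanSpace ℝ (Fin n)) A) p from h)
    rw [hεq, map_zero] at h1
    exact smul_ne_zero hc hq h1
  -- The kernel of the anchor is a line, so v = kε at `p`. Then 0 = ∇_v q = kc q with c ≠ 0.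
  obtain ⟨k, hk⟩ := exists_eq_smul_of_anchor_eq_zero hZ h𝒜 hp hv hε hε0
  have h1 := (canonicalConnection hZ h𝒜).conn_congr_left (v' := k • ε) q hk
  rw [hvq, map_smul] at h1
  change 0 = k • (canonicalConnection hZ h𝒜).conn ε q p at h1
  rw [hεq, smul_smul] at h1
  have h2 := (smul_eq_zero.1 h1.symm).resolve_right hq
  rw [hk, (mul_eq_zero.1 h2).resolve_right hc, zero_smul]

/-- The hypothesis is the equation of ker dφ, with `w` the base component and `m` the logarithmic
derivative of the linear function of `q`. Off Z it determines `m` from `w`; on Z it says that `w` is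
tangent to Z and leaves `m` free. -/
lemma exists_anchor_eq_conn_eq (hZ : IsHypersurface n Z) (h𝒜 : IsBTangentBundle Z 𝒜) {p : M}
    {q : SmoothSection n ℝ (CanonicalBundle n n A)} (hq : q p ≠ 0) {g : M → ℝ}
    (hg : ContMDiff (𝓡 n) 𝓘(ℝ, ℝ) ∞ g) (hs : ∀ᶠ y in 𝓝 p, detSection 𝒜 y = funSmul g hg q y)
    {w : TangentSpace (𝓡 n) p} {m : ℝ} (h : g p * m + mvfderiv (𝓡 n) g p w = 0) :
    ∃ v : SmoothSection n (EuclideanSpace ℝ (Fin n)) A, 𝒜.anchor p (v p) = w ∧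
      (canonicalConnection hZ h𝒜).conn v q p = m • q p := by
  by_cases hp : p ∈ Z
  · obtain ⟨U, hU, hpU, hgU⟩ := exists_isOpen_coefficient hZ h𝒜 hg hp hq hs
    rw [(hgU p hpU).1.1 hp, zero_mul, zero_add] at h
    obtain ⟨a, rfl⟩ := h𝒜.exists_anchor_eq hg hU hpU hgU h
    obtain ⟨v, rfl, -⟩ := exists_smoothSection_apply_eq (n := n)
      (F := EuclideanSpace ℝ (Fin n)) isOpen_univ (mem_univ p) a
    obtain ⟨ε, hε, c, hc, hεq⟩ := exists_anchor_eq_zero_conn_ne_zero hZ h𝒜 hp hq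
    obtain ⟨k, hk⟩ := DetLine.exists_eq_smul hq ((canonicalConnection hZ h𝒜).conn v q p)
    -- Adding a multiple of ε leaves the anchor at `p` unchanged and shifts the coefficient of ∇q
    -- from k to m.
    refine ⟨v + ((m - k) / c) • ε, ?_, ?_⟩
    · rw [ContMDiffSection.coe_add, ContMDiffSection.coe_smul, Pi.add_apply, Pi.smul_apply,
        map_add, map_smul, hε, smul_zero, add_zero]
    · rw [map_add, map_smul]
      change (canonicalConnection hZ h𝒜).conn v q p +
        ((m - k) / c) • (canonicalConnection hZ h𝒜).conn ε q p = _
      rw [hk, hεq, smul_smul, ← add_smul, div_mul_cancel₀ _ hc, add_sub_cancel]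
  · obtain ⟨a, rfl⟩ := (h𝒜.bijective_anchor hZ.1 hp).2 w
    obtain ⟨v, rfl, -⟩ := exists_smoothSection_apply_eq (n := n)
      (F := EuclideanSpace ℝ (Fin n)) isOpen_univ (mem_univ p) a
    refine ⟨v, rfl, ?_⟩
    have hgp : g p ≠ 0 := by
      intro h0
      apply (detAnchor_eq_zero_iff hZ h𝒜 p).not.2 hp
      change detSection 𝒜 p = 0
      rw [hs.self_of_nhds, funSmul_apply, h0, zero_smul]
    have h1 := smul_canonicalConnection_add hZ h𝒜 v hg hs
    apply smul_right_injective _ hgp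
    change g p • _ = g p • _
    rw [eq_neg_of_add_eq_zero_left h1, smul_smul, ← neg_smul]
    congr 1
    rw [eq_comm]
    exact eq_neg_of_add_eq_zero_left h

end Ehresmann

/-! ### The Ehresmann connection on Q* and the intrinsic regularisation -/

section Foliation

set_option linter.unusedSectionVars false

variable {n : ℕ} {M : Type*} [TopologicalSpace M] [T2Space M]
  [ChartedSpace (EuclideanSpace ℝ (Fin n)) M] [IsManifold (𝓡 n) ∞ M] {Z : Set M}
  {A : M → Type*} [∀ x, AddCommGroup (A x)] [∀ x, Module ℝ (A x)]
  [∀ x, TopologicalSpace (A x)] [TopologicalSpace (TotalSpace (EuclideanSpace ℝ (Fin n)) A)]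
  [FiberBundle (EuclideanSpace ℝ (Fin n)) A] [VectorBundle ℝ (EuclideanSpace ℝ (Fin n)) A]
  [ContMDiffVectorBundle ∞ (EuclideanSpace ℝ (Fin n)) A (𝓡 n)]
  {𝒜 : LieAlgebroid n n A} (D : AConnection 𝒜 ℝ (CanonicalBundle n n A))

lemma finrank_dual_real : Module.finrank ℝ (ℝ →L[ℝ] ℝ) = 1 := by
  rw [← (LinearMap.toContinuousLinearMap : (ℝ →ₗ[ℝ] ℝ) ≃ₗ[ℝ] (ℝ →L[ℝ] ℝ)).finrank_eq,
    Module.finrank_linearMap, Module.finrank_self, mul_one]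

/-- The derivative of the linear function on `Q^*` defined by the section `g q`. -/
lemma mvfderiv_apply_section_of_eventuallyEq
    {e : TotalSpace (ℝ →L[ℝ] ℝ) (fun x => CanonicalBundle n n A x →L[ℝ] ℝ)}
    {σ q : SmoothSection n ℝ (CanonicalBundle n n A)} {g : M → ℝ}
    (hg : ContMDiff (𝓡 n) 𝓘(ℝ, ℝ) ∞ g) (h : ∀ᶠ y in 𝓝 e.proj, σ y = funSmul g hg q y)
    (w : TangentSpace ((𝓡 n).prod 𝓘(ℝ, ℝ →L[ℝ] ℝ)) e) :
    mvfderiv ((𝓡 n).prod 𝓘(ℝ, ℝ →L[ℝ] ℝ)) (fun e' : TotalSpace (ℝ →L[ℝ] ℝ)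
      (fun x => CanonicalBundle n n A x →L[ℝ] ℝ) => e'.2 (σ e'.proj)) e w =
    g e.proj * mvfderiv ((𝓡 n).prod 𝓘(ℝ, ℝ →L[ℝ] ℝ)) (fun e' : TotalSpace (ℝ →L[ℝ] ℝ)
      (fun x => CanonicalBundle n n A x →L[ℝ] ℝ) => e'.2 (q e'.proj)) e w +
    e.2 (q e.proj) * mvfderiv (𝓡 n) g e.proj (mfderiv ((𝓡 n).prod 𝓘(ℝ, ℝ →L[ℝ] ℝ)) (𝓡 n)
      (TotalSpace.proj : TotalSpace (ℝ →L[ℝ] ℝ)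
        (fun x => CanonicalBundle n n A x →L[ℝ] ℝ) → M) e w) := by
  have hc : Filter.Tendsto (TotalSpace.proj : TotalSpace (ℝ →L[ℝ] ℝ)
      (fun x => CanonicalBundle n n A x →L[ℝ] ℝ) → M) (𝓝 e) (𝓝 e.proj) :=
    (FiberBundle.continuous_proj (ℝ →L[ℝ] ℝ)
      (fun x => CanonicalBundle n n A x →L[ℝ] ℝ)).continuousAt
  have h1 : (fun e' : TotalSpace (ℝ →L[ℝ] ℝ) (fun x => CanonicalBundle n n A x →L[ℝ] ℝ) =>
      e'.2 (σ e'.proj)) =ᶠ[𝓝 e] fun e' => (g ∘ TotalSpace.proj) e' * e'.2 (q e'.proj) := by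
    filter_upwards [hc.eventually h] with e' he'
    rw [he', funSmul_apply, map_smul]
    rfl
  have hgd : MDifferentiableAt (𝓡 n) 𝓘(ℝ, ℝ) g e.proj :=
    hg.contMDiffAt.mdifferentiableAt (by simp)
  rw [mvfderiv_congr_of_eventuallyEq h1,
    mvfderiv_mul_apply (hgd.comp e (Bundle.mdifferentiableAt_proj _))
      ((contMDiff_apply_section q).contMDiffAt.mdifferentiableAt (by simp)),
    mvfderiv_comp_apply e hgd (Bundle.mdifferentiableAt_proj _)]
  rfl

/-- Both sides of the defining equation obey the same Leibniz rule in the section, so testing on one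
local generator is enough. Tensoriality in `A` removes the choice of extension. -/
lemma AConnection.mem_dualEhresmann_iff
    {e : TotalSpace (ℝ →L[ℝ] ℝ) (fun x => CanonicalBundle n n A x →L[ℝ] ℝ)}
    {q : SmoothSection n ℝ (CanonicalBundle n n A)} (hq : q e.proj ≠ 0)
    (v : SmoothSection n (EuclideanSpace ℝ (Fin n)) A)
    (w : TangentSpace ((𝓡 n).prod 𝓘(ℝ, ℝ →L[ℝ] ℝ)) e) :
    (v e.proj, w) ∈ D.dualEhresmann e ↔
      𝒜.anchor e.proj (v e.proj) = mfderiv ((𝓡 n).prod 𝓘(ℝ, ℝ →L[ℝ] ℝ)) (𝓡 n)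
        (TotalSpace.proj : TotalSpace (ℝ →L[ℝ] ℝ)
          (fun x => CanonicalBundle n n A x →L[ℝ] ℝ) → M) e w ∧
      mvfderiv ((𝓡 n).prod 𝓘(ℝ, ℝ →L[ℝ] ℝ)) (fun e' : TotalSpace (ℝ →L[ℝ] ℝ)
        (fun x => CanonicalBundle n n A x →L[ℝ] ℝ) => e'.2 (q e'.proj)) e w =
          e.2 (D.conn v q e.proj) := by
  constructor
  · rintro ⟨h1, a, ha, h2⟩
    refine ⟨h1, ?_⟩
    rw [← D.conn_congr_left q (show a e.proj = v e.proj from ha)]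
    exact h2 q
  · rintro ⟨h1, h2⟩
    refine ⟨h1, v, rfl, fun σ => ?_⟩
    obtain ⟨g, hg, hσ⟩ := exists_eventually_eq_funSmul hq σ
    rw [mvfderiv_apply_section_of_eventuallyEq hg hσ, D.conn_congr v hσ, D.conn_funSmul,
      map_add, map_smul, map_smul, LieAlgebroid.lieDerivFun, h1]
    simp only [h2, smul_eq_mul]
    ring

/-- Valid for every connection on Q: a vector of `A` prescribes the base component and the
derivative of the linear function of a generator, and these determine one tangent vector. -/
lemma AConnection.bijOn_fst_dualEhresmann
    (e : TotalSpace (ℝ →L[ℝ] ℝ) (fun x => CanonicalBundle n n A x →L[ℝ] ℝ)) :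
    Set.BijOn Prod.fst (D.dualEhresmann e :
      Set (A e.proj × TangentSpace ((𝓡 n).prod 𝓘(ℝ, ℝ →L[ℝ] ℝ)) e)) Set.univ := by
  obtain ⟨α, hα, Y, hq⟩ := exists_mkSection_ne_zero (n := n) A e.proj
  have hb := bijective_mfderiv_proj_prod (e := e) finrank_dual_real
    (contMDiff_apply_section (mkSection hα Y)) (fun _ _ _ => rfl) (by
      obtain ⟨ξ, hξ⟩ := exists_dualSection_apply_ne_zero (n := n) (F := ℝ) hq
      exact ⟨ξ e.proj, hξ⟩)
  refine ⟨fun _ _ => mem_univ _, ?_, ?_⟩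
  · rintro ⟨a, w⟩ h ⟨a', w'⟩ h' (rfl : a = a')
    obtain ⟨v, rfl, -⟩ := exists_smoothSection_apply_eq (n := n)
      (F := EuclideanSpace ℝ (Fin n)) isOpen_univ (mem_univ _) a
    obtain ⟨h1, h2⟩ := (D.mem_dualEhresmann_iff hq v w).1 h
    obtain ⟨h1', h2'⟩ := (D.mem_dualEhresmann_iff hq v w').1 h'
    exact Prod.ext rfl (hb.1 (Prod.ext (h1.symm.trans h1') (h2.trans h2'.symm)))
  · intro a _
    obtain ⟨v, rfl, -⟩ := exists_smoothSection_apply_eq (n := n)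
      (F := EuclideanSpace ℝ (Fin n)) isOpen_univ (mem_univ _) a
    obtain ⟨w, hw⟩ := hb.2 (𝒜.anchor e.proj (v e.proj), e.2 (D.conn v (mkSection hα Y) e.proj))
    exact ⟨(v e.proj, w), (D.mem_dualEhresmann_iff hq v w).2
      ⟨(Prod.ext_iff.1 hw).1.symm, (Prod.ext_iff.1 hw).2⟩, rfl⟩

lemma bijOn_snd_dualEhresmann (hZ : IsHypersurface n Z) (h𝒜 : IsBTangentBundle Z 𝒜)
    {e : TotalSpace (ℝ →L[ℝ] ℝ) (fun x => CanonicalBundle n n A x →L[ℝ] ℝ)} (he : e.2 ≠ 0) :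
    Set.BijOn Prod.snd ((canonicalConnection hZ h𝒜).dualEhresmann e :
        Set (A e.proj × TangentSpace ((𝓡 n).prod 𝓘(ℝ, ℝ →L[ℝ] ℝ)) e))
      (intrinsicRegularisation n (detAnchor 𝒜) e :
        Set (TangentSpace ((𝓡 n).prod 𝓘(ℝ, ℝ →L[ℝ] ℝ)) e)) := by
  obtain ⟨α, hα, Y, hq⟩ := exists_mkSection_ne_zero (n := n) A e.proj
  have heq : e.2 (mkSection hα Y e.proj) ≠ 0 := by
    intro h
    refine he (ContinuousLinearMap.ext fun r => ?_)
    obtain ⟨c, rfl⟩ := DetLine.exists_eq_smul hq r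
    rw [map_smul, h, smul_zero]
    rfl
  refine ⟨?_, ?_, ?_⟩
  · rintro ⟨a, w⟩ ⟨-, v, -, h⟩
    -- The linear function of det(ρ) is φ itself, and ∇ det(ρ) = 0.
    have := h (detSection 𝒜)
    rw [canonicalConnection_detSection] at this
    exact this.trans (map_zero _)
  · rintro ⟨a, w⟩ h ⟨a', w'⟩ h' (rfl : w = w')
    have h0 := sub_mem h h'
    obtain ⟨v, hv, -⟩ := exists_smoothSection_apply_eq (n := n)
      (F := EuclideanSpace ℝ (Fin n)) isOpen_univ (mem_univ _) (a - a')
    have h1 : (v e.proj, (0 : TangentSpace ((𝓡 n).prod 𝓘(ℝ, ℝ →L[ℝ] ℝ)) e)) ∈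
        (canonicalConnection hZ h𝒜).dualEhresmann e := by
      rw [hv]
      simpa using h0
    -- The difference of two lifts of `w` has zero anchor and, since e ≠ 0, annihilates `q` under ∇;
    -- it therefore vanishes.
    obtain ⟨h2, h3⟩ := ((canonicalConnection hZ h𝒜).mem_dualEhresmann_iff hq v 0).1 h1
    rw [ContinuousLinearMap.map_zero] at h2 h3
    obtain ⟨c, hc⟩ := DetLine.exists_eq_smul hq
      ((canonicalConnection hZ h𝒜).conn v (mkSection hα Y) e.proj)
    rw [hc, map_smul] at h3
    rw [(smul_eq_zero.1 h3.symm).resolve_right heq, zero_smul] at hc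
    have h4 := eq_zero_of_anchor_eq_zero hZ h𝒜 hq h2 hc
    rw [hv] at h4
    exact Prod.ext (sub_eq_zero.1 h4) rfl
  · intro w hw
    obtain ⟨g, hg, hs⟩ := exists_eventually_eq_funSmul hq (detSection 𝒜)
    have hw' := (mvfderiv_apply_section_of_eventuallyEq hg hs w).symm.trans hw
    -- With ℓ the linear function of the generator, dφ(w) = 0 reads g dℓ(w) + ℓ(e) dg(dπ(w)) = 0.
    -- Dividing by ℓ(e) ≠ 0 gives the required equation with m = dℓ(w)/ℓ(e).
    obtain ⟨v, hv, hvq⟩ := exists_anchor_eq_conn_eq hZ h𝒜 hq hg hs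
      (w := mfderiv ((𝓡 n).prod 𝓘(ℝ, ℝ →L[ℝ] ℝ)) (𝓡 n) (TotalSpace.proj : TotalSpace (ℝ →L[ℝ] ℝ)
          (fun x => CanonicalBundle n n A x →L[ℝ] ℝ) → M) e w)
      (m := mvfderiv ((𝓡 n).prod 𝓘(ℝ, ℝ →L[ℝ] ℝ)) (fun e' : TotalSpace (ℝ →L[ℝ] ℝ)
        (fun x => CanonicalBundle n n A x →L[ℝ] ℝ) => e'.2 (mkSection hα Y e'.proj)) e w /
          e.2 (mkSection hα Y e.proj)) (by
        rw [← mul_div_assoc, div_add' _ _ _ heq, div_eq_zero_iff]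
        left
        rw [mul_comm (mvfderiv (𝓡 n) g e.proj _)]
        exact hw')
    refine ⟨(v e.proj, w), ((canonicalConnection hZ h𝒜).mem_dualEhresmann_iff hq v w).2
      ⟨hv, ?_⟩, rfl⟩
    rw [hvq, map_smul, smul_eq_mul, div_mul_cancel₀ _ heq]

end Foliation

/-! ### Fibrewise inversion and the Ehresmann connection on Q -/

section Inverse

set_option linter.unusedSectionVars false

variable {n : ℕ} {M : Type*} [TopologicalSpace M] [T2Space M]
  [ChartedSpace (EuclideanSpace ℝ (Fin n)) M] [IsManifold (𝓡 n) ∞ M] {Z : Set M}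
  {A : M → Type*} [∀ x, AddCommGroup (A x)] [∀ x, Module ℝ (A x)]
  [∀ x, TopologicalSpace (A x)] [TopologicalSpace (TotalSpace (EuclideanSpace ℝ (Fin n)) A)]
  [FiberBundle (EuclideanSpace ℝ (Fin n)) A] [VectorBundle ℝ (EuclideanSpace ℝ (Fin n)) A]
  [ContMDiffVectorBundle ∞ (EuclideanSpace ℝ (Fin n)) A (𝓡 n)]
  {𝒜 : LieAlgebroid n n A} (D : AConnection 𝒜 ℝ (CanonicalBundle n n A))

/-- Locally, sections of the dual of a line bundle are multiples of a nonvanishing one. -/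
lemma exists_eventually_eq_smul_dualSection {p : M} {q : SmoothSection n ℝ (CanonicalBundle n n A)}
    {ξ : SmoothSection n (ℝ →L[ℝ] ℝ) (fun x => CanonicalBundle n n A x →L[ℝ] ℝ)}
    (hξ : ξ p (q p) ≠ 0)
    (η : SmoothSection n (ℝ →L[ℝ] ℝ) (fun x => CanonicalBundle n n A x →L[ℝ] ℝ)) :
    ∃ h : M → ℝ, ContMDiff (𝓡 n) 𝓘(ℝ, ℝ) ∞ h ∧
      ∀ᶠ y in 𝓝 p, ∀ r : CanonicalBundle n n A y, η y r = h y * ξ y r := by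
  have hξq := contMDiff_pairing ξ q
  have hU : IsOpen {y | ξ y (q y) ≠ 0} := isOpen_ne_fun hξq.continuous continuous_const
  obtain ⟨g, hg, hg', -⟩ := exists_contMDiff_eventuallyEq (n := n) hU hξ
    ((contMDiff_pairing η q).contMDiffOn.div₀ hξq.contMDiffOn fun x hx => hx)
  refine ⟨g, hg, ?_⟩
  filter_upwards [hg', hU.mem_nhds hξ] with y hy hyU r
  have hyU' : ξ y (q y) ≠ 0 := hyU
  have hq0 : q y ≠ 0 := fun h => hyU' (by rw [h, map_zero])
  obtain ⟨c, rfl⟩ := DetLine.exists_eq_smul hq0 r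
  rw [hy, map_smul, map_smul, Pi.div_apply, smul_eq_mul, smul_eq_mul, mul_left_comm,
    div_mul_cancel₀ _ hyU']

/-- The derivative of the linear function on `Q` defined by a multiple of the section `ξ`
of `Q^*`. -/
lemma mvfderiv_dualSection_apply_of_eventuallyEq {e : TotalSpace ℝ (CanonicalBundle n n A)}
    {η ξ : SmoothSection n (ℝ →L[ℝ] ℝ) (fun x => CanonicalBundle n n A x →L[ℝ] ℝ)} {h : M → ℝ}
    (hh : ContMDiff (𝓡 n) 𝓘(ℝ, ℝ) ∞ h)
    (hη : ∀ᶠ y in 𝓝 e.proj, ∀ r : CanonicalBundle n n A y, η y r = h y * ξ y r)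
    (w : TangentSpace ((𝓡 n).prod 𝓘(ℝ, ℝ)) e) :
    mvfderiv ((𝓡 n).prod 𝓘(ℝ, ℝ))
      (fun e' : TotalSpace ℝ (CanonicalBundle n n A) => η e'.proj e'.2) e w =
    h e.proj * mvfderiv ((𝓡 n).prod 𝓘(ℝ, ℝ))
      (fun e' : TotalSpace ℝ (CanonicalBundle n n A) => ξ e'.proj e'.2) e w +
    ξ e.proj e.2 * mvfderiv (𝓡 n) h e.proj (mfderiv ((𝓡 n).prod 𝓘(ℝ, ℝ)) (𝓡 n)
      (TotalSpace.proj : TotalSpace ℝ (CanonicalBundle n n A) → M) e w) := by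
  have hc : Filter.Tendsto (TotalSpace.proj : TotalSpace ℝ (CanonicalBundle n n A) → M)
      (𝓝 e) (𝓝 e.proj) :=
    (FiberBundle.continuous_proj ℝ (CanonicalBundle n n A)).continuousAt
  have h1 : (fun e' : TotalSpace ℝ (CanonicalBundle n n A) => η e'.proj e'.2) =ᶠ[𝓝 e]
      fun e' => (h ∘ TotalSpace.proj) e' * ξ e'.proj e'.2 := by
    filter_upwards [hc.eventually hη] with e' he' using he' e'.2
  have hd : MDifferentiableAt (𝓡 n) 𝓘(ℝ, ℝ) h e.proj :=
    hh.contMDiffAt.mdifferentiableAt (by simp)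
  rw [mvfderiv_congr_of_eventuallyEq h1,
    mvfderiv_mul_apply (hd.comp e (Bundle.mdifferentiableAt_proj _))
      ((contMDiff_dualSection_apply ξ).contMDiffAt.mdifferentiableAt (by simp)),
    mvfderiv_comp_apply e hd (Bundle.mdifferentiableAt_proj _)]
  rfl

/-- The dual connection at `p`, paired with `σ p`, depends on `σ` only through `σ p`. -/
lemma AConnection.lieDerivFun_sub_conn_of_eventuallyEq {p : M}
    {σ q : SmoothSection n ℝ (CanonicalBundle n n A)}
    (ξ : SmoothSection n (ℝ →L[ℝ] ℝ) (fun x => CanonicalBundle n n A x →L[ℝ] ℝ))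
    (v : SmoothSection n (EuclideanSpace ℝ (Fin n)) A) {g : M → ℝ}
    (hg : ContMDiff (𝓡 n) 𝓘(ℝ, ℝ) ∞ g) (h : ∀ᶠ y in 𝓝 p, σ y = funSmul g hg q y) :
    𝒜.lieDerivFun (fun x => ξ x (σ x)) p (v p) - ξ p (D.conn v σ p) =
      g p * (𝒜.lieDerivFun (fun x => ξ x (q x)) p (v p) - ξ p (D.conn v q p)) := by
  have h1 : (fun x => ξ x (σ x)) =ᶠ[𝓝 p] fun x => g x * ξ x (q x) := by
    filter_upwards [h] with y hy
    rw [hy, funSmul_apply, map_smul, smul_eq_mul]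
  rw [D.conn_congr v h, D.conn_funSmul, map_add, map_smul, map_smul]
  unfold LieAlgebroid.lieDerivFun
  rw [mvfderiv_congr_of_eventuallyEq h1,
    mvfderiv_mul_apply (hg.contMDiffAt.mdifferentiableAt (by simp))
      ((contMDiff_pairing ξ q).contMDiffAt.mdifferentiableAt (by simp))]
  simp only [smul_eq_mul]
  ring

/-- Near the base point every section of Q is a multiple of `q` and every section of Q* a multiple
of ξ. The product rule reduces all the conditions to the single pair ξ, `q`. -/
lemma AConnection.mem_ehresmann_iff {e : TotalSpace ℝ (CanonicalBundle n n A)}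
    {q : SmoothSection n ℝ (CanonicalBundle n n A)}
    {ξ : SmoothSection n (ℝ →L[ℝ] ℝ) (fun x => CanonicalBundle n n A x →L[ℝ] ℝ)}
    (hξ : ξ e.proj (q e.proj) ≠ 0) {c : ℝ} (hc : e.2 = c • q e.proj)
    (v : SmoothSection n (EuclideanSpace ℝ (Fin n)) A)
    (w : TangentSpace ((𝓡 n).prod 𝓘(ℝ, ℝ)) e) :
    (v e.proj, w) ∈ D.ehresmann e ↔
      𝒜.anchor e.proj (v e.proj) = mfderiv ((𝓡 n).prod 𝓘(ℝ, ℝ)) (𝓡 n)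
        (TotalSpace.proj : TotalSpace ℝ (CanonicalBundle n n A) → M) e w ∧
      mvfderiv ((𝓡 n).prod 𝓘(ℝ, ℝ))
        (fun e' : TotalSpace ℝ (CanonicalBundle n n A) => ξ e'.proj e'.2) e w =
          c * (𝒜.lieDerivFun (fun x => ξ x (q x)) e.proj (v e.proj) -
            ξ e.proj (D.conn v q e.proj)) := by
  have hq : q e.proj ≠ 0 := fun h => hξ (by rw [h, map_zero])
  -- Every section through e has the same coefficient `c` at the base point, so the horizontal
  -- condition does not depend on the extension.
  have hcoef : ∀ (σ : SmoothSection n ℝ (CanonicalBundle n n A)) (g : M → ℝ)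
      (hg : ContMDiff (𝓡 n) 𝓘(ℝ, ℝ) ∞ g), σ e.proj = e.2 →
      (∀ᶠ y in 𝓝 e.proj, σ y = funSmul g hg q y) → g e.proj = c := fun σ g hg hσ h =>
    smul_left_injective ℝ hq (h.self_of_nhds.symm.trans (hσ.trans hc))
  constructor
  · rintro ⟨h1, a, ha, h2⟩
    refine ⟨h1, ?_⟩
    have ha' : a e.proj = v e.proj := ha
    obtain ⟨σ, hσ, -⟩ := exists_smoothSection_apply_eq (n := n) (F := ℝ) isOpen_univ
      (mem_univ _) e.2
    obtain ⟨g, hg, hσq⟩ := exists_eventually_eq_funSmul hq σ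
    have h3 := h2 ξ σ hσ
    rw [D.lieDerivFun_sub_conn_of_eventuallyEq ξ a hg hσq, hcoef σ g hg hσ hσq, ha',
      D.conn_congr_left q ha'] at h3
    exact h3
  · rintro ⟨h1, h2⟩
    refine ⟨h1, v, rfl, fun η σ hσ => ?_⟩
    obtain ⟨g, hg, hσq⟩ := exists_eventually_eq_funSmul hq σ
    obtain ⟨h, hh, hη⟩ := exists_eventually_eq_smul_dualSection hξ η
    have h3 : (fun x => η x (q x)) =ᶠ[𝓝 e.proj] fun x => h x * ξ x (q x) := by
      filter_upwards [hη] with y hy using hy _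
    rw [D.lieDerivFun_sub_conn_of_eventuallyEq η v hg hσq, hcoef σ g hg hσ hσq,
      mvfderiv_dualSection_apply_of_eventuallyEq hh hη, hη.self_of_nhds, hc, map_smul]
    simp only [h2, ← h1]
    unfold LieAlgebroid.lieDerivFun
    rw [mvfderiv_congr_of_eventuallyEq h3,
      mvfderiv_mul_apply (hh.contMDiffAt.mdifferentiableAt (by simp))
        ((contMDiff_pairing ξ q).contMDiffAt.mdifferentiableAt (by simp)), smul_eq_mul]
    ring

lemma AConnection.bijOn_fst_ehresmann (e : TotalSpace ℝ (CanonicalBundle n n A)) :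
    Set.BijOn Prod.fst (D.ehresmann e :
      Set (A e.proj × TangentSpace ((𝓡 n).prod 𝓘(ℝ, ℝ)) e)) Set.univ := by
  obtain ⟨α, hα, Y, hq⟩ := exists_mkSection_ne_zero (n := n) A e.proj
  obtain ⟨ξ, hξ⟩ := exists_dualSection_apply_ne_zero (n := n) (F := ℝ) hq
  obtain ⟨c, hc⟩ := DetLine.exists_eq_smul hq e.2
  have hb := bijective_mfderiv_proj_prod (e := e) (Module.finrank_self ℝ)
    (contMDiff_dualSection_apply ξ) (fun y c v => (ξ y).map_smul c v) ⟨mkSection hα Y e.proj, hξ⟩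
  refine ⟨fun _ _ => mem_univ _, ?_, ?_⟩
  · rintro ⟨a, w⟩ h ⟨a', w'⟩ h' (rfl : a = a')
    obtain ⟨v, rfl, -⟩ := exists_smoothSection_apply_eq (n := n)
      (F := EuclideanSpace ℝ (Fin n)) isOpen_univ (mem_univ _) a
    obtain ⟨h1, h2⟩ := (D.mem_ehresmann_iff hξ hc v w).1 h
    obtain ⟨h1', h2'⟩ := (D.mem_ehresmann_iff hξ hc v w').1 h'
    exact Prod.ext rfl (hb.1 (Prod.ext (h1.symm.trans h1') (h2.trans h2'.symm)))
  · intro a _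
    obtain ⟨v, rfl, -⟩ := exists_smoothSection_apply_eq (n := n)
      (F := EuclideanSpace ℝ (Fin n)) isOpen_univ (mem_univ _) a
    obtain ⟨w, hw⟩ := hb.2 (𝒜.anchor e.proj (v e.proj),
      c * (𝒜.lieDerivFun (fun x => ξ x (mkSection hα Y x)) e.proj (v e.proj) -
        ξ e.proj (D.conn v (mkSection hα Y) e.proj)))
    exact ⟨(v e.proj, w), (D.mem_ehresmann_iff hξ hc v w).2
      ⟨(Prod.ext_iff.1 hw).1.symm, (Prod.ext_iff.1 hw).2⟩, rfl⟩

/-- The chosen functional is unique since the fibre is a line, so any ξ nonzero on e computes it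
after rescaling. -/
lemma fibrewiseInverse_eq {e : TotalSpace ℝ (CanonicalBundle n n A)}
    {ξ : CanonicalBundle n n A e.proj →L[ℝ] ℝ} (hξ : ξ e.2 ≠ 0) :
    fibrewiseInverse e = ⟨e.proj, (ξ e.2)⁻¹ • ξ⟩ := by
  have h : ∃ ξ : CanonicalBundle n n A e.proj →L[ℝ] ℝ, ξ e.2 = 1 :=
    ⟨(ξ e.2)⁻¹ • ξ, inv_mul_cancel₀ hξ⟩
  have h0 : e.2 ≠ 0 := fun h => hξ (by rw [h, map_zero])
  unfold fibrewiseInverse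
  rw [dif_pos h]
  congr 1
  ext r
  obtain ⟨c, rfl⟩ := DetLine.exists_eq_smul h0 r
  rw [map_smul, map_smul, h.choose_spec]
  exact congrArg (c • ·) (inv_mul_cancel₀ hξ).symm

/-- One section ξ of Q* with ξ(e) ≠ 0 serves on a neighbourhood, where the inversion is e' ↦
ξ/ξ(e'). -/
lemma mdifferentiableAt_fibrewiseInverse {e : TotalSpace ℝ (CanonicalBundle n n A)}
    (he : e.2 ≠ 0) :
    MDifferentiableAt ((𝓡 n).prod 𝓘(ℝ, ℝ)) ((𝓡 n).prod 𝓘(ℝ, ℝ →L[ℝ] ℝ))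
      (fibrewiseInverse (W := CanonicalBundle n n A)) e := by
  obtain ⟨ξ, hξ⟩ := exists_dualSection_apply_ne_zero (n := n) (F := ℝ) he
  have hl := contMDiff_dualSection_apply ξ
  let t := trivializationAt (ℝ →L[ℝ] ℝ) (fun x => CanonicalBundle n n A x →L[ℝ] ℝ) e.proj
  have ht : e.proj ∈ t.baseSet := mem_baseSet_trivializationAt _ _ _
  have hp : ContMDiffAt ((𝓡 n).prod 𝓘(ℝ, ℝ)) (𝓡 n) ∞
    (TotalSpace.proj : TotalSpace ℝ (CanonicalBundle n n A) → M) e :=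
    (contMDiff_proj (n := ∞) (CanonicalBundle n n A)).contMDiffAt
  have h1 : ContMDiffAt ((𝓡 n).prod 𝓘(ℝ, ℝ)) ((𝓡 n).prod 𝓘(ℝ, ℝ →L[ℝ] ℝ)) ∞
      (fun e' : TotalSpace ℝ (CanonicalBundle n n A) => TotalSpace.mk' (ℝ →L[ℝ] ℝ)
        (E := fun x => CanonicalBundle n n A x →L[ℝ] ℝ) e'.proj
        ((ξ e'.proj e'.2)⁻¹ • ξ e'.proj)) e := by
    rw [t.contMDiffAt_iff (t.mem_source.2 ht)]
    refine ⟨hp, ?_⟩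
    have h2 : ContMDiffAt ((𝓡 n).prod 𝓘(ℝ, ℝ)) 𝓘(ℝ, ℝ →L[ℝ] ℝ) ∞
        (fun e' : TotalSpace ℝ (CanonicalBundle n n A) => (t ⟨e'.proj, ξ e'.proj⟩).2) e :=
      ((t.contMDiffAt_section_iff ht).1 ξ.contMDiff.contMDiffAt).comp e hp
    refine ((hl.contMDiffAt.inv₀ hξ).smul h2).congr_of_eventuallyEq ?_
    filter_upwards [hp.continuousAt.eventually (t.open_baseSet.mem_nhds ht)] with e' he'
    exact (t.linear ℝ he').map_smul _ _
  refine (h1.congr_of_eventuallyEq ?_).mdifferentiableAt (by simp)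
  filter_upwards [hl.continuous.continuousAt.eventually_ne hξ] with e' he'
  exact fibrewiseInverse_eq he'

lemma fibrewiseInverse_apply_section {e : TotalSpace ℝ (CanonicalBundle n n A)}
    {ξ : CanonicalBundle n n A e.proj →L[ℝ] ℝ} (hξ : ξ e.2 ≠ 0)
    (q : SmoothSection n ℝ (CanonicalBundle n n A)) :
    (fibrewiseInverse e).2 (q (fibrewiseInverse e).proj) = (ξ e.2)⁻¹ * ξ (q e.proj) :=
  congrArg (fun f : TotalSpace (ℝ →L[ℝ] ℝ) (fun x => CanonicalBundle n n A x →L[ℝ] ℝ) =>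
    f.2 (q f.proj)) (fibrewiseInverse_eq hξ)

lemma mfderiv_proj_mfderiv_fibrewiseInverse {e : TotalSpace ℝ (CanonicalBundle n n A)}
    (he : e.2 ≠ 0) (w : TangentSpace ((𝓡 n).prod 𝓘(ℝ, ℝ)) e) :
    mfderiv ((𝓡 n).prod 𝓘(ℝ, ℝ →L[ℝ] ℝ)) (𝓡 n) (TotalSpace.proj : TotalSpace (ℝ →L[ℝ] ℝ)
        (fun x => CanonicalBundle n n A x →L[ℝ] ℝ) → M) (fibrewiseInverse e)
      (mfderiv ((𝓡 n).prod 𝓘(ℝ, ℝ)) ((𝓡 n).prod 𝓘(ℝ, ℝ →L[ℝ] ℝ))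
        (fibrewiseInverse (W := CanonicalBundle n n A)) e w) =
      mfderiv ((𝓡 n).prod 𝓘(ℝ, ℝ)) (𝓡 n)
        (TotalSpace.proj : TotalSpace ℝ (CanonicalBundle n n A) → M) e w :=
  (mfderiv_comp_apply e (Bundle.mdifferentiableAt_proj
    (fun x => CanonicalBundle n n A x →L[ℝ] ℝ) (F := ℝ →L[ℝ] ℝ) (IB := 𝓡 n))
    (mdifferentiableAt_fibrewiseInverse he) w).symm

/-- The derivatives of linear functions on `Q` and on `Q^*` are related by the fibrewise
inversion. -/
lemma mvfderiv_apply_section_fibrewiseInverse {e : TotalSpace ℝ (CanonicalBundle n n A)}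
    {q : SmoothSection n ℝ (CanonicalBundle n n A)} (hq : q e.proj = e.2)
    {ξ : SmoothSection n (ℝ →L[ℝ] ℝ) (fun x => CanonicalBundle n n A x →L[ℝ] ℝ)}
    (hξ : ξ e.proj e.2 ≠ 0) (w : TangentSpace ((𝓡 n).prod 𝓘(ℝ, ℝ)) e) :
    ξ e.proj e.2 * mvfderiv ((𝓡 n).prod 𝓘(ℝ, ℝ →L[ℝ] ℝ)) (fun e' : TotalSpace (ℝ →L[ℝ] ℝ)
        (fun x => CanonicalBundle n n A x →L[ℝ] ℝ) => e'.2 (q e'.proj)) (fibrewiseInverse e)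
      (mfderiv ((𝓡 n).prod 𝓘(ℝ, ℝ)) ((𝓡 n).prod 𝓘(ℝ, ℝ →L[ℝ] ℝ))
        (fibrewiseInverse (W := CanonicalBundle n n A)) e w) +
      mvfderiv ((𝓡 n).prod 𝓘(ℝ, ℝ))
        (fun e' : TotalSpace ℝ (CanonicalBundle n n A) => ξ e'.proj e'.2) e w =
      mvfderiv (𝓡 n) (fun x => ξ x (q x)) e.proj (mfderiv ((𝓡 n).prod 𝓘(ℝ, ℝ)) (𝓡 n)
        (TotalSpace.proj : TotalSpace ℝ (CanonicalBundle n n A) → M) e w) := by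
  have he : e.2 ≠ 0 := fun h => hξ (by rw [h, map_zero])
  have hi := mdifferentiableAt_fibrewiseInverse he
  let l : TotalSpace (ℝ →L[ℝ] ℝ) (fun x => CanonicalBundle n n A x →L[ℝ] ℝ) → ℝ :=
    fun f => f.2 (q f.proj)
  have hie : l (fibrewiseInverse e) = 1 :=
    (fibrewiseInverse_apply_section hξ q).trans (by rw [hq, inv_mul_cancel₀ hξ])
  have hξq : MDifferentiableAt (𝓡 n) 𝓘(ℝ, ℝ) (fun x => ξ x (q x)) e.proj :=
    (contMDiff_pairing ξ q).contMDiffAt.mdifferentiableAt (by simp)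
  have hld : MDifferentiableAt ((𝓡 n).prod 𝓘(ℝ, ℝ →L[ℝ] ℝ)) 𝓘(ℝ, ℝ) l (fibrewiseInverse e) :=
    (contMDiff_apply_section q).contMDiffAt.mdifferentiableAt (by simp)
  have hξd := contMDiff_dualSection_apply ξ
  -- Near e, ⟨ξ, e'⟩⟨e'⁻¹, q⟩ depends only on the base point, where it is ⟨ξ, q⟩. Its derivative at
  -- e simplifies because q passes through e, so ⟨e⁻¹, q⟩ = 1.
  have key : (fun e' : TotalSpace ℝ (CanonicalBundle n n A) =>
      ξ e'.proj e'.2 * (l ∘ fibrewiseInverse) e') =ᶠ[𝓝 e]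
      (fun x => ξ x (q x)) ∘ TotalSpace.proj := by
    filter_upwards [hξd.continuous.continuousAt.eventually_ne hξ] with e' he'
    exact (congrArg (ξ e'.proj e'.2 * ·) (fibrewiseInverse_apply_section he' q)).trans
      (mul_inv_cancel_left₀ he' _)
  have hkey := DFunLike.congr_fun (mvfderiv_congr_of_eventuallyEq
    (I := (𝓡 n).prod 𝓘(ℝ, ℝ)) key) w
  rwa [mvfderiv_mul_apply (hξd.contMDiffAt.mdifferentiableAt (by simp)) (hld.comp e hi),
    mvfderiv_comp_apply e hld hi, mvfderiv_comp_apply e hξq (Bundle.mdifferentiableAt_proj _),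
    Function.comp, hie, one_mul] at hkey

set_option maxHeartbeats 400000 in
/-- The fibrewise inversion relates the Ehresmann connections on `Q` and on `Q^*`. -/
lemma AConnection.mem_ehresmann_iff_fibrewiseInverse {e : TotalSpace ℝ (CanonicalBundle n n A)}
    (he : e.2 ≠ 0) (a : A e.proj) (w : TangentSpace ((𝓡 n).prod 𝓘(ℝ, ℝ)) e) :
    (a, w) ∈ D.ehresmann e ↔ (a, mfderiv ((𝓡 n).prod 𝓘(ℝ, ℝ)) ((𝓡 n).prod 𝓘(ℝ, ℝ →L[ℝ] ℝ))
      (fibrewiseInverse (W := CanonicalBundle n n A)) e w) ∈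
        D.dualEhresmann (fibrewiseInverse e) := by
  obtain ⟨v, rfl, -⟩ := exists_smoothSection_apply_eq (n := n)
    (F := EuclideanSpace ℝ (Fin n)) isOpen_univ (mem_univ _) a
  obtain ⟨q, hqe, -⟩ := exists_smoothSection_apply_eq (n := n) (F := ℝ) isOpen_univ
    (mem_univ _) e.2
  have hq : q e.proj ≠ 0 := by rwa [hqe]
  obtain ⟨ξ, hξ⟩ := exists_dualSection_apply_ne_zero (n := n) (F := ℝ) hq
  have hξe : ξ e.proj e.2 ≠ 0 := by rwa [← hqe]
  obtain ⟨m, hm⟩ := DetLine.exists_eq_smul hq (D.conn v q e.proj)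
  have hinv : (fibrewiseInverse e).2 (D.conn v q (fibrewiseInverse e).proj) = m := by
    refine (fibrewiseInverse_apply_section hξe (D.conn v q)).trans ?_
    rw [hm, map_smul, hqe, smul_eq_mul, mul_left_comm, inv_mul_cancel₀ hξe, mul_one]
  refine (D.mem_ehresmann_iff hξ (c := 1) (by rw [hqe, one_smul]) v w).trans
    (Iff.trans ?_ (D.mem_dualEhresmann_iff (e := fibrewiseInverse e) hq v _).symm)
  -- With ∇_v q = m q, horizontality on Q* says d = m, where d is the derivative of the linear
  -- function of q along the image of w. On Q it says that the derivative of ξ along w is ρ(v)(ξ(q))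
  -- - m ξ(e). Once the anchor equation holds, `hkey` makes the two conditions differ only by the
  -- nonzero factor ξ(e).
  have hkey := mvfderiv_apply_section_fibrewiseInverse hqe hξe w
  rw [hinv, hm, map_smul, smul_eq_mul, one_mul, mfderiv_proj_mfderiv_fibrewiseInverse he, hqe]
  generalize mvfderiv ((𝓡 n).prod 𝓘(ℝ, ℝ →L[ℝ] ℝ)) (fun e' : TotalSpace (ℝ →L[ℝ] ℝ)
    (fun x => CanonicalBundle n n A x →L[ℝ] ℝ) => e'.2 (q e'.proj)) (fibrewiseInverse e)
      (mfderiv ((𝓡 n).prod 𝓘(ℝ, ℝ)) ((𝓡 n).prod 𝓘(ℝ, ℝ →L[ℝ] ℝ))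
        (fibrewiseInverse (W := CanonicalBundle n n A)) e w) = d at hkey ⊢
  refine and_congr_right fun h1 => ?_
  have h2 : 𝒜.lieDerivFun (fun x => ξ x (q x)) e.proj (v e.proj) = _ :=
    (congrArg (mvfderiv (𝓡 n) (fun x => ξ x (q x)) e.proj) h1).trans hkey.symm
  rw [h2]
  constructor
  · intro h
    have h3 : ξ e.proj e.2 * (d - m) = 0 := by linear_combination -h
    exact sub_eq_zero.1 ((mul_eq_zero.1 h3).resolve_left hξe)
  · rintro rfl
    ring

lemma fibrewiseInverse_snd_ne_zero {e : TotalSpace ℝ (CanonicalBundle n n A)} (he : e.2 ≠ 0) :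
    (fibrewiseInverse e).2 ≠ 0 := by
  obtain ⟨ξ, hξ⟩ := exists_dualSection_apply_ne_zero (n := n) (F := ℝ) he
  rw [fibrewiseInverse_eq hξ]
  exact smul_ne_zero (inv_ne_zero hξ) fun h => hξ (by rw [h]; rfl)

/-- The target is a preimage under the derivative of the inversion, and horizontality of (a, w) on Q
is that of (a, image of w) on Q*. Bijectivity therefore transfers without inverting that derivative.
-/
lemma bijOn_snd_ehresmann (hZ : IsHypersurface n Z) (h𝒜 : IsBTangentBundle Z 𝒜)
    {e : TotalSpace ℝ (CanonicalBundle n n A)} (he : e.2 ≠ 0) :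
    Set.BijOn Prod.snd ((canonicalConnection hZ h𝒜).ehresmann e :
        Set (A e.proj × TangentSpace ((𝓡 n).prod 𝓘(ℝ, ℝ)) e))
      (inverseIntrinsicRegularisation n (detAnchor 𝒜) e :
        Set (TangentSpace ((𝓡 n).prod 𝓘(ℝ, ℝ)) e)) := by
  obtain ⟨hm, hi, hs⟩ := bijOn_snd_dualEhresmann hZ h𝒜 (fibrewiseInverse_snd_ne_zero he)
  have h := (canonicalConnection hZ h𝒜).mem_ehresmann_iff_fibrewiseInverse he
  refine ⟨fun z hz => hm ((h z.1 z.2).1 hz), ?_, fun w hw => ?_⟩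
  · rintro ⟨a, w⟩ hz ⟨a', w'⟩ hz' (rfl : w = w')
    exact Prod.ext (Prod.ext_iff.1 (hi ((h a w).1 hz) ((h a' w).1 hz') rfl)).1 rfl
  · obtain ⟨⟨a, u⟩, hz, rfl⟩ := hs hw
    exact ⟨(a, w), (h a w).2 hz, rfl⟩

end Inverse

end

theorem mainTheorem8 (n : ℕ) {M : Type*} [TopologicalSpace M] [T2Space M]
    [SecondCountableTopology M] [ChartedSpace (EuclideanSpace ℝ (Fin n)) M]
    [IsManifold (𝓡 n) ∞ M]
    (Z : Set M) (hZ : IsHypersurface n Z)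
    (A : M → Type*) [∀ x, AddCommGroup (A x)] [∀ x, Module ℝ (A x)]
    [∀ x, TopologicalSpace (A x)]
    [TopologicalSpace (TotalSpace (EuclideanSpace ℝ (Fin n)) A)]
    [FiberBundle (EuclideanSpace ℝ (Fin n)) A] [VectorBundle ℝ (EuclideanSpace ℝ (Fin n)) A]
    [ContMDiffVectorBundle ∞ (EuclideanSpace ℝ (Fin n)) A (𝓡 n)]
    (𝒜 : LieAlgebroid n n A) (h𝒜 : IsBTangentBundle Z 𝒜) :
    -- `(Q, det ρ)`, with `Q = det(A^*) ⊗ det(TM)`, is a b-divisor for `Z`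
    IsBDivisor n (W := CanonicalBundle n n A) Z (detAnchor 𝒜) ∧
    -- the canonical representation `∇` of `𝒜` on `Q` exists and is unique
    ∃ D : AConnection 𝒜 ℝ (CanonicalBundle n n A),
      IsCanonicalConnection D ∧
      (∀ D' : AConnection 𝒜 ℝ (CanonicalBundle n n A), IsCanonicalConnection D' → D' = D) ∧
      D.IsFlat ∧
      -- the Ehresmann connection of `∇^*`, on the total space of `Q^*`, is complementary to the
      -- vertical bundle of `π^! 𝒜`, and outside the zero section the anchor of `π^! 𝒜` maps it
      -- bijectively onto the intrinsic regularisation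
      (∀ e : TotalSpace (ℝ →L[ℝ] ℝ) (fun x => CanonicalBundle n n A x →L[ℝ] ℝ),
        Set.BijOn Prod.fst (D.dualEhresmann e :
            Set (A e.proj × TangentSpace ((𝓡 n).prod 𝓘(ℝ, ℝ →L[ℝ] ℝ)) e)) Set.univ ∧
        (e.2 ≠ 0 →
          Set.BijOn Prod.snd (D.dualEhresmann e :
            Set (A e.proj × TangentSpace ((𝓡 n).prod 𝓘(ℝ, ℝ →L[ℝ] ℝ)) e))
            (intrinsicRegularisation n (detAnchor 𝒜) e :
              Set (TangentSpace ((𝓡 n).prod 𝓘(ℝ, ℝ →L[ℝ] ℝ)) e)))) ∧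
      -- the same for the Ehresmann connection of `∇`, on the total space of `Q`, and the foliation
      -- corresponding to the intrinsic regularisation under the fibrewise inversion `Q \ M → Q^* \ M`
      (∀ e : TotalSpace ℝ (CanonicalBundle n n A),
        Set.BijOn Prod.fst (D.ehresmann e : Set (A e.proj × TangentSpace ((𝓡 n).prod 𝓘(ℝ, ℝ)) e)) Set.univ ∧
        (e.2 ≠ 0 →
          Set.BijOn Prod.snd (D.ehresmann e : Set (A e.proj × TangentSpace ((𝓡 n).prod 𝓘(ℝ, ℝ)) e))
            (inverseIntrinsicRegularisation n (detAnchor 𝒜) e :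
              Set (TangentSpace ((𝓡 n).prod 𝓘(ℝ, ℝ)) e)))) := by
  refine ⟨isBDivisor_detAnchor hZ h𝒜, canonicalConnection hZ h𝒜,
    isCanonicalConnection_canonicalConnection hZ h𝒜,
    fun D' h => (isCanonicalConnection_canonicalConnection hZ h𝒜).unique h,
    isFlat_canonicalConnection hZ h𝒜, fun e => ⟨?_, fun he => ?_⟩, fun e => ⟨?_, fun he => ?_⟩⟩
  · exact (canonicalConnection hZ h𝒜).bijOn_fst_dualEhresmann e
  · exact bijOn_snd_dualEhresmann hZ h𝒜 he
  · exact (canonicalConnection hZ h𝒜).bijOn_fst_ehresmann e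
  · exact bijOn_snd_ehresmann hZ h𝒜 he
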